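/- Conventions. Let $R$ be a commutative ring in which $2$ is invertible, let $V$ be a finitely generated projective $R$-module with a quadratic form $q$, and for an integer $n\ge 1$ write $V(n)=(V,nq)$. $C(V)$ is the $\mathbf Z/2$-graded Clifford algebra, and $C^{0,r}$ is the Clifford algebra of $R^r$ with the form $\sum x_i^2$. Tensor products of graded objects are graded (sign rule). For a $\mathbf Z/2$-graded algebra $A$, $K(A)$ denotes the graded Grothendieck group, the cokernel of the restriction map from the Grothendieck group of finitely generated projective $A\otimes C^{0,2}$-modules to that of finitely generated projective $A\otimes C^{0,1}$-modules. Since $2$ is invertible, $K(A)$ is the Grothendieck group of finitely generated projective graded $A$-modules modulo the classes of those modules $M$ that carry an $R$-linear odd involution $\eta$ (that is, $\eta^2=1$ and $\eta$ anticommutes with the grading involution) with $\eta(ax)=(-1)^{\deg a}a\,\eta(x)$ for homogeneous $a\in A$. If $M$ and $N$ are finitely generated projective graded modules over $C(V(a))$ and $C(V(b))$, and $a+b$ is invertible in $R$, then $M\otimes N$ is a $C(V(a+b))$-module through the diagonal $V(a+b)\to V(a)\oplus V(b)$; it is finitely generated projective, and this defines a bilinear cup-product $K(C(V(a)))\times K(C(V(b)))\to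 K(C(V(a+b)))$. For a graded $C(V)$-module $E$, the tensor power $E^{\otimes n}$ is a graded $C(V(n))$-module through the diagonal $V(n)\to V^n$, and the symmetric group $S_n$ acts on it by permutation of the factors with the sign rule. The exterior power $\lambda^n(E)$ is the quotient of $E^{\otimes n}$ by the elements $m-\varepsilon(\sigma)m^\sigma$, $\sigma\in S_n$, $\varepsilon$ being the signature. If $n!$ is invertible in $R$, the Adams operation is $\Psi^n(E)=Q_n(\lambda^1(E),\dots,\lambda^n(E))\in K(C(V(n)))$, where $Q_n$ is the Newton polynomial (which expresses the $n$-th power sum through the elementary symmetric functions) and products are cup-products. Theorem. Let $k\ge 1$ be an integer such that $2k$ is invertible in $R$. Let $\Omega_k=\mathbf Z[x]/(\Phi_k(x))$, where $\Phi_k$ is the $k$-th cyclotomic polynomial, let $\omega$ be the class of $x$, and let $\zeta\in R$ be a root of $\Phi_k$. For a finitely generated projective graded $C(V)$-module $E$, let $F=E^{\otimes k}$ and let $F_{\omega^j}$ be the eigenmodule of the cyclic permutation $(1\,2\,\dots\,k)$ of $F$ for the eigenvalue $\zeta^j$. Then $F=\bigoplus_{j=0}^{k-1}F_{\omega^j}$,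 each $F_{\omega^j}$ is a finitely generated projective graded $C(V(k))$-module, and so $$\overline\Psi^k(E)=\sum_{j=0}^{k-1}F_{\omega^j}\cdot\omega^j\in K(C(V(k)))\otimes_{\mathbf Z}\Omega_k$$ is defined. (1) If $E_0$ and $E_1$ are two such modules, then, with $E_0\otimes E_1$ viewed as a $C(V(2))$-module, $\overline\Psi^k(E_0\otimes E_1)=\overline\Psi^k(E_0)\cdot\overline\Psi^k(E_1)$ in $K(C(V(2k)))\otimes_{\mathbf Z}\Omega_k$. (2) If $k$ is prime, then $K(C(V(k)))\to K(C(V(k)))\otimes_{\mathbf Z}\Omega_k$, $x\mapsto x\otimes 1$, is injective, $\overline\Psi^k(E)$ belongs to the subgroup $K(C(V(k)))$, and $\overline\Psi^k(E_0\oplus E_1)=\overline\Psi^k(E_0)+\overline\Psi^k(E_1)$ in $K(C(V(k)))$. (3) If $k!$ is invertible in $R$, then $\lambda^i(E)$ is a finitely generated projective $C(V(i))$-module for $1\le i\le k$, and $\overline\Psi^k(E)=\Psi^k(E)$, i.e. $\overline\Psi^k(E)=\Psi^k(E)\otimes 1$ in $K(C(V(k)))\otimes_{\mathbf Z}\Omega_k$.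 -/

import Mathlib

universe u

open scoped TensorProduct

noncomputable section

/-- A `ℤ/2`-graded module over the Clifford algebra `C(V, Q)`, where `2` is invertible in `R`.
The structure map of the `C(V, Q)`-module is `act`; the `ℤ/2`-grading is given by its grading
involution `gr` (`+1` on the even part and `-1` on the odd part), and `gr_act` says that the
vectors `v ∈ V ⊆ C(V, Q)` act by operators of odd degree. -/
structure CliffMod {R V : Type u} [CommRing R] [AddCommGroup V] [Module R V]
    (Q : QuadraticForm R V) : Type (u + 1) where
  carrier : Type u
  [addCommGroup : AddCommGroup carrier]
  [module : Module R carrier]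
  act : CliffordAlgebra Q →ₐ[R] Module.End R carrier
  gr : Module.End R carrier
  gr_gr : ∀ x, gr (gr x) = x
  gr_act : ∀ v x, gr (act (CliffordAlgebra.ι Q v) x) = -act (CliffordAlgebra.ι Q v) (gr x)

attribute [instance] CliffMod.addCommGroup CliffMod.module

namespace CliffMod

variable {R V W : Type u} [CommRing R] [AddCommGroup V] [Module R V] [AddCommGroup W] [Module R W]
  {Q Q₁ Q₂ Q₃ : QuadraticForm R V} {P : QuadraticForm R W}

/-- The carrier is finitely generated and projective as a module over `C(V, Q)`. -/
def IsFGP (M : CliffMod Q) : Prop :=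
  letI : Module (CliffordAlgebra Q) M.carrier := Module.compHom M.carrier M.act.toRingHom
  Module.Finite (CliffordAlgebra Q) M.carrier ∧ Module.Projective (CliffordAlgebra Q) M.carrier

/-- Isomorphisms of graded modules (of degree `0`). -/
structure Iso (M N : CliffMod Q) where
  toEquiv : M.carrier ≃ₗ[R] N.carrier
  map_act : ∀ a x, toEquiv (M.act a x) = N.act a (toEquiv x)
  map_gr : ∀ x, toEquiv (M.gr x) = N.gr (toEquiv x)

/-- Direct sum of graded modules. -/
abbrev prod (M N : CliffMod Q) : CliffMod Q where
  carrier := M.carrier × N.carrier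
  act := (LinearMap.prodMapAlgHom R M.carrier N.carrier).comp (AlgHom.prod M.act N.act)
  gr := LinearMap.prodMap M.gr N.gr
  gr_gr x := by simp [M.gr_gr, N.gr_gr]
  gr_act v x := by
    refine Prod.ext ?_ ?_
    · exact M.gr_act v x.1
    · exact N.gr_act v x.2

/-- Restriction of scalars along the morphism of Clifford algebras given by an isometry. -/
abbrev restrict (M : CliffMod P) (f : Q →qᵢ P) : CliffMod Q where
  carrier := M.carrier
  act := M.act.comp (CliffordAlgebra.map f)
  gr := M.gr
  gr_gr := M.gr_gr
  gr_act v x := by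
    simp only [AlgHom.comp_apply, CliffordAlgebra.map_apply_ι]
    exact M.gr_act _ x

/-- The graded submodule carried by an `R`-submodule stable under all operators. -/
abbrev sub (M : CliffMod Q) (N : Submodule R M.carrier) (hact : ∀ a, ∀ x ∈ N, M.act a x ∈ N)
    (hgr : ∀ x ∈ N, M.gr x ∈ N) : CliffMod Q where
  carrier := N
  act :=
    { toFun := fun a => (M.act a).restrict (hact a)
      map_one' := by ext x; simp
      map_mul' := fun a b => by ext x; simp
      map_zero' := by ext x; simp
      map_add' := fun a b => by ext x; simp
      commutes' := fun r => by ext x; simp }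
  gr := M.gr.restrict hgr
  gr_gr x := by ext; simp [M.gr_gr]
  gr_act v x := by ext; simp [M.gr_act]

/-- The graded quotient by an `R`-submodule stable under all operators. -/
abbrev quot (M : CliffMod Q) (N : Submodule R M.carrier) (hact : ∀ a, ∀ x ∈ N, M.act a x ∈ N)
    (hgr : ∀ x ∈ N, M.gr x ∈ N) : CliffMod Q where
  carrier := M.carrier ⧸ N
  act :=
    { toFun := fun a => N.mapQ N (M.act a) (hact a)
      map_one' := by ext x; simp
      map_mul' := fun a b => by ext x; simp
      map_zero' := by ext x; simp
      map_add' := fun a b => by ext x; simp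
      commutes' := fun r => by
        ext x
        simp [Module.algebraMap_end_apply] }
  gr := N.mapQ N M.gr hgr
  gr_gr x := by
    obtain ⟨x, rfl⟩ := N.mkQ_surjective x
    simp [M.gr_gr]
  gr_act v x := by
    obtain ⟨x, rfl⟩ := N.mkQ_surjective x
    simp [M.gr_act]

theorem commute_act (M : CliffMod Q) (T : Module.End R M.carrier)
    (h : ∀ v x, T (M.act (CliffordAlgebra.ι Q v) x) = M.act (CliffordAlgebra.ι Q v) (T x))
    (a : CliffordAlgebra Q) (x : M.carrier) : T (M.act a x) = M.act a (T x) := by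
  induction a using CliffordAlgebra.induction generalizing x with
  | algebraMap r => simp [Module.algebraMap_end_apply]
  | ι v => exact h v x
  | mul a b ha hb => simp [ha, hb]
  | add a b ha hb => simp [ha, hb]

theorem gr_act' (M : CliffMod Q) (a : CliffordAlgebra Q) (x : M.carrier) :
    M.gr (M.act a x) = M.act (CliffordAlgebra.involute a) (M.gr x) := by
  induction a using CliffordAlgebra.induction generalizing x with
  | algebraMap r => simp [Module.algebraMap_end_apply]
  | ι v => simp [M.gr_act]
  | mul a b ha hb => simp [ha, hb]
  | add a b ha hb => simp [ha, hb]

theorem act_ι_sq (M : CliffMod Q) (v : V) (x : M.carrier) :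
    M.act (CliffordAlgebra.ι Q v) (M.act (CliffordAlgebra.ι Q v) x) = Q v • x := by
  rw [← Module.End.mul_apply, ← map_mul, CliffordAlgebra.ι_sq_scalar, AlgHom.commutes,
    Module.algebraMap_end_apply]

section Tensor

/-- The graded tensor product of a graded `C(V, Q)`-module and a graded `C(W, P)`-module, as a
graded module over `C(V, Q) ⊗ C(W, P) = C(V ⊕ W, Q ⊕ P)`: by the sign rule, `(v, w)` acts
as `v ⊗ 1 + gr ⊗ w`. -/
abbrev extTensor (M : CliffMod Q) (N : CliffMod P) : CliffMod (Q.prod P) where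
  carrier := M.carrier ⊗[R] N.carrier
  act := CliffordAlgebra.lift (Q.prod P)
    ⟨LinearMap.coprod
        ((TensorProduct.mapBilinear (RingHom.id R) M.carrier N.carrier M.carrier
            N.carrier).flip LinearMap.id ∘ₗ
          M.act.toLinearMap ∘ₗ CliffordAlgebra.ι Q)
        (TensorProduct.mapBilinear (RingHom.id R) M.carrier N.carrier M.carrier N.carrier M.gr ∘ₗ
          N.act.toLinearMap ∘ₗ CliffordAlgebra.ι P),
      fun vw => by
        refine TensorProduct.ext' fun x y => ?_
        simp [TensorProduct.mapBilinear_apply, M.act_ι_sq, N.act_ι_sq, M.gr_act, M.gr_gr,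
          TensorProduct.neg_tmul, TensorProduct.smul_tmul']⟩
  gr := TensorProduct.map M.gr N.gr
  gr_gr x := by
    rw [← LinearMap.comp_apply, ← TensorProduct.map_comp]
    have h1 : M.gr ∘ₗ M.gr = LinearMap.id := LinearMap.ext M.gr_gr
    have h2 : N.gr ∘ₗ N.gr = LinearMap.id := LinearMap.ext N.gr_gr
    rw [h1, h2, TensorProduct.map_id, LinearMap.id_apply]
  gr_act vw x := by
    induction x using TensorProduct.induction_on with
    | zero => simp
    | add x y hx hy => simp only [map_add, hx, hy, neg_add]
    | tmul x y =>
      simp [TensorProduct.mapBilinear_apply, M.gr_act, N.gr_act, TensorProduct.neg_tmul,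
        TensorProduct.tmul_neg]
      abel

/-- The diagonal `v ↦ (v, v)`, an isometry `(V, Q₁ + Q₂) → (V, Q₁) ⊕ (V, Q₂)`. -/
def diag (h : ∀ v, Q₃ v = Q₁ v + Q₂ v) : Q₃ →qᵢ Q₁.prod Q₂ where
  toLinearMap := LinearMap.prod LinearMap.id LinearMap.id
  map_app' v := by simp [h]

/-- The tensor product of graded Clifford modules, restricted along the diagonal. -/
abbrev tensor (h : ∀ v, Q₃ v = Q₁ v + Q₂ v) (M : CliffMod Q₁) (N : CliffMod Q₂) : CliffMod Q₃ :=
  (extTensor M N).restrict (diag h)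

end Tensor

section Power

open PiTensorProduct

/-- The operator on `M^{⊗ n}` by which `v ∈ V` in the `i`-th summand of `V^n` acts: it is
`gr ⊗ ⋯ ⊗ gr ⊗ v ⊗ 1 ⊗ ⋯ ⊗ 1`, with `v` at the `i`-th place (sign rule). -/
def slot (M : CliffMod Q) {n : ℕ} (i : Fin n) (f : Module.End R M.carrier) (j : Fin n) :
    Module.End R M.carrier :=
  if j < i then M.gr else if j = i then f else 1

theorem slot_eq_update (M : CliffMod Q) {n : ℕ} (i : Fin n) (f : Module.End R M.carrier) :
    Function.update (M.slot i 0) i f = M.slot i f := by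
  funext j
  by_cases hj : j = i
  · subst hj; simp [slot]
  · simp [slot, hj]

/-- The operator `slot i v` on `M^{⊗ n}`, as a linear function of `v` (see `slotMap_apply`). -/
def slotMap (M : CliffMod Q) {n : ℕ} (i : Fin n) :
    V →ₗ[R] Module.End R (⨂[R] _ : Fin n, M.carrier) :=
  (PiTensorProduct.mapMultilinear R (fun _ : Fin n => M.carrier) fun _ => M.carrier).toLinearMap
    (M.slot i 0) i ∘ₗ M.act.toLinearMap ∘ₗ CliffordAlgebra.ι Q

theorem slotMap_apply (M : CliffMod Q) {n : ℕ} (i : Fin n) (v : V) :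
    M.slotMap i v = PiTensorProduct.map (M.slot i (M.act (CliffordAlgebra.ι Q v))) := by
  rw [← slot_eq_update]
  rfl

theorem gr_mul_gr (M : CliffMod Q) : M.gr * M.gr = 1 := LinearMap.ext M.gr_gr

theorem gr_mul_act (M : CliffMod Q) (v : V) :
    M.gr * M.act (CliffordAlgebra.ι Q v) = -(M.act (CliffordAlgebra.ι Q v) * M.gr) :=
  LinearMap.ext (M.gr_act v)

theorem map_smul_fun {n : ℕ} {X : Type u} [AddCommGroup X] [Module R X] (c : Fin n → R)
    (f : Fin n → Module.End R X) :
    (PiTensorProduct.map (fun j => c j • f j) : Module.End R (⨂[R] _ : Fin n, X)) =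
      (∏ j, c j) • (PiTensorProduct.map f : Module.End R (⨂[R] _ : Fin n, X)) :=
  (PiTensorProduct.mapMultilinear R (fun _ : Fin n => X) (fun _ => X)).map_smul_univ c f

theorem slotMap_sq (M : CliffMod Q) {n : ℕ} (i : Fin n) (v : V) :
    M.slotMap i v * M.slotMap i v = algebraMap R _ (Q v) := by
  rw [slotMap_apply, ← PiTensorProduct.map_mul]
  have : (fun j => M.slot i (M.act (CliffordAlgebra.ι Q v)) j *
      M.slot i (M.act (CliffordAlgebra.ι Q v)) j) =
      fun j => (if j = i then Q v else 1 : R) • (1 : Module.End R M.carrier) := by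
    ext j x
    rcases lt_trichotomy j i with h | h | h
    · simp [slot, h, h.ne, M.gr_gr]
    · subst h; simp [slot]
    · simp [slot, h.ne', h.not_gt]
  rw [this, map_smul_fun (R := R) _ fun _ => 1, PiTensorProduct.map_one,
    Algebra.algebraMap_eq_smul_one]
  simp

theorem slotMap_anticomm_aux (M : CliffMod Q) {n : ℕ} {i j : Fin n} (h : i < j) (v w : V) :
    M.slotMap j w * M.slotMap i v = -(M.slotMap i v * M.slotMap j w) := by
  rw [slotMap_apply, slotMap_apply, ← PiTensorProduct.map_mul, ← PiTensorProduct.map_mul]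
  have : (fun l => M.slot j (M.act (CliffordAlgebra.ι Q w)) l *
        M.slot i (M.act (CliffordAlgebra.ι Q v)) l) =
      fun l => (if l = i then -1 else 1 : R) • (M.slot i (M.act (CliffordAlgebra.ι Q v)) l *
        M.slot j (M.act (CliffordAlgebra.ι Q w)) l) := by
    funext l
    rcases lt_trichotomy l i with hl | hl | hl
    · simp [slot, hl, hl.ne, hl.trans h]
    · subst hl; simp [slot, h, M.gr_mul_act]
    · rcases lt_trichotomy l j with hj | hj | hj
      · simp [slot, hl.not_gt, hl.ne', hj]
      · subst hj; simp [slot, hl.not_gt, hl.ne']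
      · simp [slot, hl.not_gt, hl.ne', hj.not_gt, hj.ne']
  rw [this, map_smul_fun, Finset.prod_ite_eq' _ _ fun _ => (-1 : R), if_pos (Finset.mem_univ _)]
  exact neg_one_smul R (_ : Module.End R (⨂[R] _ : Fin n, M.carrier))

theorem slotMap_anticomm (M : CliffMod Q) {n : ℕ} {i j : Fin n} (h : i ≠ j) (v w : V) :
    M.slotMap i v * M.slotMap j w = -(M.slotMap j w * M.slotMap i v) := by
  rcases lt_or_gt_of_ne h with h | h
  · rw [slotMap_anticomm_aux M h, neg_neg]
  · rw [slotMap_anticomm_aux M h]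

theorem slotMap_sum_sq (M : CliffMod Q) {n : ℕ} (w : Fin n → V) (s : Finset (Fin n)) :
    (∑ i ∈ s, M.slotMap i (w i)) * (∑ i ∈ s, M.slotMap i (w i)) =
      algebraMap R _ (∑ i ∈ s, Q (w i)) := by
  classical
  induction s using Finset.induction_on with
  | empty => simp
  | insert a s ha ih =>
    have hc : M.slotMap a (w a) * (∑ i ∈ s, M.slotMap i (w i)) =
        -((∑ i ∈ s, M.slotMap i (w i)) * M.slotMap a (w a)) := by
      rw [Finset.mul_sum, Finset.sum_mul, ← Finset.sum_neg_distrib]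
      refine Finset.sum_congr rfl fun i hi => slotMap_anticomm M ?_ _ _
      rintro rfl; exact ha hi
    rw [Finset.sum_insert ha, Finset.sum_insert ha, map_add, ← ih, add_mul, mul_add, mul_add,
      slotMap_sq, hc]
    abel

/-- The graded tensor power `M^{⊗ n}`, a graded module over `C(V)^{⊗ n} = C(V^n)`. -/
abbrev extPower (M : CliffMod Q) (n : ℕ) : CliffMod (QuadraticMap.pi fun _ : Fin n => Q) where
  carrier := ⨂[R] _ : Fin n, M.carrier
  act := CliffordAlgebra.lift _
    ⟨∑ i, M.slotMap i ∘ₗ LinearMap.proj i, fun w => by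
      simpa [LinearMap.sum_apply] using slotMap_sum_sq M w Finset.univ⟩
  gr := PiTensorProduct.map fun _ => M.gr
  gr_gr x := by
    rw [← Module.End.mul_apply, ← PiTensorProduct.map_mul]
    simp [M.gr_mul_gr, PiTensorProduct.map_one]
  gr_act w x := by
    simp only [CliffordAlgebra.lift_ι_apply, LinearMap.sum_apply, LinearMap.comp_apply,
      LinearMap.proj_apply, map_sum, ← Finset.sum_neg_distrib]
    refine Finset.sum_congr rfl fun i _ => ?_
    rw [← Module.End.mul_apply, ← Module.End.mul_apply, ← LinearMap.neg_apply]
    congr 1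
    rw [slotMap_apply, ← PiTensorProduct.map_mul, ← PiTensorProduct.map_mul]
    have : (fun l => M.gr * M.slot i (M.act (CliffordAlgebra.ι Q (w i))) l) =
        fun l => (if l = i then -1 else 1 : R) •
          (M.slot i (M.act (CliffordAlgebra.ι Q (w i))) l * M.gr) := by
      funext l
      rcases lt_trichotomy l i with hl | hl | hl
      · simp [slot, hl, hl.ne]
      · subst hl; simp [slot, M.gr_mul_act]
      · simp [slot, hl.not_gt, hl.ne']
    rw [this, map_smul_fun, Finset.prod_ite_eq' _ _ fun _ => (-1 : R), if_pos (Finset.mem_univ _)]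
    exact neg_one_smul R (_ : Module.End R (⨂[R] _ : Fin n, M.carrier))

theorem extPower_act_ι (M : CliffMod Q) (n : ℕ) (w : Fin n → V) :
    (M.extPower n).act (CliffordAlgebra.ι _ w) = ∑ i, M.slotMap i (w i) := by
  refine (CliffordAlgebra.lift_ι_apply _ _ _).trans ?_
  simp [LinearMap.sum_apply]

/-- The diagonal `v ↦ (v, …, v)`, an isometry `(V, nQ) → (V, Q)^n`. -/
def diagPow {Q' : QuadraticForm R V} (n : ℕ) (h : ∀ v, Q' v = n • Q v) :
    Q' →qᵢ QuadraticMap.pi fun _ : Fin n => Q where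
  toLinearMap := LinearMap.pi fun _ => LinearMap.id
  map_app' v := by simp [h]

/-- The graded tensor power `M^{⊗ n}`, restricted along the diagonal to `C(V, nQ)`. -/
abbrev power {Q' : QuadraticForm R V} (M : CliffMod Q) (n : ℕ) (h : ∀ v, Q' v = n • Q v) :
    CliffMod Q' :=
  (M.extPower n).restrict (diagPow n h)

variable [Invertible (2 : R)]

/-- The projection of `M` onto its even part (`b = false`) or its odd part (`b = true`). -/
def proj (M : CliffMod Q) (b : Bool) : Module.End R M.carrier :=
  (⅟2 : R) • (1 + (bif b then -1 else 1 : R) • M.gr)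

/-- The sign of the permutation `σ` restricted to the places `i` with `s i = true`. -/
def koszulSign {n : ℕ} (σ : Equiv.Perm (Fin n)) (s : Fin n → Bool) : ℤˣ :=
  ∏ i, ∏ j, if (i < j ∧ σ j < σ i) ∧ s i = true ∧ s j = true then -1 else 1

/-- The action of the symmetric group on `M^{⊗ n}` by the sign rule: on a tensor
`m₁ ⊗ ⋯ ⊗ mₙ` of homogeneous elements, `σ` moves `mᵢ` to the place `σ i` and multiplies by
the sign of the permutation that it induces on the odd factors. -/
def perm (M : CliffMod Q) {n : ℕ} (σ : Equiv.Perm (Fin n)) :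
    Module.End R (⨂[R] _ : Fin n, M.carrier) :=
  ∑ s : Fin n → Bool, ((koszulSign σ s : ℤ) : R) •
    ((PiTensorProduct.reindex R (fun _ : Fin n => M.carrier) σ).toLinearMap ∘ₗ
      PiTensorProduct.map fun i => M.proj (s i))

theorem gr_mul_proj (M : CliffMod Q) (b : Bool) :
    M.gr * M.proj b = (bif b then -1 else 1 : R) • M.proj b := by
  cases b
  · simp [proj, mul_add, M.gr_mul_gr, add_comm]
  · simp [proj, mul_add, M.gr_mul_gr, add_comm]

theorem gr_mul_proj_comm (M : CliffMod Q) (b : Bool) :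
    M.proj b * M.gr = M.gr * M.proj b := by
  simp [proj, mul_add, add_mul]

theorem proj_mul_act (M : CliffMod Q) (b : Bool) (v : V) :
    M.proj b * M.act (CliffordAlgebra.ι Q v) = M.act (CliffordAlgebra.ι Q v) * M.proj (!b) := by
  cases b <;> simp [proj, mul_add, add_mul, M.gr_mul_act]

theorem koszulSign_flip {n : ℕ} (σ : Equiv.Perm (Fin n)) (s : Fin n → Bool) (i : Fin n) :
    koszulSign σ (Function.update s i (!s i)) * ∏ j, (if j < i ∧ s j = true then -1 else 1 : ℤˣ) =
      koszulSign σ s * ∏ j, (if j ≠ i ∧ σ j < σ i ∧ s j = true then -1 else 1 : ℤˣ) := by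
  have key : koszulSign σ (Function.update s i (!s i)) * koszulSign σ s =
      (∏ b, (if (i < b ∧ σ b < σ i) ∧ s b = true then -1 else 1 : ℤˣ)) *
      ∏ a, (if (a < i ∧ σ i < σ a) ∧ s a = true then -1 else 1 : ℤˣ) := by
    have h : ∀ a b : Fin n,
        (if (a < b ∧ σ b < σ a) ∧ Function.update s i (!s i) a = true ∧
            Function.update s i (!s i) b = true then -1 else 1 : ℤˣ) *
          (if (a < b ∧ σ b < σ a) ∧ s a = true ∧ s b = true then -1 else 1 : ℤˣ) =
        (if a = i then (if (i < b ∧ σ b < σ i) ∧ s b = true then -1 else 1 : ℤˣ) else 1) *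
        (if b = i then (if (a < i ∧ σ i < σ a) ∧ s a = true then -1 else 1 : ℤˣ) else 1) := by
      intro a b
      by_cases ha : a = i
      · subst ha
        by_cases hb : b = a
        · subst hb; simp
        · cases hs : s a <;> simp [hb]
      · by_cases hb : b = i
        · subst hb
          cases hs : s b <;> simp [ha]
        · rw [Function.update_of_ne ha, Function.update_of_ne hb, if_neg ha, if_neg hb, mul_one]
          exact Int.units_mul_self _
    simp only [koszulSign]
    rw [← Finset.prod_mul_distrib]
    simp only [← Finset.prod_mul_distrib, h]
    simp only [Finset.prod_mul_distrib]
    congr 1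
    · rw [Finset.prod_comm]; simp
    · simp
  have hsq : koszulSign σ s * koszulSign σ s = 1 := Int.units_mul_self _
  have h3 : koszulSign σ (Function.update s i (!s i)) = koszulSign σ s *
      ((∏ b, (if (i < b ∧ σ b < σ i) ∧ s b = true then -1 else 1 : ℤˣ)) *
      ∏ a, (if (a < i ∧ σ i < σ a) ∧ s a = true then -1 else 1 : ℤˣ)) := by
    rw [← key, mul_comm, mul_assoc, hsq, mul_one]
  rw [h3, mul_assoc, ← Finset.prod_mul_distrib, ← Finset.prod_mul_distrib]
  congr 1
  refine Finset.prod_congr rfl fun j _ => ?_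
  cases hs : s j
  · simp
  · rcases lt_trichotomy j i with h | h | h
    · rcases lt_trichotomy (σ j) (σ i) with h' | h' | h'
      · simp [h, h.not_gt, h', h'.not_gt, h.ne]
      · exact absurd (σ.injective h') h.ne
      · simp [h, h.not_gt, h', h'.not_gt, h.ne]
    · subst h; simp
    · rcases lt_trichotomy (σ j) (σ i) with h' | h' | h'
      · simp [h, h.not_gt, h', h'.not_gt, h.ne']
      · exact absurd (σ.injective h') h.ne'
      · simp [h, h.not_gt, h', h'.not_gt, h.ne']

theorem perm_slotMap (M : CliffMod Q) {n : ℕ} (σ : Equiv.Perm (Fin n)) (i : Fin n) (v : V) :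
    M.perm σ * M.slotMap i v = M.slotMap (σ i) v * M.perm σ := by
  classical
  set f := M.act (CliffordAlgebra.ι Q v) with hf
  let Y : (Fin n → Bool) → Module.End R (⨂[R] _ : Fin n, M.carrier) := fun s =>
    PiTensorProduct.map fun j => if j = i then f * M.proj (s j) else M.proj (s j)
  let ρ : Module.End R (⨂[R] _ : Fin n, M.carrier) :=
    (PiTensorProduct.reindex R (fun _ : Fin n => M.carrier) σ).toLinearMap
  have hL : ∀ s : Fin n → Bool,
      (PiTensorProduct.map fun j => M.proj (s j)) * M.slotMap i v =
      (((∏ j, (if j < i ∧ s j = true then -1 else 1 : ℤˣ) : ℤˣ) : ℤ) : R) •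
        Y (Function.update s i (!s i)) := by
    intro s
    rw [slotMap_apply, ← PiTensorProduct.map_mul]
    have : (fun j => M.proj (s j) * M.slot i f j) = fun j =>
        (if j < i ∧ s j = true then -1 else 1 : R) •
          (if j = i then f * M.proj (Function.update s i (!s i) j)
            else M.proj (Function.update s i (!s i) j)) := by
      funext j
      rcases lt_trichotomy j i with h | h | h
      · cases hs : s j <;>
        simp [slot, h, h.ne, gr_mul_proj_comm, gr_mul_proj, hs]
      · subst h; simp [slot, hf, proj_mul_act]
      · simp [slot, h.not_gt, h.ne']
    rw [← hf, this, map_smul_fun]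
    congr 1
    push_cast
    refine Finset.prod_congr rfl fun j _ => ?_
    split_ifs <;> simp
  have hR : ∀ s : Fin n → Bool,
      M.slotMap (σ i) v * (ρ * PiTensorProduct.map fun j => M.proj (s j)) =
      (((∏ j, (if j ≠ i ∧ σ j < σ i ∧ s j = true then -1 else 1 : ℤˣ) : ℤˣ) : ℤ) : R) •
        (ρ * Y s) := by
    intro s
    have h1 : M.slotMap (σ i) v * ρ = ρ * PiTensorProduct.map fun j => M.slot (σ i) f (σ j) := by
      refine PiTensorProduct.ext (MultilinearMap.ext fun x => ?_)
      simp [ρ, slotMap_apply, hf]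
    rw [← mul_assoc, h1, mul_assoc, ← PiTensorProduct.map_mul]
    have : (fun j => M.slot (σ i) f (σ j) * M.proj (s j)) = fun j =>
        (if j ≠ i ∧ σ j < σ i ∧ s j = true then -1 else 1 : R) •
          (if j = i then f * M.proj (s j) else M.proj (s j)) := by
      funext j
      by_cases h : j = i
      · subst h; simp [slot]
      · have h' : σ j ≠ σ i := fun e => h (σ.injective e)
        by_cases hlt : σ j < σ i
        · cases hs : s j <;> simp [slot, h, hlt, gr_mul_proj]
        · simp [slot, h, hlt]
    rw [this, map_smul_fun, mul_smul_comm]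
    congr 1
    push_cast
    refine Finset.prod_congr rfl fun j _ => ?_
    split_ifs <;> simp
  have hdef : M.perm σ = ∑ s : Fin n → Bool, ((koszulSign σ s : ℤ) : R) •
      (ρ * PiTensorProduct.map fun i => M.proj (s i)) := rfl
  have hinv : ∀ s : Fin n → Bool,
      Function.update (Function.update s i (!s i)) i (!(Function.update s i (!s i) i)) = s := by
    intro s; simp
  let e : (Fin n → Bool) ≃ (Fin n → Bool) :=
    ⟨fun s => Function.update s i (!s i), fun s => Function.update s i (!s i), hinv, hinv⟩
  rw [hdef, Finset.sum_mul, Finset.mul_sum]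
  rw [← Equiv.sum_comp e]
  refine Finset.sum_congr rfl fun s _ => ?_
  have h1 := hL (e s)
  have h2 := hR s
  have he : Function.update (e s) i (!(e s) i) = s := hinv s
  rw [he] at h1
  rw [smul_mul_assoc, mul_assoc, h1, mul_smul_comm, mul_smul_comm, h2, smul_smul, smul_smul]
  congr 1
  have h3 : ∏ j, (if j < i ∧ e s j = true then -1 else 1 : ℤˣ) =
      ∏ j, (if j < i ∧ s j = true then -1 else 1 : ℤˣ) := by
    refine Finset.prod_congr rfl fun j _ => ?_
    by_cases hj : j < i
    · simp [e, Function.update_of_ne hj.ne]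
    · simp [hj]
  rw [h3]
  exact_mod_cast congrArg (fun z : ℤˣ => ((z : ℤ) : R)) (koszulSign_flip σ s i)

theorem perm_act (M : CliffMod Q) {Q' : QuadraticForm R V} (n : ℕ) (h : ∀ v, Q' v = n • Q v)
    (σ : Equiv.Perm (Fin n)) (a : CliffordAlgebra Q') (x : ⨂[R] _ : Fin n, M.carrier) :
    M.perm σ ((M.power n h).act a x) = (M.power n h).act a (M.perm σ x) := by
  refine commute_act (M.power n h) (M.perm σ) (fun v x => ?_) a x
  have hv : (M.power n h).act (CliffordAlgebra.ι Q' v) = ∑ i : Fin n, M.slotMap i v := by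
    change (M.extPower n).act (CliffordAlgebra.map (diagPow n h) (CliffordAlgebra.ι Q' v)) = _
    rw [CliffordAlgebra.map_apply_ι, extPower_act_ι]
    rfl
  rw [hv, ← Module.End.mul_apply, Finset.mul_sum]
  simp only [perm_slotMap]
  rw [← Finset.sum_mul, Equiv.sum_comp σ (fun i => M.slotMap i v)]
  rfl

theorem perm_gr (M : CliffMod Q) {Q' : QuadraticForm R V} (n : ℕ) (h : ∀ v, Q' v = n • Q v)
    (σ : Equiv.Perm (Fin n)) (x : ⨂[R] _ : Fin n, M.carrier) :
    M.perm σ ((M.power n h).gr x) = (M.power n h).gr (M.perm σ x) := by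
  have hg : (M.power n h).gr = PiTensorProduct.map fun _ : Fin n => M.gr := rfl
  rw [hg]
  have key : M.perm σ * (PiTensorProduct.map fun _ : Fin n => M.gr) =
      (PiTensorProduct.map fun _ : Fin n => M.gr) * M.perm σ := ?_
  · exact LinearMap.congr_fun key x
  rw [perm, Finset.sum_mul, Finset.mul_sum]
  refine Finset.sum_congr rfl fun s _ => ?_
  rw [smul_mul_assoc, mul_smul_comm]
  congr 1
  refine PiTensorProduct.ext (MultilinearMap.ext fun x => ?_)
  have hc : ∀ b y, M.proj b (M.gr y) = M.gr (M.proj b y) := fun b y =>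
    LinearMap.congr_fun (M.gr_mul_proj_comm b) y
  simp [hc]

/-- The eigenmodule `F_μ` of the cyclic permutation `(1 2 … k)` acting on `F = M^{⊗ k}`, for the
eigenvalue `μ`, as a graded `C(V, kQ)`-module. -/
def eigen {Q' : QuadraticForm R V} (M : CliffMod Q) (k : ℕ) (h : ∀ v, Q' v = k • Q v) (μ : R) :
    CliffMod Q' :=
  (M.power k h).sub (Module.End.eigenspace (M.perm (finRotate k)) μ)
    (fun a x hx => by
      rw [Module.End.mem_eigenspace_iff] at hx ⊢
      exact (M.perm_act k h _ a x).trans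
        ((congrArg _ hx).trans (map_smul ((M.power k h).act a) μ x)))
    (fun x hx => by
      rw [Module.End.mem_eigenspace_iff] at hx ⊢
      exact (M.perm_gr k h _ x).trans ((congrArg _ hx).trans (map_smul (M.power k h).gr μ x)))

/-- The `R`-submodule of `M^{⊗ n}` spanned by the elements `m - ε(σ) m^σ`. -/
def extRel (M : CliffMod Q) (n : ℕ) : Submodule R (⨂[R] _ : Fin n, M.carrier) :=
  Submodule.span R {y | ∃ (σ : Equiv.Perm (Fin n)) (m : ⨂[R] _ : Fin n, M.carrier),
    y = m - ((Equiv.Perm.sign σ : ℤ) : R) • M.perm σ m}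

/-- The graded exterior power `λⁿ(M)`, a graded `C(V, nQ)`-module. -/
def lambda {Q' : QuadraticForm R V} (M : CliffMod Q) (n : ℕ) (h : ∀ v, Q' v = n • Q v) :
    CliffMod Q' :=
  (M.power n h).quot (M.extRel n)
    (fun a x hx => by
      refine Submodule.span_induction (p := fun y _ => (M.power n h).act a y ∈ M.extRel n)
        ?_ ?_ ?_ ?_ hx
      · rintro _ ⟨σ, m, rfl⟩
        refine Submodule.subset_span ⟨σ, (M.power n h).act a m, ?_⟩
        rw [perm_act]
        exact (map_sub ((M.power n h).act a) _ _).trans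
          (congrArg _ (map_smul ((M.power n h).act a) _ _))
      · exact (congrArg (· ∈ M.extRel n) (map_zero ((M.power n h).act a))).mpr (zero_mem _)
      · intro y z _ _ hy hz
        exact (congrArg (· ∈ M.extRel n) (map_add ((M.power n h).act a) y z)).mpr
          (add_mem hy hz)
      · intro r y _ hy
        exact (congrArg (· ∈ M.extRel n) (map_smul ((M.power n h).act a) r y)).mpr
          (Submodule.smul_mem _ r hy))
    (fun x hx => by
      refine Submodule.span_induction (p := fun y _ => (M.power n h).gr y ∈ M.extRel n)
        ?_ ?_ ?_ ?_ hx
      · rintro _ ⟨σ, m, rfl⟩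
        refine Submodule.subset_span ⟨σ, (M.power n h).gr m, ?_⟩
        rw [perm_gr]
        exact (map_sub (M.power n h).gr _ _).trans (congrArg _ (map_smul (M.power n h).gr _ _))
      · exact (congrArg (· ∈ M.extRel n) (map_zero (M.power n h).gr)).mpr (zero_mem _)
      · intro y z _ _ hy hz
        exact (congrArg (· ∈ M.extRel n) (map_add (M.power n h).gr y z)).mpr (add_mem hy hz)
      · intro r y _ hy
        exact (congrArg (· ∈ M.extRel n) (map_smul (M.power n h).gr r y)).mpr
          (Submodule.smul_mem _ r hy))

end Power

section Projectivity

open CliffordAlgebra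

/-- `C(V, Q)` as a graded module over itself. -/
abbrev reg (Q : QuadraticForm R V) : CliffMod Q where
  carrier := CliffordAlgebra Q
  act := Algebra.lmul R (CliffordAlgebra Q)
  gr := (involute (Q := Q)).toLinearMap
  gr_gr x := involute_involute x
  gr_act v x := by simp

/-- Linear maps commuting with the Clifford action (and not necessarily with the grading). -/
def Hom (M N : CliffMod Q) : Type u :=
  {f : M.carrier →ₗ[R] N.carrier // ∀ v x, f (M.act (ι Q v) x) = N.act (ι Q v) (f x)}

theorem Hom.map_act {M N : CliffMod Q} (f : Hom M N) (a : CliffordAlgebra Q) (x : M.carrier) :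
    f.1 (M.act a x) = N.act a (f.1 x) := by
  induction a using CliffordAlgebra.induction generalizing x with
  | algebraMap r => simp [Module.algebraMap_end_apply]
  | ι v => exact f.2 v x
  | mul a b ha hb => simp [ha, hb]
  | add a b ha hb => simp [ha, hb]

/-- `M` is a direct summand of a finite direct sum of copies of `N`. -/
def Retr (M N : CliffMod Q) : Prop :=
  ∃ (κ : Type) (_ : Fintype κ) (i : κ → Hom M N) (p : κ → Hom N M),
    ∀ x, ∑ j, (p j).1 ((i j).1 x) = x

theorem Retr.trans {M N K : CliffMod Q} (h₁ : Retr M N) (h₂ : Retr N K) : Retr M K := by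
  obtain ⟨κ, _, i, p, h⟩ := h₁
  obtain ⟨κ', _, i', p', h'⟩ := h₂
  refine ⟨κ × κ', inferInstance,
    fun j => ⟨(i' j.2).1 ∘ₗ (i j.1).1, fun v x => by simp [(i j.1).2, (i' j.2).2]⟩,
    fun j => ⟨(p j.1).1 ∘ₗ (p' j.2).1, fun v x => by simp [(p j.1).2, (p' j.2).2]⟩, fun x => ?_⟩
  simp only [LinearMap.comp_apply, Fintype.sum_prod_type]
  calc _ = ∑ j, (p j).1 (∑ l, (p' l).1 ((i' l).1 ((i j).1 x))) := by simp only [map_sum]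
    _ = x := by simp only [h', h]

theorem Retr.of_leftInverse {M N : CliffMod Q} (f : Hom M N) (g : Hom N M)
    (h : ∀ x, g.1 (f.1 x) = x) : Retr M N :=
  ⟨Unit, inferInstance, fun _ => f, fun _ => g, fun x => by simp [h]⟩

theorem isFGP_iff (M : CliffMod Q) : M.IsFGP ↔ Retr M (reg Q) := by
  let _ : Module (CliffordAlgebra Q) M.carrier := Module.compHom M.carrier M.act.toRingHom
  have hsm : ∀ (a : CliffordAlgebra Q) (x : M.carrier), a • x = M.act a x := fun _ _ => rfl
  have : IsScalarTower R (CliffordAlgebra Q) M.carrier := ⟨fun r a x => by simp [hsm]⟩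
  change Module.Finite (CliffordAlgebra Q) M.carrier ∧
    Module.Projective (CliffordAlgebra Q) M.carrier ↔ _
  constructor
  · rintro ⟨_, _⟩
    obtain ⟨n, f, g, -, -, hfg⟩ :=
      Module.Finite.exists_comp_eq_id_of_projective (CliffordAlgebra Q) M.carrier
    refine ⟨Fin n, inferInstance,
      fun j => ⟨(LinearMap.proj j ∘ₗ g).restrictScalars R, fun v x => ?_⟩,
      fun j => ⟨(f ∘ₗ LinearMap.single (CliffordAlgebra Q) (fun _ : Fin n => CliffordAlgebra Q)
        j).restrictScalars R, fun v x => ?_⟩, fun x => ?_⟩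
    · have := congrFun (map_smul g (ι Q v) x) j
      exact this
    · have := map_smul (f ∘ₗ LinearMap.single (CliffordAlgebra Q)
        (fun _ : Fin n => CliffordAlgebra Q) j) (ι Q v) x
      exact this
    · have h1 := LinearMap.congr_fun hfg x
      simp only [LinearMap.comp_apply, LinearMap.id_apply] at h1
      conv_rhs => rw [← h1, ← LinearMap.sum_single_apply (fun _ : Fin n => CliffordAlgebra Q) (g x)]
      rw [map_sum]
      rfl
  · rintro ⟨κ, _, i, p, h⟩
    let I : M.carrier →ₗ[CliffordAlgebra Q] (κ → CliffordAlgebra Q) :=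
      { toFun := fun x j => (i j).1 x
        map_add' := fun x y => by ext j; simp
        map_smul' := fun a x => by
          funext j
          exact (i j).map_act a x }
    let P : (κ → CliffordAlgebra Q) →ₗ[CliffordAlgebra Q] M.carrier :=
      { toFun := fun y => ∑ j, (p j).1 (y j)
        map_add' := fun x y => by simp [Finset.sum_add_distrib]
        map_smul' := fun a y => by
          rw [RingHom.id_apply, Finset.smul_sum]
          exact Finset.sum_congr rfl fun j _ => (p j).map_act a (y j) }
    have hPI : P ∘ₗ I = LinearMap.id := LinearMap.ext h
    exact ⟨Module.Finite.of_surjective P fun x => ⟨I x, LinearMap.congr_fun hPI x⟩,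
      Module.Projective.of_split I P hPI⟩

theorem IsFGP.prod {M N : CliffMod Q} (hM : M.IsFGP) (hN : N.IsFGP) : (M.prod N).IsFGP := by
  rw [isFGP_iff] at *
  obtain ⟨κ, _, i, p, h⟩ := hM
  obtain ⟨κ', _, i', p', h'⟩ := hN
  refine ⟨κ ⊕ κ', inferInstance, Sum.elim
      (fun j => ⟨(i j).1 ∘ₗ LinearMap.fst R M.carrier N.carrier, fun v x => (i j).2 v x.1⟩)
      (fun j => ⟨(i' j).1 ∘ₗ LinearMap.snd R M.carrier N.carrier, fun v x => (i' j).2 v x.2⟩),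
    Sum.elim
      (fun j => ⟨LinearMap.inl R M.carrier N.carrier ∘ₗ (p j).1, fun v x => ?_⟩)
      (fun j => ⟨LinearMap.inr R M.carrier N.carrier ∘ₗ (p' j).1, fun v x => ?_⟩), fun x => ?_⟩
  · exact Prod.ext ((p j).2 v x) (map_zero (N.act (ι Q v))).symm
  · exact Prod.ext (map_zero (M.act (ι Q v))).symm ((p' j).2 v x)
  · rw [Fintype.sum_sum_type]
    have h1 : ∑ j, LinearMap.inl R M.carrier N.carrier ((p j).1 ((i j).1 x.1)) =
        LinearMap.inl R M.carrier N.carrier x.1 := by rw [← map_sum, h]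
    have h2 : ∑ j, LinearMap.inr R M.carrier N.carrier ((p' j).1 ((i' j).1 x.2)) =
        LinearMap.inr R M.carrier N.carrier x.2 := by rw [← map_sum, h']
    refine (congrArg₂ (· + ·) h1 h2).trans ?_
    simp

theorem extTensor_act_ι (M : CliffMod Q) (N : CliffMod P) (v : V) (w : W) (x : M.carrier)
    (y : N.carrier) : (extTensor M N).act (ι _ (v, w)) (x ⊗ₜ[R] y) =
      M.act (ι Q v) x ⊗ₜ y + M.gr x ⊗ₜ N.act (ι P w) y := by
  refine (LinearMap.congr_fun (CliffordAlgebra.lift_ι_apply _ _ _) _).trans ?_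
  simp [TensorProduct.mapBilinear_apply]

theorem tensor_act_ι (h : ∀ v, Q₃ v = Q₁ v + Q₂ v) (M : CliffMod Q₁) (N : CliffMod Q₂) (v : V)
    (x : M.carrier) (y : N.carrier) : (tensor h M N).act (ι _ v) (x ⊗ₜ[R] y) =
      M.act (ι _ v) x ⊗ₜ y + M.gr x ⊗ₜ N.act (ι _ v) y := by
  have := extTensor_act_ι M N v v x y
  rw [← this]
  exact congrArg (fun a => (extTensor M N).act a (x ⊗ₜ[R] y))
    (CliffordAlgebra.map_apply_ι (diag h) v)

theorem Retr.tensor_right (h : ∀ v, Q₃ v = Q₁ v + Q₂ v) (M : CliffMod Q₁) {N N' : CliffMod Q₂}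
    (hN : Retr N N') : Retr (tensor h M N) (tensor h M N') := by
  obtain ⟨κ, _, i, p, hip⟩ := hN
  have hom : ∀ {K L : CliffMod Q₂} (f : Hom K L) (v : V) (x : M.carrier ⊗[R] K.carrier),
      TensorProduct.map LinearMap.id f.1 ((tensor h M K).act (ι _ v) x) =
      (tensor h M L).act (ι _ v) (TensorProduct.map LinearMap.id f.1 x) := by
    intro K L f v x
    induction x using TensorProduct.induction_on with
    | zero => simp only [map_zero]
    | add x y hx hy => simp only [map_add, hx, hy]
    | tmul x y =>
      rw [tensor_act_ι, TensorProduct.map_tmul, tensor_act_ι, map_add, TensorProduct.map_tmul,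
        TensorProduct.map_tmul, f.2]
      rfl
  refine ⟨κ, inferInstance, fun j => ⟨TensorProduct.map LinearMap.id (i j).1, hom (i j)⟩,
    fun j => ⟨TensorProduct.map LinearMap.id (p j).1, hom (p j)⟩, fun x => ?_⟩
  induction x using TensorProduct.induction_on with
  | zero => simp only [map_zero, Finset.sum_const_zero]
  | add x y hx hy => simp only [map_add, Finset.sum_add_distrib] at *; rw [hx, hy]
  | tmul x y =>
    simp only [TensorProduct.map_tmul, LinearMap.id_apply]
    rw [← TensorProduct.tmul_sum, hip]

section Swap

variable [Invertible (2 : R)]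

/-- The graded interchange of factors `m ⊗ n ↦ (-1)^{deg m deg n} n ⊗ m`. -/
def swap (M : CliffMod Q₁) (N : CliffMod Q₂) :
    M.carrier ⊗[R] N.carrier →ₗ[R] N.carrier ⊗[R] M.carrier :=
  (⅟2 : R) • ((TensorProduct.comm R M.carrier N.carrier).toLinearMap ∘ₗ
    (LinearMap.id + TensorProduct.map M.gr LinearMap.id + TensorProduct.map LinearMap.id N.gr -
      TensorProduct.map M.gr N.gr))

theorem swap_tmul (M : CliffMod Q₁) (N : CliffMod Q₂) (x : M.carrier) (y : N.carrier) :
    swap M N (x ⊗ₜ y) = (⅟2 : R) • (y ⊗ₜ x + y ⊗ₜ M.gr x + N.gr y ⊗ₜ x - N.gr y ⊗ₜ M.gr x) := by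
  simp [swap]

theorem swap_swap (M : CliffMod Q₁) (N : CliffMod Q₂) (x : M.carrier ⊗[R] N.carrier) :
    swap N M (swap M N x) = x := by
  induction x using TensorProduct.induction_on with
  | zero => simp only [map_zero]
  | add x y hx hy => simp only [map_add, hx, hy]
  | tmul x y =>
    simp only [swap_tmul, map_smul, map_add, map_sub, M.gr_gr, N.gr_gr]
    have h4 : (⅟2 : R) * ⅟2 * 4 = 1 := by
      have h2 : (⅟2 : R) * 2 = 1 := invOf_mul_self 2
      linear_combination (⅟2 * 2 + 1) * h2
    conv_rhs => rw [← one_smul R (x ⊗ₜ[R] y), ← h4]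
    module

theorem swap_act (h : ∀ v, Q₃ v = Q₁ v + Q₂ v) (h' : ∀ v, Q₃ v = Q₂ v + Q₁ v) (M : CliffMod Q₁)
    (N : CliffMod Q₂) (v : V) (x : M.carrier ⊗[R] N.carrier) :
    swap M N ((tensor h M N).act (ι _ v) x) = (tensor h' N M).act (ι _ v) (swap M N x) := by
  induction x using TensorProduct.induction_on with
  | zero => simp only [map_zero]
  | add x y hx hy => simp only [map_add, hx, hy]
  | tmul x y =>
    rw [tensor_act_ι, map_add, swap_tmul, swap_tmul, swap_tmul, map_smul, map_sub, map_add,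
      map_add, tensor_act_ι, tensor_act_ι, tensor_act_ι, tensor_act_ι]
    simp only [M.gr_gr, N.gr_gr, M.gr_act, N.gr_act, TensorProduct.neg_tmul,
      TensorProduct.tmul_neg]
    module

theorem Retr.swap (h : ∀ v, Q₃ v = Q₁ v + Q₂ v) (h' : ∀ v, Q₃ v = Q₂ v + Q₁ v) (M : CliffMod Q₁)
    (N : CliffMod Q₂) : Retr (tensor h M N) (tensor h' N M) :=
  Retr.of_leftInverse ⟨CliffMod.swap M N, swap_act h h' M N⟩ ⟨CliffMod.swap N M, swap_act h' h N M⟩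
    (swap_swap M N)

end Swap

theorem inr_mul_inl (w : W) (a : CliffordAlgebra Q) :
    CliffordAlgebra.map (QuadraticMap.Isometry.inr Q P) (ι P w) *
        CliffordAlgebra.map (QuadraticMap.Isometry.inl Q P) a =
      CliffordAlgebra.map (QuadraticMap.Isometry.inl Q P) (involute a) *
        CliffordAlgebra.map (QuadraticMap.Isometry.inr Q P) (ι P w) := by
  induction a using CliffordAlgebra.induction with
  | algebraMap r => simp only [AlgHom.commutes]; exact (Algebra.commutes _ _).symm
  | ι v =>
    rw [involute_ι, map_neg, map_apply_ι, map_apply_ι, neg_mul]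
    refine ι_mul_ι_comm_of_isOrtho ?_
    exact (QuadraticMap.IsOrtho.inl_inr v w).symm
  | mul a b ha hb => rw [map_mul, ← mul_assoc, ha, mul_assoc, hb, map_mul, map_mul, mul_assoc]
  | add a b ha hb => simp only [map_add, mul_add, add_mul, ha, hb]

/-- The map `C(V) ⊗ C(W) → C(V ⊕ W)`. -/
def regProd (Q : QuadraticForm R V) (P : QuadraticForm R W) :
    CliffordAlgebra Q ⊗[R] CliffordAlgebra P →ₗ[R] CliffordAlgebra (Q.prod P) :=
  TensorProduct.lift ((LinearMap.mul R _).compl₁₂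
    (CliffordAlgebra.map (QuadraticMap.Isometry.inl Q P)).toLinearMap
    (CliffordAlgebra.map (QuadraticMap.Isometry.inr Q P)).toLinearMap)

theorem regProd_tmul (a : CliffordAlgebra Q) (b : CliffordAlgebra P) :
    regProd Q P (a ⊗ₜ b) = CliffordAlgebra.map (QuadraticMap.Isometry.inl Q P) a *
      CliffordAlgebra.map (QuadraticMap.Isometry.inr Q P) b := by
  simp [regProd]

/-- `regProd` is linear over `C(V ⊕ W)`. -/
def regProdHom (Q : QuadraticForm R V) (P : QuadraticForm R W) :
    Hom (extTensor (reg Q) (reg P)) (reg (Q.prod P)) :=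
  ⟨regProd Q P, fun vw x => by
    obtain ⟨v, w⟩ := vw
    induction x using TensorProduct.induction_on with
    | zero => simp only [map_zero]
    | add x y hx hy => simp only [map_add, hx, hy]
    | tmul a b =>
      rw [extTensor_act_ι, map_add]
      change regProd Q P ((ι Q v * a) ⊗ₜ b) + regProd Q P (involute a ⊗ₜ (ι P w * b)) =
        ι (Q.prod P) (v, w) * regProd Q P (a ⊗ₜ b)
      have hvw : ι (Q.prod P) (v, w) = CliffordAlgebra.map (QuadraticMap.Isometry.inl Q P) (ι Q v) +
          CliffordAlgebra.map (QuadraticMap.Isometry.inr Q P) (ι P w) := by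
        rw [map_apply_ι, map_apply_ι, ← map_add]
        simp
      rw [hvw, add_mul]
      simp only [regProd_tmul, map_mul]
      simp only [← mul_assoc]
      rw [inr_mul_inl]⟩

/-- The map `C(V ⊕ W) → C(V) ⊗ C(W)`, `s ↦ s · (1 ⊗ 1)`. -/
def regProdInv (Q : QuadraticForm R V) (P : QuadraticForm R W) :
    Hom (reg (Q.prod P)) (extTensor (reg Q) (reg P)) :=
  ⟨(LinearMap.applyₗ ((1 : CliffordAlgebra Q) ⊗ₜ[R] (1 : CliffordAlgebra P))) ∘ₗ
      (extTensor (reg Q) (reg P)).act.toLinearMap, fun vw x => by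
    change (extTensor (reg Q) (reg P)).act (ι _ vw * x) _ = _
    rw [map_mul]
    rfl⟩

theorem regProdInv_regProd (x : CliffordAlgebra Q ⊗[R] CliffordAlgebra P) :
    (regProdInv Q P).1 (regProd Q P x) = x := by
  have hl : ∀ (a c : CliffordAlgebra Q) (d : CliffordAlgebra P),
      (extTensor (reg Q) (reg P)).act (CliffordAlgebra.map (QuadraticMap.Isometry.inl Q P) a)
        (c ⊗ₜ[R] d) = (a * c) ⊗ₜ d := by
    intro a
    induction a using CliffordAlgebra.induction with
    | algebraMap r =>
      intro c d
      rw [AlgHom.commutes, AlgHom.commutes, Module.algebraMap_end_apply, ← Algebra.smul_def,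
        TensorProduct.smul_tmul']
    | ι v =>
      intro c d
      rw [map_apply_ι, QuadraticMap.Isometry.inl_apply, extTensor_act_ι]
      simp
    | mul a b ha hb =>
      intro c d
      rw [map_mul, map_mul, Module.End.mul_apply, hb, ha, mul_assoc]
    | add a b ha hb =>
      intro c d
      rw [map_add, map_add, LinearMap.add_apply, hb, ha, add_mul, TensorProduct.add_tmul]
  have hr : ∀ (b d : CliffordAlgebra P),
      (extTensor (reg Q) (reg P)).act (CliffordAlgebra.map (QuadraticMap.Isometry.inr Q P) b)
        ((1 : CliffordAlgebra Q) ⊗ₜ[R] d) = 1 ⊗ₜ (b * d) := by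
    intro a
    induction a using CliffordAlgebra.induction with
    | algebraMap r =>
      intro d
      rw [AlgHom.commutes, AlgHom.commutes, Module.algebraMap_end_apply, ← Algebra.smul_def,
        TensorProduct.tmul_smul]
    | ι v =>
      intro d
      rw [map_apply_ι, QuadraticMap.Isometry.inr_apply, extTensor_act_ι]
      simp
    | mul a b ha hb =>
      intro d
      rw [map_mul, map_mul, Module.End.mul_apply, hb, ha, mul_assoc]
    | add a b ha hb =>
      intro d
      rw [map_add, map_add, LinearMap.add_apply, hb, ha, add_mul, TensorProduct.tmul_add]
  induction x using TensorProduct.induction_on with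
  | zero => simp only [map_zero]
  | add x y hx hy => simp only [map_add, hx, hy]
  | tmul a b =>
    rw [regProd_tmul]
    change (extTensor (reg Q) (reg P)).act (_ * _) ((1 : CliffordAlgebra Q) ⊗ₜ[R] 1) = _
    rw [map_mul, Module.End.mul_apply, hr, hl, mul_one, mul_one]

theorem regProd_regProdInv (s : CliffordAlgebra (Q.prod P)) :
    regProd Q P ((regProdInv Q P).1 s) = s := by
  refine ((regProdHom Q P).map_act s ((1 : CliffordAlgebra Q) ⊗ₜ[R] 1)).trans ?_
  change s * regProd Q P (1 ⊗ₜ 1) = s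
  rw [regProd_tmul, map_one, map_one, mul_one, mul_one]

/-- Restriction of module maps along an isometry. -/
def Hom.restrict {M N : CliffMod P} (f : Hom M N) (g : Q →qᵢ P) :
    Hom (M.restrict g) (N.restrict g) :=
  ⟨f.1, fun v x => f.map_act (CliffordAlgebra.map g (ι Q v)) x⟩

/-- For `c = a + b` invertible, `V(b) ⊕ V(a)` is the orthogonal sum of the diagonal `V(c)` and
of a copy of `V(abc)`. -/
def splitTo (Q : QuadraticForm R V) {a b c : ℕ} (h : a + b = c) :
    (c • Q).prod ((a * b * c) • Q) →qᵢ (b • Q).prod (a • Q) where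
  toLinearMap := LinearMap.prod
    (LinearMap.fst R V V + (a : R) • LinearMap.snd R V V)
    (LinearMap.fst R V V - (b : R) • LinearMap.snd R V V)
  map_app' x := by
    obtain ⟨v, w⟩ := x
    have h1 : Q (v + (a : R) • w) =
        Q v + (a : R) * (a : R) * Q w + (a : R) * QuadraticMap.polar Q v w := by
      rw [QuadraticMap.map_add Q, QuadraticMap.map_smul, QuadraticMap.polar_smul_right]
      simp
    have h2 : Q (v - (b : R) • w) =
        Q v + (b : R) * (b : R) * Q w - (b : R) * QuadraticMap.polar Q v w := by
      rw [sub_eq_add_neg, QuadraticMap.map_add Q, QuadraticMap.map_neg, QuadraticMap.map_smul,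
        QuadraticMap.polar_neg_right, QuadraticMap.polar_smul_right]
      simp [sub_eq_add_neg]
    subst h
    change (b • Q) (v + (a : R) • w) + (a • Q) (v - (b : R) • w) =
      ((a + b) • Q) v + ((a * b * (a + b)) • Q) w
    simp only [smul_apply, h1, h2, nsmul_eq_mul]
    push_cast
    ring

/-- The inverse of `splitTo`. -/
def splitInv (Q : QuadraticForm R V) {a b c : ℕ} (h : a + b = c) (u : Rˣ) (hu : (u : R) = c) :
    (b • Q).prod (a • Q) →qᵢ (c • Q).prod ((a * b * c) • Q) where
  toLinearMap := LinearMap.prod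
    (LinearMap.fst R V V - ((a : R) * (u⁻¹ : Rˣ)) • (LinearMap.fst R V V - LinearMap.snd R V V))
    (((u⁻¹ : Rˣ) : R) • (LinearMap.fst R V V - LinearMap.snd R V V))
  map_app' x := by
    obtain ⟨v, w⟩ := x
    have hc : (((u⁻¹ : Rˣ) : R) * ((a : R) + b)) • (v - w) = v - w := by
      rw [← Nat.cast_add, h, ← hu, Units.inv_mul, one_smul]
    refine ((splitTo Q h).map_app _).symm.trans (congrArg _ (Prod.ext ?_ ?_))
    · change v - ((a : R) * (u⁻¹ : Rˣ)) • (v - w) + (a : R) • (((u⁻¹ : Rˣ) : R) • (v - w)) = v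
      module
    · change v - ((a : R) * (u⁻¹ : Rˣ)) • (v - w) - (b : R) • (((u⁻¹ : Rˣ) : R) • (v - w)) = w
      calc _ = v - (((u⁻¹ : Rˣ) : R) * ((a : R) + b)) • (v - w) := by module
        _ = w := by rw [hc, sub_sub_cancel]

theorem splitTo_splitInv (Q : QuadraticForm R V) {a b c : ℕ} (h : a + b = c) (u : Rˣ)
    (hu : (u : R) = c) (x : V × V) : splitTo Q h (splitInv Q h u hu x) = x := by
  obtain ⟨v, w⟩ := x
  have hc : (((u⁻¹ : Rˣ) : R) * ((a : R) + b)) • (v - w) = v - w := by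
    rw [← Nat.cast_add, h, ← hu, Units.inv_mul, one_smul]
  refine Prod.ext ?_ ?_
  · change v - ((a : R) * (u⁻¹ : Rˣ)) • (v - w) + (a : R) • (((u⁻¹ : Rˣ) : R) • (v - w)) = v
    module
  · change v - ((a : R) * (u⁻¹ : Rˣ)) • (v - w) - (b : R) • (((u⁻¹ : Rˣ) : R) • (v - w)) = w
    calc _ = v - (((u⁻¹ : Rˣ) : R) * ((a : R) + b)) • (v - w) := by module
      _ = w := by rw [hc, sub_sub_cancel]

section Clifford

variable [Invertible (2 : R)] [Module.Finite R V] [Module.Projective R V]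

theorem finite_retract_cliffordAlgebra (Q : QuadraticForm R V) :
    ∃ (κ : Type) (_ : Fintype κ) (i : κ → CliffordAlgebra Q →ₗ[R] R) (p : κ → CliffordAlgebra Q),
      ∀ x, ∑ j, i j x • p j = x := by
  obtain ⟨n, f, g, -, -, hfg⟩ := Module.Finite.exists_comp_eq_id_of_projective R V
  let b := (Pi.basisFun R (Fin n)).ExteriorAlgebra
  let e := CliffordAlgebra.equivExterior Q
  have hc : ∀ x, ExteriorAlgebra.map f (ExteriorAlgebra.map g x) = x := by
    intro x
    rw [← AlgHom.comp_apply, ExteriorAlgebra.map_comp_map, hfg, ExteriorAlgebra.map_id]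
    rfl
  refine ⟨Finset (Fin n), inferInstance,
    fun s => b.coord s ∘ₗ (ExteriorAlgebra.map g).toLinearMap ∘ₗ e.toLinearMap,
    fun s => e.symm (ExteriorAlgebra.map f (b s)), fun x => ?_⟩
  have h1 := b.sum_repr (ExteriorAlgebra.map g (e x))
  apply e.injective
  conv_rhs => rw [← hc (e x), ← h1]
  simp only [map_sum, map_smul, LinearEquiv.apply_symm_apply]
  rfl

theorem retr_restrict_inl (Q P : QuadraticForm R V) :
    Retr ((extTensor (reg Q) (reg P)).restrict (QuadraticMap.Isometry.inl Q P)) (reg Q) := by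
  obtain ⟨κ, _, i, p, hip⟩ := finite_retract_cliffordAlgebra P
  have hact : ∀ (v : V) (x : CliffordAlgebra Q) (y : CliffordAlgebra P),
      ((extTensor (reg Q) (reg P)).restrict (QuadraticMap.Isometry.inl Q P)).act (ι Q v)
        (x ⊗ₜ[R] y) = (ι Q v * x) ⊗ₜ y := by
    intro v x y
    change (extTensor (reg Q) (reg P)).act (CliffordAlgebra.map _ (ι Q v)) (x ⊗ₜ[R] y) = _
    rw [map_apply_ι, QuadraticMap.Isometry.inl_apply, extTensor_act_ι]
    simp
  refine ⟨κ, inferInstance,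
    fun j => ⟨(TensorProduct.rid R (CliffordAlgebra Q)).toLinearMap ∘ₗ
      TensorProduct.map LinearMap.id (i j), fun v x => ?_⟩,
    fun j => ⟨(TensorProduct.mk R (CliffordAlgebra Q) (CliffordAlgebra P)).flip (p j),
      fun v x => (hact v x (p j)).symm⟩, fun x => ?_⟩
  · induction x using TensorProduct.induction_on with
    | zero => simp only [map_zero]
    | add x y hx hy => simp only [map_add, hx, hy]
    | tmul x y =>
      rw [hact]
      simp
  · induction x using TensorProduct.induction_on with
    | zero => simp only [map_zero, Finset.sum_const_zero]
    | add x y hx hy => simp only [map_add, Finset.sum_add_distrib] at *; rw [hx, hy]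
    | tmul x y =>
      conv_rhs => rw [← hip y, TensorProduct.tmul_sum]
      refine Finset.sum_congr rfl fun j _ => ?_
      simp

theorem retr_reg_tensor_reg (Q : QuadraticForm R V) {a b c : ℕ} (h : a + b = c)
    (hc : IsUnit (c : R)) (h' : ∀ v, (c • Q) v = (b • Q) v + (a • Q) v) :
    Retr (tensor h' (reg (b • Q)) (reg (a • Q))) (reg (c • Q)) := by
  obtain ⟨u, hu⟩ := hc
  let inl := QuadraticMap.Isometry.inl (c • Q) ((a * b * c) • Q)
  have hinl : ∀ v, splitTo Q h (inl v) = diag h' v := by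
    intro v
    refine Prod.ext ?_ ?_
    · change v + (a : R) • (0 : V) = v
      rw [smul_zero, add_zero]
    · change v - (b : R) • (0 : V) = v
      rw [smul_zero, sub_zero]
  have hdiag : ∀ v, splitInv Q h u hu (diag h' v) = inl v := by
    intro v
    refine Prod.ext ?_ ?_
    · change v - ((a : R) * (u⁻¹ : Rˣ)) • (v - v) = v
      rw [sub_self, smul_zero, sub_zero]
    · change ((u⁻¹ : Rˣ) : R) • (v - v) = 0
      rw [sub_self, smul_zero]
  have h1 : Retr (tensor h' (reg (b • Q)) (reg (a • Q)))
      ((reg ((b • Q).prod (a • Q))).restrict (diag h')) :=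
    Retr.of_leftInverse ((regProdHom _ _).restrict _) ((regProdInv _ _).restrict _)
      regProdInv_regProd
  have h2 : Retr ((reg ((b • Q).prod (a • Q))).restrict (diag h'))
      ((reg ((c • Q).prod ((a * b * c) • Q))).restrict inl) := by
    refine Retr.of_leftInverse
      ⟨(CliffordAlgebra.map (splitInv Q h u hu)).toLinearMap, fun v x => ?_⟩
      ⟨(CliffordAlgebra.map (splitTo Q h)).toLinearMap, fun v x => ?_⟩ fun x => ?_
    · change CliffordAlgebra.map (splitInv Q h u hu) (CliffordAlgebra.map (diag h') (ι _ v) * x) =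
        CliffordAlgebra.map inl (ι _ v) * CliffordAlgebra.map (splitInv Q h u hu) x
      rw [map_mul, map_apply_ι, map_apply_ι, map_apply_ι, hdiag]
    · change CliffordAlgebra.map (splitTo Q h) (CliffordAlgebra.map inl (ι _ v) * x) =
        CliffordAlgebra.map (diag h') (ι _ v) * CliffordAlgebra.map (splitTo Q h) x
      rw [map_mul, map_apply_ι, map_apply_ι, map_apply_ι, hinl]
    · change ((CliffordAlgebra.map (splitTo Q h)).comp
        (CliffordAlgebra.map (splitInv Q h u hu))) x = AlgHom.id R _ x
      congr 1
      refine CliffordAlgebra.hom_ext (LinearMap.ext fun y => ?_)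
      simp [splitTo_splitInv]
  have h3 : Retr ((reg ((c • Q).prod ((a * b * c) • Q))).restrict inl)
      ((extTensor (reg (c • Q)) (reg ((a * b * c) • Q))).restrict inl) :=
    Retr.of_leftInverse ((regProdInv _ _).restrict _) ((regProdHom _ _).restrict _)
      regProd_regProdInv
  exact h1.trans (h2.trans (h3.trans (retr_restrict_inl _ _)))

theorem IsFGP.tensor {Q : QuadraticForm R V} {a b c : ℕ} (h : a + b = c) (hc : IsUnit (c : R))
    (h' : ∀ v, (c • Q) v = (a • Q) v + (b • Q) v) {M : CliffMod (a • Q)} {N : CliffMod (b • Q)}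
    (hM : M.IsFGP) (hN : N.IsFGP) : (tensor h' M N).IsFGP := by
  rw [isFGP_iff] at *
  have h'' : ∀ v, (c • Q) v = (b • Q) v + (a • Q) v := fun v => by rw [h', add_comm]
  exact (Retr.tensor_right h' M hN).trans ((Retr.swap h' h'' M (reg _)).trans
    ((Retr.tensor_right h'' _ hM).trans (retr_reg_tensor_reg Q h hc h'')))

end Clifford

end Projectivity

/-- An odd involution of a graded module, anticommuting with the grading involution and with
`V`: it extends the action of `C(V) ⊗ C^{0,1}`, in which `C^{0,1}` acts through the grading
involution, to an action of `C(V) ⊗ C^{0,2}`. -/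
def HasOddInvolution (M : CliffMod Q) : Prop :=
  ∃ η : Module.End R M.carrier, (∀ x, η (η x) = x) ∧ (∀ x, η (M.gr x) = -M.gr (η x)) ∧
    ∀ v x, η (M.act (CliffordAlgebra.ι Q v) x) = -M.act (CliffordAlgebra.ι Q v) (η x)

/-- The relations of the graded Grothendieck group. -/
def grKRel (Q : QuadraticForm R V) :
    AddSubgroup (FreeAbelianGroup {M : CliffMod Q // M.IsFGP}) :=
  AddSubgroup.closure
    ({z | ∃ K M N : {M : CliffMod Q // M.IsFGP}, Nonempty (Iso K.1 (M.1.prod N.1)) ∧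
        z = FreeAbelianGroup.of K - FreeAbelianGroup.of M - FreeAbelianGroup.of N} ∪
      {z | ∃ M : {M : CliffMod Q // M.IsFGP}, HasOddInvolution M.1 ∧ z = FreeAbelianGroup.of M})

/-- The graded Grothendieck group of `C(V, Q)`, written `K(C(V, Q))`: the cokernel of the
restriction map `K(C(V, Q) ⊗ C^{0,2}) → K(C(V, Q) ⊗ C^{0,1})`. As `2` is invertible,
`C(V, Q) ⊗ C^{0,1}`-modules are graded `C(V, Q)`-modules, and the image of the restriction map is
generated by the classes of those which admit an odd involution. -/
def GrK (Q : QuadraticForm R V) : Type (u + 1) :=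
  FreeAbelianGroup {M : CliffMod Q // M.IsFGP} ⧸ grKRel Q

instance (Q : QuadraticForm R V) : AddCommGroup (GrK Q) :=
  inferInstanceAs (AddCommGroup (FreeAbelianGroup {M : CliffMod Q // M.IsFGP} ⧸ grKRel Q))

/-- The class of a finitely generated projective graded module in the Grothendieck group. -/
def classOf (M : CliffMod Q) (h : M.IsFGP) : GrK Q :=
  QuotientAddGroup.mk' (grKRel Q) (FreeAbelianGroup.of ⟨M, h⟩)

open Classical in
/-- The class of a graded module, with the value `0` if it is not finitely generated
projective. -/
def cls (M : CliffMod Q) : GrK Q := if h : M.IsFGP then classOf M h else 0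

theorem cls_eq (M : CliffMod Q) (h : M.IsFGP) : M.cls = classOf M h := dif_pos h

theorem classOf_eq_add {K M N : CliffMod Q} (hK : K.IsFGP) (hM : M.IsFGP) (hN : N.IsFGP)
    (e : Iso K (M.prod N)) : classOf K hK = classOf M hM + classOf N hN := by
  rw [← sub_eq_zero, ← sub_sub]
  exact (QuotientAddGroup.eq_zero_iff _).2
    (AddSubgroup.subset_closure (Or.inl ⟨⟨K, hK⟩, ⟨M, hM⟩, ⟨N, hN⟩, ⟨e⟩, rfl⟩))

theorem classOf_eq_zero {M : CliffMod Q} (hM : M.IsFGP) (h : HasOddInvolution M) :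
    classOf M hM = 0 :=
  (QuotientAddGroup.eq_zero_iff _).2
    (AddSubgroup.subset_closure (Or.inr ⟨⟨M, hM⟩, h, rfl⟩))

/-- The universal property of the graded Grothendieck group. -/
def GrK.lift {A : Type (u + 1)} [AddCommGroup A] (f : {M : CliffMod Q // M.IsFGP} → A)
    (hadd : ∀ K M N, Nonempty (Iso K.1 (M.1.prod N.1)) → f K = f M + f N)
    (hzero : ∀ M, HasOddInvolution M.1 → f M = 0) : GrK Q →ₗ[ℤ] A :=
  (QuotientAddGroup.lift (grKRel Q) (FreeAbelianGroup.lift f) <| by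
    rw [grKRel, AddSubgroup.closure_le]
    rintro _ (⟨K, M, N, e, rfl⟩ | ⟨M, e, rfl⟩)
    · simp [hadd K M N e]
    · simp [hzero M e] : GrK Q →+ A).toIntLinearMap

theorem GrK.lift_classOf {A : Type (u + 1)} [AddCommGroup A] (f : {M : CliffMod Q // M.IsFGP} → A)
    (hadd : ∀ K M N, Nonempty (Iso K.1 (M.1.prod N.1)) → f K = f M + f N)
    (hzero : ∀ M, HasOddInvolution M.1 → f M = 0) (M : CliffMod Q) (h : M.IsFGP) :
    GrK.lift f hadd hzero (classOf M h) = f ⟨M, h⟩ :=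
  FreeAbelianGroup.lift_apply_of f ⟨M, h⟩

theorem GrK.hom_ext {A : Type (u + 1)} [AddCommGroup A] {f g : GrK Q →ₗ[ℤ] A}
    (h : ∀ M hM, f (classOf M hM) = g (classOf M hM)) : f = g := by
  have : f.toAddMonoidHom.comp (QuotientAddGroup.mk' (grKRel Q)) =
      g.toAddMonoidHom.comp (QuotientAddGroup.mk' (grKRel Q)) :=
    FreeAbelianGroup.lift_ext _ _ fun M => h M.1 M.2
  refine LinearMap.ext fun x => ?_
  obtain ⟨x, rfl⟩ := QuotientAddGroup.mk'_surjective _ x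
  exact DFunLike.congr_fun this x

/-- Distributivity of the tensor product over direct sums, in the first variable. -/
def tensorProdLeft (h : ∀ v, Q₃ v = Q₁ v + Q₂ v) {K M M' : CliffMod Q₁} (N : CliffMod Q₂)
    (e : Iso K (M.prod M')) : Iso (tensor h K N) ((tensor h M N).prod (tensor h M' N)) where
  toEquiv := (TensorProduct.congr e.toEquiv (LinearEquiv.refl R N.carrier)).trans
    (TensorProduct.prodLeft R R M.carrier M'.carrier N.carrier)
  map_act a x := by
    refine Hom.map_act (M := tensor h K N) (N := (tensor h M N).prod (tensor h M' N))
      ⟨_, fun v x => ?_⟩ a x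
    induction x using TensorProduct.induction_on with
    | zero => simp only [map_zero]
    | add x y hx hy => simp only [map_add] at *; rw [hx, hy]
    | tmul x y =>
      rw [tensor_act_ι, map_add]
      have h1 := e.map_act (CliffordAlgebra.ι _ v) x
      have h2 := e.map_gr x
      refine Prod.ext ?_ ?_
      · refine Eq.trans ?_ (tensor_act_ι h M N v (e.toEquiv x).1 y).symm
        simp [h1, h2]
      · refine Eq.trans ?_ (tensor_act_ι h M' N v (e.toEquiv x).2 y).symm
        simp [h1, h2]
  map_gr x := by
    induction x using TensorProduct.induction_on with
    | zero => simp only [map_zero]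
    | add x y hx hy => simp only [map_add] at *; rw [hx, hy]
    | tmul x y =>
      have h2 := e.map_gr x
      refine Prod.ext ?_ ?_ <;> (simp [h2]; rfl)

/-- Distributivity of the tensor product over direct sums, in the second variable. -/
def tensorProdRight (h : ∀ v, Q₃ v = Q₁ v + Q₂ v) (M : CliffMod Q₁) {K N N' : CliffMod Q₂}
    (e : Iso K (N.prod N')) : Iso (tensor h M K) ((tensor h M N).prod (tensor h M N')) where
  toEquiv := (TensorProduct.congr (LinearEquiv.refl R M.carrier) e.toEquiv).trans
    (TensorProduct.prodRight R R M.carrier N.carrier N'.carrier)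
  map_act a x := by
    refine Hom.map_act (M := tensor h M K) (N := (tensor h M N).prod (tensor h M N'))
      ⟨_, fun v x => ?_⟩ a x
    induction x using TensorProduct.induction_on with
    | zero => simp only [map_zero]
    | add x y hx hy => simp only [map_add] at *; rw [hx, hy]
    | tmul x y =>
      rw [tensor_act_ι, map_add]
      have h1 := e.map_act (CliffordAlgebra.ι _ v) y
      refine Prod.ext ?_ ?_
      · refine Eq.trans ?_ (tensor_act_ι h M N v x (e.toEquiv y).1).symm
        simp [h1]
      · refine Eq.trans ?_ (tensor_act_ι h M N' v x (e.toEquiv y).2).symm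
        simp [h1]
  map_gr x := by
    induction x using TensorProduct.induction_on with
    | zero => simp only [map_zero]
    | add x y hx hy => simp only [map_add] at *; rw [hx, hy]
    | tmul x y =>
      have h2 := e.map_gr y
      refine Prod.ext ?_ ?_ <;> simp [h2]

theorem HasOddInvolution.tensor_left (h : ∀ v, Q₃ v = Q₁ v + Q₂ v) {M : CliffMod Q₁}
    (N : CliffMod Q₂) (hM : HasOddInvolution M) : HasOddInvolution (tensor h M N) := by
  obtain ⟨η, h1, h2, h3⟩ := hM
  refine ⟨TensorProduct.map η LinearMap.id, fun x => ?_, fun x => ?_, fun v x => ?_⟩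
  all_goals
    induction x using TensorProduct.induction_on with
    | zero => simp only [map_zero, neg_zero]
    | add x y hx hy => simp only [map_add, neg_add] at *; rw [hx, hy]
    | tmul x y => ?_
  · simp [h1]
  · simp [h2, TensorProduct.neg_tmul]
  · rw [tensor_act_ι, TensorProduct.map_tmul, tensor_act_ι]
    simp [h2, h3, TensorProduct.neg_tmul]
    abel

theorem HasOddInvolution.tensor_right (h : ∀ v, Q₃ v = Q₁ v + Q₂ v) (M : CliffMod Q₁)
    {N : CliffMod Q₂} (hN : HasOddInvolution N) : HasOddInvolution (tensor h M N) := by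
  obtain ⟨η, h1, h2, h3⟩ := hN
  refine ⟨TensorProduct.map M.gr η, fun x => ?_, fun x => ?_, fun v x => ?_⟩
  all_goals
    induction x using TensorProduct.induction_on with
    | zero => simp only [map_zero, neg_zero]
    | add x y hx hy => simp only [map_add, neg_add] at *; rw [hx, hy]
    | tmul x y => ?_
  · simp [h1, M.gr_gr]
  · simp [h2, TensorProduct.tmul_neg]
  · rw [tensor_act_ι, TensorProduct.map_tmul, tensor_act_ι]
    simp [M.gr_act, h3, TensorProduct.neg_tmul, TensorProduct.tmul_neg]
    abel

theorem add_nsmul_apply (Q : QuadraticForm R V) {a b c : ℕ} (h : a + b = c) (v : V) :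
    (c • Q) v = (a • Q) v + (b • Q) v := by
  simp [← h, add_smul]

theorem mul_nsmul_apply (Q : QuadraticForm R V) (k : ℕ) (v : V) :
    ((2 * k) • Q) v = k • (2 • Q) v := by
  simp [mul_comm 2 k, mul_smul]

theorem two_nsmul_apply (Q : QuadraticForm R V) (v : V) : (2 • Q) v = Q v + Q v := by
  simp [two_mul]

theorem isUnit_cast_of_factorial {n m : ℕ} (hm : 0 < m) (hmn : m ≤ n)
    (h : IsUnit ((n.factorial : ℕ) : R)) : IsUnit (m : R) :=
  isUnit_of_dvd_unit (Nat.cast_dvd_cast (Nat.dvd_factorial hm hmn)) h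

theorem isUnit_factorial_of_le {n m : ℕ} (hmn : m ≤ n) (h : IsUnit ((n.factorial : ℕ) : R)) :
    IsUnit ((m.factorial : ℕ) : R) :=
  isUnit_of_dvd_unit (Nat.cast_dvd_cast (Nat.factorial_dvd_factorial hmn)) h

section Operations

variable [Invertible (2 : R)] [Module.Finite R V] [Module.Projective R V]

/-- The cup-product `K(C(V(a))) × K(C(V(b))) → K(C(V(c)))` for `c = a + b` invertible in `R`,
induced by the graded tensor product of modules. -/
def cup (Q : QuadraticForm R V) {a b c : ℕ} (h : a + b = c) (hc : IsUnit (c : R)) :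
    GrK (a • Q) →ₗ[ℤ] GrK (b • Q) →ₗ[ℤ] GrK (c • Q) :=
  GrK.lift
    (fun M => GrK.lift
      (fun N => classOf (tensor (add_nsmul_apply Q h) M.1 N.1) (IsFGP.tensor h hc _ M.2 N.2))
      (fun _ _ _ ⟨e⟩ => classOf_eq_add _ _ _ (tensorProdRight _ M.1 e))
      (fun _ e => classOf_eq_zero _ (e.tensor_right _ M.1)))
    (fun _ _ _ ⟨e⟩ => GrK.hom_ext fun N hN => by
      simp only [LinearMap.add_apply, GrK.lift_classOf]
      exact classOf_eq_add _ _ _ (tensorProdLeft _ N e))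
    (fun _ e => GrK.hom_ext fun N hN => by
      simp only [LinearMap.zero_apply, GrK.lift_classOf]
      exact classOf_eq_zero _ (e.tensor_left _ N))

theorem cup_cls (Q : QuadraticForm R V) {a b c : ℕ} (h : a + b = c) (hc : IsUnit (c : R))
    (M : CliffMod (a • Q)) (N : CliffMod (b • Q)) (hM : M.IsFGP) (hN : N.IsFGP) :
    cup Q h hc M.cls N.cls = (tensor (add_nsmul_apply Q h) M N).cls := by
  rw [cls_eq M hM, cls_eq N hN, cls_eq _ (IsFGP.tensor h hc _ hM hN), cup, GrK.lift_classOf,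
    GrK.lift_classOf]

/-- The ring of integers `Ω_k = ℤ[x]/(Φ_k(x))` of the `k`-th cyclotomic field. -/
abbrev Omega (k : ℕ) : Type := AdjoinRoot (Polynomial.cyclotomic k ℤ)

/-- The class `ω` of `x` in `Ω_k`. -/
def omegaRoot (k : ℕ) : Omega k := AdjoinRoot.root (Polynomial.cyclotomic k ℤ)

/-- The cup-product with coefficients in `Ω_k`: `(x ⊗ α) · (y ⊗ β) = (x · y) ⊗ αβ`. -/
def cupOmega (Q : QuadraticForm R V) (k : ℕ) {a b c : ℕ} (h : a + b = c) (hc : IsUnit (c : R)) :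
    GrK (a • Q) ⊗[ℤ] Omega k →ₗ[ℤ] GrK (b • Q) ⊗[ℤ] Omega k →ₗ[ℤ] GrK (c • Q) ⊗[ℤ] Omega k :=
  TensorProduct.map₂ (cup Q h hc) (LinearMap.mul ℤ (Omega k))

/-- `Ψ̄ᵏ(E) = ∑_{j < k} F_{ω^j} · ω^j` in `K(C(V(k))) ⊗ Ω_k`, where `F = E^{⊗ k}` and where
`ζ ∈ R` corresponds to `ω`. -/
def psiBar {Q' : QuadraticForm R V} (E : CliffMod Q) (k : ℕ) (h : ∀ v, Q' v = k • Q v) (ζ : R) :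
    GrK Q' ⊗[ℤ] Omega k :=
  ∑ j ∈ Finset.range k, (E.eigen k h (ζ ^ j)).cls ⊗ₜ[ℤ] (omegaRoot k ^ j)

/-- The Adams operation `Ψⁿ(E) = Q_n(λ¹(E), …, λⁿ(E))` in `K(C(V(n)))`, for `n ≥ 1` and `n!`
invertible in `R`. The Newton polynomial `Q_n`, which expresses the `n`-th power sum through the
elementary symmetric functions, is given by Newton's recursion
`Q_n = ∑_{i=1}^{n-1} (-1)^{i-1} λ^i Q_{n-i} + (-1)^{n-1} n λ^n`, products being cup-products. -/
def adams (E : CliffMod Q) : (n : ℕ) → IsUnit ((n.factorial : ℕ) : R) → GrK (n • Q)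
  | 0, _ => 0
  | m + 1, h =>
    (∑ i : Fin m, (-1 : ℤ) ^ (i : ℕ) •
      cup Q (a := i + 1) (b := m - i) (c := m + 1) (by omega)
        (isUnit_cast_of_factorial m.succ_pos le_rfl h)
        (E.lambda (i + 1) fun _ => rfl).cls
        (adams E (m - i) (isUnit_factorial_of_le (by omega) h))) +
    ((-1 : ℤ) ^ m * (m + 1 : ℕ)) • (E.lambda (m + 1) fun _ => rfl).cls

end Operations

end CliffMod

end

/-!
The proof deals throughout with the class `chi k ζ M T N = ∑ N_{ζ^j} · ω^j` of a submodule `N` of a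
graded module `M` with an automorphism `T` such that `T^k = 1`; the class `Ψ̄ᵏ(E)` is the case of
`E^{⊗ k}` with the cyclic permutation (`psiBar_eq_chi`). As `k` is invertible and the powers of `ζ`
satisfy the orthogonality relations, the eigenmodules are the images of the projections `eigProj`, so
that they are direct summands, and the class is additive for decompositions which are compatible with
`T` (`chi_decomp`). The main tool is `chi_eq_zero`: an invertible operator `D` with `D T = ζ^m T D`
identifies the eigenmodules for `ζ^(j+m)` and `ζ^j`, and if `k` does not divide `m` this makes the
class vanish, because the sum of the `ω^j` over a coset of a nontrivial subgroup of `ℤ/k` is `0`.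

Tensor products of finitely generated projective modules are finitely generated projective
(`IsFGP.tensor'`) because, for `Q₃ = Q₁ + Q₂`, the module `C(V, Q₁) ⊗ N` with the diagonal action of
`C(V, Q₃)` is isomorphic to the module `C(V, Q₃) ⊗ N` induced from the `R`-module `N` (`indMap`), and
`N` is a retract of a free `R`-module.

*Multiplicativity.* The sign rule gives an isomorphism
`(E₀ ⊗ E₁)^{⊗ k} ≅ E₀^{⊗ k} ⊗ E₁^{⊗ k}` compatible with permutations (`gradedUnzip_perm`), and the
eigenmodules of `T₀ ⊗ T₁` are the sums of the products of those of `T₀` and `T₁` (`chi_tensor`).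

*Prime `k`.* The cycle is conjugate to its powers with exponent prime to `k`, so that the eigenmodules
for `ζ, …, ζ^(k-1)` are isomorphic and `Ψ̄ᵏ(E)` is the image of `F_1 - F_ω`
(`eigen_sub_tmul_one`). Extension of scalars to `Ω_k` is injective, since `Ω_k` is free over `ℤ` with
`1` in a basis. In `(E₀ ⊕ E₁)^{⊗ k}`, the part with `m` factors `E₁` has an operator `D` as above for
`0 < m < k`: multiply the summand in which `E₁` occupies the places of a set `s` by
`∏_{i ∈ s} ζ^i` (`chi_countProj_eq_zero`).

*Comparison with the Adams operation.* Consider the functions `φ` which assign to each map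
`f : Fin k → Fin k` a tensor `φ f ∈ E^{⊗ k}`, and which are equivariant under the symmetric group
permuting the places, with a twist by the signature (`altFun`). The cyclic group rotates the values
of `f`. The class of this module is computed in two ways.

* The functions supported by the maps which miss `i` values, `0 < i < k`, have an operator `D` as
  above, given by the product of the `ζ^j` over the missed values `j`. Only the bijective maps
  remain; evaluation at the identity turns the rotation into the cyclic permutation of `E^{⊗ k}`
  times its signature, whence `(-1)^(k-1) Ψ̄ᵏ(E)` (`chi_rotOp_eq_chi_signPerm`).
* A Fourier transformation on the values makes the rotation diagonal: it becomes multiplication by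
  `ζ^(∑ f i)` (`chi_rotOp_eq_chi_diagonal`). Now the functions decompose by the numbers `c j` of
  places at which `f` has the value `j`. The summand of `c` consists of the tensors antisymmetric
  under a Young subgroup, and as `k!` is invertible its class is the product of the exterior powers
  `λ^{c j}(E)` (`subCls_altSub_stab`). The total is `∑_c ω^(∑ j c j) ∏_j λ^{c j}(E)`
  (`chi_diagonal_eq_sum`).

The last sum is the coefficient of `t^k` in `∏_j λ(ω^j t)`, where `λ(t) = ∑ λⁿ(E) tⁿ`; by Newton's
identities it is `(-1)^(k-1) Q_k(λ¹(E), …, λᵏ(E))` (`coeff_prod_rescale_of_newton`).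
-/

noncomputable section

namespace CliffMod

open CliffordAlgebra

variable {R V : Type u} [CommRing R] [AddCommGroup V] [Module R V]
  {Q Q' Q₁ Q₂ Q₃ : QuadraticForm R V}

/-! ### Homogeneous tensors and the action of the symmetric group -/

/-- The sign `(-1)^b` in `R` of a parity `b`. -/
def sg (R : Type u) [CommRing R] (b : Bool) : R := bif b then -1 else 1

theorem sg_mul_self (b : Bool) : sg R b * sg R b = 1 := by cases b <;> simp [sg]

/-- `x` is homogeneous of parity `b`. -/
def IsHom (M : CliffMod Q) (b : Bool) (x : M.carrier) : Prop := M.gr x = sg R b • x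

theorem IsHom.act {M : CliffMod Q} {b : Bool} {x : M.carrier} (h : M.IsHom b x) (v : V) :
    M.IsHom (!b) (M.act (ι Q v) x) := by
  unfold IsHom at *
  rw [M.gr_act, h]
  cases b <;> simp [sg]

section Homogeneous

variable [Invertible (2 : R)]

theorem isHom_proj (M : CliffMod Q) (b : Bool) (x : M.carrier) : M.IsHom b (M.proj b x) :=
  LinearMap.congr_fun (M.gr_mul_proj b) x

theorem proj_add_proj (M : CliffMod Q) (x : M.carrier) : M.proj false x + M.proj true x = x := by
  have : (⅟2 : R) * 2 = 1 := invOf_mul_self 2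
  simp only [proj, cond_false, cond_true, LinearMap.smul_apply, LinearMap.add_apply,
    Module.End.one_apply]
  conv_rhs => rw [← one_smul R x, ← this]
  module

theorem IsHom.proj_same {M : CliffMod Q} {b : Bool} {x : M.carrier} (h : M.IsHom b x) :
    M.proj b x = x := by
  have h2 : (⅟2 : R) * 2 = 1 := invOf_mul_self 2
  unfold IsHom at h
  cases b
  all_goals
    simp only [proj, cond_false, cond_true, LinearMap.smul_apply, LinearMap.add_apply,
      Module.End.one_apply, h, sg]
    conv_rhs => rw [← one_smul R x, ← h2]
    module

theorem IsHom.proj_ne {M : CliffMod Q} {b c : Bool} {x : M.carrier} (h : M.IsHom b x)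
    (hc : c ≠ b) : M.proj c x = 0 := by
  have h1 := proj_add_proj M x
  have h2 := h.proj_same
  cases b <;> cases c <;> first | exact absurd rfl hc | (rw [h2] at h1; simpa using h1)

theorem IsHom.tprod_proj {M : CliffMod Q} {n : ℕ} {x : Fin n → M.carrier} {s : Fin n → Bool}
    (h : ∀ i, M.IsHom (s i) (x i)) (t : Fin n → Bool) :
    (PiTensorProduct.tprod R fun i => M.proj (t i) (x i)) =
      if t = s then PiTensorProduct.tprod R x else 0 := by
  split_ifs with hts
  · subst hts
    congr 1
    funext i
    exact (h i).proj_same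
  · obtain ⟨i, hi⟩ := Function.ne_iff.1 hts
    exact (PiTensorProduct.tprod R).map_coord_zero i ((h i).proj_ne hi)

theorem tprod_eq_sum_proj (M : CliffMod Q) {n : ℕ} (x : Fin n → M.carrier) :
    PiTensorProduct.tprod R x =
      ∑ s : Fin n → Bool, PiTensorProduct.tprod R fun i => M.proj (s i) (x i) := by
  rw [← MultilinearMap.map_sum (PiTensorProduct.tprod R) fun i (b : Bool) => M.proj b (x i)]
  congr 1
  funext i
  rw [Fintype.sum_bool, add_comm, proj_add_proj]

/-- Linear maps on a tensor power are equal as soon as they agree on the tensors of homogeneous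
elements. -/
theorem tprod_hom_ext (M : CliffMod Q) {n : ℕ} {P : Type*} [AddCommGroup P] [Module R P]
    {f g : (⨂[R] _ : Fin n, M.carrier) →ₗ[R] P}
    (h : ∀ (s : Fin n → Bool) (x : Fin n → M.carrier), (∀ i, M.IsHom (s i) (x i)) →
      f (PiTensorProduct.tprod R x) = g (PiTensorProduct.tprod R x)) : f = g := by
  refine PiTensorProduct.ext (MultilinearMap.ext fun x => ?_)
  simp only [LinearMap.compMultilinearMap_apply]
  rw [tprod_eq_sum_proj, map_sum, map_sum]
  exact Finset.sum_congr rfl fun s _ => h s _ fun i => isHom_proj M _ _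

theorem perm_tprod (M : CliffMod Q) {n : ℕ} (σ : Equiv.Perm (Fin n)) {s : Fin n → Bool}
    {x : Fin n → M.carrier} (h : ∀ i, M.IsHom (s i) (x i)) :
    M.perm σ (PiTensorProduct.tprod R x) =
      ((koszulSign σ s : ℤ) : R) • PiTensorProduct.tprod R fun i => x (σ.symm i) := by
  classical
  simp only [perm, LinearMap.sum_apply, LinearMap.smul_apply, LinearMap.comp_apply,
    PiTensorProduct.map_tprod, IsHom.tprod_proj h]
  rw [Finset.sum_eq_single s]
  · rw [if_pos rfl]
    congr 1
    exact PiTensorProduct.reindex_tprod _ _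
  · intro t _ ht
    rw [if_neg ht, map_zero, smul_zero]
  · intro h
    exact absurd (Finset.mem_univ s) h

end Homogeneous

theorem slotMap_tprod (M : CliffMod Q) {n : ℕ} (i : Fin n) (v : V) {s : Fin n → Bool}
    {x : Fin n → M.carrier} (h : ∀ i, M.IsHom (s i) (x i)) :
    M.slotMap i v (PiTensorProduct.tprod R x) =
      (∏ j, if j < i then sg R (s j) else 1) •
        PiTensorProduct.tprod R (Function.update x i (M.act (ι Q v) (x i))) := by
  rw [slotMap_apply, PiTensorProduct.map_tprod, ← MultilinearMap.map_smul_univ]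
  congr 1
  funext j
  rcases lt_trichotomy j i with hj | hj | hj
  · simp only [slot, if_pos hj]
    rw [Function.update_of_ne hj.ne]
    exact h j
  · subst hj
    simp [slot]
  · simp [slot, hj.not_gt, hj.ne']

/-- Two products over ordered pairs agree as soon as the contributions of each unordered pair
agree. -/
theorem prod_pairs_congr {ι₀ A : Type*} [Fintype ι₀] [LinearOrder ι₀] [CommMonoid A]
    (f g : ι₀ → ι₀ → A) (hd : ∀ i, f i i = g i i)
    (h : ∀ i j, i < j → f i j * f j i = g i j * g j i) :
    ∏ i, ∏ j, f i j = ∏ i, ∏ j, g i j := by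
  have key : ∀ f : ι₀ → ι₀ → A, ∏ i, ∏ j, f i j =
      ∏ i, ∏ j, if i < j then f i j * f j i else if i = j then f i i else 1 := by
    intro f
    have h1 : ∏ i, ∏ j, f i j = (∏ i, ∏ j, if i < j then f i j else if i = j then f i i else 1) *
        ∏ i, ∏ j, if j < i then f i j else 1 := by
      simp only [← Finset.prod_mul_distrib]
      refine Finset.prod_congr rfl fun i _ => Finset.prod_congr rfl fun j _ => ?_
      rcases lt_trichotomy i j with hij | hij | hij
      · simp [hij, hij.not_gt]
      · subst hij; simp
      · simp [hij, hij.not_gt, hij.ne']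
    rw [h1, Finset.prod_comm (f := fun i j => if j < i then f i j else 1)]
    simp only [← Finset.prod_mul_distrib]
    refine Finset.prod_congr rfl fun i _ => Finset.prod_congr rfl fun j _ => ?_
    split_ifs <;> simp
  rw [key f, key g]
  refine Finset.prod_congr rfl fun i _ => Finset.prod_congr rfl fun j _ => ?_
  split_ifs with h1
  · exact h i j h1
  · exact hd i
  · rfl

theorem koszulSign_comp_symm {n : ℕ} (σ τ : Equiv.Perm (Fin n)) (s : Fin n → Bool) :
    koszulSign σ (fun i => s (τ.symm i)) =
      ∏ i, ∏ j, if (τ i < τ j ∧ σ (τ j) < σ (τ i)) ∧ s i = true ∧ s j = true then -1 else 1 := by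
  unfold koszulSign
  rw [← Equiv.prod_comp τ]
  refine Finset.prod_congr rfl fun i _ => ?_
  rw [← Equiv.prod_comp τ]
  simp

/-- The sign rule is a cocycle. -/
theorem koszulSign_mul {n : ℕ} (σ τ : Equiv.Perm (Fin n)) (s : Fin n → Bool) :
    koszulSign (σ * τ) s = koszulSign σ (fun i => s (τ.symm i)) * koszulSign τ s := by
  rw [koszulSign_comp_symm, koszulSign, koszulSign, ← Finset.prod_mul_distrib]
  simp only [← Finset.prod_mul_distrib]
  refine prod_pairs_congr _ _ (fun i => by simp) fun i j hij => ?_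
  have h1 : τ i ≠ τ j := fun h => hij.ne (τ.injective h)
  have h2 : σ (τ i) ≠ σ (τ j) := fun h => h1 (σ.injective h)
  cases hi : s i
  · simp
  cases hj : s j
  · simp
  rcases lt_or_gt_of_ne h1 with h1 | h1 <;> rcases lt_or_gt_of_ne h2 with h2 | h2 <;>
    simp [hij, hij.not_gt, h1, h1.not_gt, h2, h2.not_gt]

theorem koszulSign_one {n : ℕ} (s : Fin n → Bool) : koszulSign 1 s = 1 := by
  unfold koszulSign
  refine Finset.prod_eq_one fun i _ => Finset.prod_eq_one fun j _ => if_neg ?_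
  rintro ⟨⟨h1, h2⟩, -⟩
  exact lt_asymm h1 h2

section Perm

variable [Invertible (2 : R)]

theorem perm_mul (M : CliffMod Q) {n : ℕ} (σ τ : Equiv.Perm (Fin n)) :
    M.perm (σ * τ) = M.perm σ * M.perm τ := by
  refine tprod_hom_ext M fun s x hx => ?_
  rw [Module.End.mul_apply, perm_tprod M τ hx, map_smul,
    perm_tprod M σ (s := fun i => s (τ.symm i)) fun i => hx _, perm_tprod M _ hx, smul_smul,
    koszulSign_mul, mul_comm (koszulSign σ _)]
  push_cast
  rfl

theorem perm_one (M : CliffMod Q) {n : ℕ} : M.perm (1 : Equiv.Perm (Fin n)) = 1 := by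
  refine tprod_hom_ext M fun s x hx => ?_
  rw [perm_tprod M 1 hx, koszulSign_one]
  simp
  rfl

/-- The action of the symmetric group on the tensor power, as a representation. -/
def permHom (M : CliffMod Q) (n : ℕ) :
    Equiv.Perm (Fin n) →* Module.End R (⨂[R] _ : Fin n, M.carrier) where
  toFun := M.perm
  map_one' := M.perm_one
  map_mul' := M.perm_mul

theorem perm_pow (M : CliffMod Q) {n : ℕ} (σ : Equiv.Perm (Fin n)) (i : ℕ) :
    M.perm (σ ^ i) = M.perm σ ^ i :=
  map_pow (M.permHom n) σ i

theorem perm_mul_apply (M : CliffMod Q) {n : ℕ} (σ τ : Equiv.Perm (Fin n))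
    (x : ⨂[R] _ : Fin n, M.carrier) : M.perm σ (M.perm τ x) = M.perm (σ * τ) x := by
  rw [perm_mul]; rfl

theorem perm_one_apply (M : CliffMod Q) {n : ℕ} (x : ⨂[R] _ : Fin n, M.carrier) :
    M.perm (1 : Equiv.Perm (Fin n)) x = x := by
  rw [perm_one]; rfl

end Perm

theorem power_act_ι (M : CliffMod Q) (n : ℕ) (h : ∀ v, Q' v = n • Q v) (v : V) :
    (M.power n h).act (ι Q' v) = ∑ i : Fin n, M.slotMap i v := by
  change (M.extPower n).act (CliffordAlgebra.map (diagPow n h) (ι Q' v)) = _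
  rw [CliffordAlgebra.map_apply_ι, extPower_act_ι]
  rfl

/-! ### Stable submodules and their classes -/

/-- `f` is a morphism of graded modules (of degree `0`). The modules are explicit because they
cannot be recovered from their carriers. -/
def IsMor (M N : CliffMod Q) (f : M.carrier →ₗ[R] N.carrier) : Prop :=
  (∀ v x, f (M.act (ι Q v) x) = N.act (ι Q v) (f x)) ∧ ∀ x, f (M.gr x) = N.gr (f x)

namespace IsMor

variable {M N K : CliffMod Q}

theorem map_act {f : M.carrier →ₗ[R] N.carrier} (hf : IsMor M N f) (a : CliffordAlgebra Q)
    (x : M.carrier) : f (M.act a x) = N.act a (f x) :=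
  Hom.map_act (M := M) (N := N) ⟨f, hf.1⟩ a x

theorem id : IsMor M M LinearMap.id := ⟨fun _ _ => rfl, fun _ => rfl⟩

theorem one : IsMor M M 1 := ⟨fun _ _ => rfl, fun _ => rfl⟩

theorem zero : IsMor M N 0 := ⟨fun v x => by simp, fun x => by simp⟩

theorem comp {f : M.carrier →ₗ[R] N.carrier} {g : N.carrier →ₗ[R] K.carrier} (hg : IsMor N K g)
    (hf : IsMor M N f) : IsMor M K (g ∘ₗ f) :=
  ⟨fun v x => by simp [hf.1, hg.1], fun x => by simp [hf.2, hg.2]⟩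

theorem mul {f g : Module.End R M.carrier} (hf : IsMor M M f) (hg : IsMor M M g) :
    IsMor M M (f * g) := hf.comp hg

theorem pow {f : Module.End R M.carrier} (hf : IsMor M M f) (i : ℕ) : IsMor M M (f ^ i) := by
  induction i with
  | zero => exact one
  | succ i ih => exact ih.mul hf

theorem smul {f : M.carrier →ₗ[R] N.carrier} (hf : IsMor M N f) (r : R) : IsMor M N (r • f) :=
  ⟨fun v x => by simp [hf.1], fun x => by simp [hf.2]⟩

theorem add {f g : M.carrier →ₗ[R] N.carrier} (hf : IsMor M N f) (hg : IsMor M N g) :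
    IsMor M N (f + g) :=
  ⟨fun v x => by simp [hf.1, hg.1], fun x => by simp [hf.2, hg.2]⟩

theorem sum {κ : Type*} (s : Finset κ) {f : κ → M.carrier →ₗ[R] N.carrier}
    (hf : ∀ i ∈ s, IsMor M N (f i)) : IsMor M N (∑ i ∈ s, f i) := by
  classical
  induction s using Finset.induction_on with
  | empty => exact zero
  | insert a s ha ih =>
    rw [Finset.sum_insert ha]
    exact (hf a (Finset.mem_insert_self a s)).add
      (ih fun i hi => hf i (Finset.mem_insert_of_mem hi))

end IsMor

/-- The submodule `N` is stable under `V` and under the grading involution. -/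
def Stable (M : CliffMod Q) (N : Submodule R M.carrier) : Prop :=
  (∀ v, ∀ x ∈ N, M.act (ι Q v) x ∈ N) ∧ ∀ x ∈ N, M.gr x ∈ N

namespace Stable

variable {M : CliffMod Q} {N N' : Submodule R M.carrier}

theorem act (h : M.Stable N) (a : CliffordAlgebra Q) : ∀ x ∈ N, M.act a x ∈ N := by
  induction a using CliffordAlgebra.induction with
  | algebraMap r =>
    intro x hx
    rw [AlgHom.commutes, Module.algebraMap_end_apply]
    exact N.smul_mem r hx
  | ι v => exact h.1 v
  | mul a b ha hb =>
    intro x hx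
    rw [map_mul]
    exact ha _ (hb x hx)
  | add a b ha hb =>
    intro x hx
    rw [map_add]
    exact N.add_mem (ha x hx) (hb x hx)

theorem top : M.Stable ⊤ := ⟨fun _ _ _ => trivial, fun _ _ => trivial⟩

theorem bot : M.Stable ⊥ := by
  constructor
  · rintro v x hx
    rw [Submodule.mem_bot] at *
    rw [hx, map_zero]
  · rintro x hx
    rw [Submodule.mem_bot] at *
    rw [hx, map_zero]

theorem inf (h : M.Stable N) (h' : M.Stable N') : M.Stable (N ⊓ N') :=
  ⟨fun v x hx => ⟨h.1 v x hx.1, h'.1 v x hx.2⟩, fun x hx => ⟨h.2 x hx.1, h'.2 x hx.2⟩⟩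

theorem ker {K : CliffMod Q} {f : M.carrier →ₗ[R] K.carrier} (hf : IsMor M K f) :
    M.Stable (LinearMap.ker f) := by
  constructor
  · intro v x hx
    rw [LinearMap.mem_ker] at *
    rw [hf.1, hx, map_zero]
  · intro x hx
    rw [LinearMap.mem_ker] at *
    rw [hf.2, hx, map_zero]

theorem eigenspace {T : Module.End R M.carrier} (hT : IsMor M M T) (μ : R) :
    M.Stable (Module.End.eigenspace T μ) := by
  constructor
  · intro v x hx
    rw [Module.End.mem_eigenspace_iff] at *
    rw [hT.1, hx, map_smul]
  · intro x hx
    rw [Module.End.mem_eigenspace_iff] at *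
    rw [hT.2, hx, map_smul]

theorem iInf {κ : Sort*} {N : κ → Submodule R M.carrier} (h : ∀ i, M.Stable (N i)) :
    M.Stable (⨅ i, N i) := by
  constructor
  · intro v x hx
    rw [Submodule.mem_iInf] at *
    exact fun i => (h i).1 v x (hx i)
  · intro x hx
    rw [Submodule.mem_iInf] at *
    exact fun i => (h i).2 x (hx i)

end Stable

/-- The graded module carried by a stable submodule. -/
abbrev ofStable (M : CliffMod Q) (N : Submodule R M.carrier) (h : M.Stable N) : CliffMod Q :=
  M.sub N h.act h.2

/-- The submodule `N` is stable and carries a finitely generated projective module. -/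
def SubFGP (M : CliffMod Q) (N : Submodule R M.carrier) : Prop :=
  ∃ h : M.Stable N, (M.ofStable N h).IsFGP

open Classical in
/-- The class of the graded module carried by the submodule `N`, with the value `0` if `N` is not
stable or not finitely generated projective. -/
def subCls (M : CliffMod Q) (N : Submodule R M.carrier) : GrK Q :=
  if h : M.Stable N then (M.ofStable N h).cls else 0

theorem subCls_eq {M : CliffMod Q} {N : Submodule R M.carrier} (h : M.Stable N) :
    M.subCls N = (M.ofStable N h).cls := dif_pos h

theorem cls_of_subsingleton (M : CliffMod Q) [Subsingleton M.carrier] : M.cls = 0 := by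
  unfold cls
  split_ifs with h
  · exact classOf_eq_zero h ⟨0, fun x => Subsingleton.elim _ _, fun x => Subsingleton.elim _ _,
      fun v x => Subsingleton.elim _ _⟩
  · rfl

theorem subCls_bot (M : CliffMod Q) : M.subCls ⊥ = 0 := by
  rw [subCls_eq Stable.bot]
  have : Subsingleton (M.ofStable ⊥ Stable.bot).carrier :=
    inferInstanceAs (Subsingleton (⊥ : Submodule R M.carrier))
  exact cls_of_subsingleton _

theorem IsFGP.of_retr {M N : CliffMod Q} (h : Retr M N) (hN : N.IsFGP) : M.IsFGP := by
  rw [isFGP_iff] at *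
  exact h.trans hN

theorem Iso.isFGP {M N : CliffMod Q} (e : Iso M N) (hM : M.IsFGP) : N.IsFGP := by
  refine IsFGP.of_retr (Retr.of_leftInverse
    ⟨e.toEquiv.symm.toLinearMap, fun v x => ?_⟩ ⟨e.toEquiv.toLinearMap, fun v x => ?_⟩
    fun x => ?_) hM
  · apply e.toEquiv.injective
    simp [e.map_act]
  · simp [e.map_act]
  · simp

/-- The inverse of an isomorphism. -/
def Iso.symm {M N : CliffMod Q} (e : Iso M N) : Iso N M where
  toEquiv := e.toEquiv.symm
  map_act a x := by
    apply e.toEquiv.injective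
    simp [e.map_act]
  map_gr x := by
    apply e.toEquiv.injective
    simp [e.map_gr]

/-- The zero module. -/
abbrev zeroMod (Q : QuadraticForm R V) : CliffMod Q :=
  (reg Q).sub ⊥ (Stable.bot (M := reg Q)).act (Stable.bot (M := reg Q)).2

theorem isFGP_zeroMod (Q : QuadraticForm R V) : (zeroMod Q).IsFGP := by
  rw [isFGP_iff]
  refine ⟨Empty, inferInstance, fun j => j.elim, fun j => j.elim, fun x => ?_⟩
  exact Subsingleton.elim (α := (⊥ : Submodule R (CliffordAlgebra Q))) _ _

theorem Iso.cls_eq {M N : CliffMod Q} (e : Iso M N) : M.cls = N.cls := by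
  by_cases hM : M.IsFGP
  · have hN := e.isFGP hM
    have h0 := isFGP_zeroMod Q
    have : Subsingleton (zeroMod Q).carrier :=
      inferInstanceAs (Subsingleton (⊥ : Submodule R (CliffordAlgebra Q)))
    have h1 : classOf (zeroMod Q) h0 = 0 := by
      rw [← CliffMod.cls_eq, cls_of_subsingleton]
    have h2 : Iso M (N.prod (zeroMod Q)) :=
      { toEquiv :=
          { toFun := fun x => (e.toEquiv x, 0)
            map_add' := fun x y => by simp
            map_smul' := fun r x => by simp
            invFun := fun y => e.toEquiv.symm y.1
            left_inv := fun x => by simp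
            right_inv := fun y => Prod.ext (by simp) (Subsingleton.elim _ _) }
        map_act := fun a x => Prod.ext (e.map_act a x) (Subsingleton.elim _ _)
        map_gr := fun x => Prod.ext (e.map_gr x) (Subsingleton.elim _ _) }
    rw [CliffMod.cls_eq M hM, CliffMod.cls_eq N hN, classOf_eq_add hM hN h0 h2, h1, add_zero]
  · have hN : ¬ N.IsFGP := fun hN => hM (e.symm.isFGP hN)
    rw [cls, cls, dif_neg hM, dif_neg hN]

theorem cls_prod {K M N : CliffMod Q} (hM : M.IsFGP) (hN : N.IsFGP) (e : Iso K (M.prod N)) :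
    K.cls = M.cls + N.cls := by
  have hK : K.IsFGP := e.symm.isFGP (hM.prod hN)
  rw [cls_eq K hK, cls_eq M hM, cls_eq N hN, classOf_eq_add hK hM hN e]

/-- A morphism which restricts to a bijection of stable submodules. -/
def isoOfStable {M M' : CliffMod Q} {N : Submodule R M.carrier} {N' : Submodule R M'.carrier}
    (hN : M.Stable N) (hN' : M'.Stable N') (a : M.carrier →ₗ[R] M'.carrier) (ha : IsMor M M' a)
    (b : M'.carrier → M.carrier) (hab : ∀ x ∈ N, a x ∈ N') (hba : ∀ y ∈ N', b y ∈ N)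
    (hl : ∀ x ∈ N, b (a x) = x) (hr : ∀ y ∈ N', a (b y) = y) :
    Iso (M.ofStable N hN) (M'.ofStable N' hN') where
  toEquiv :=
    { a.restrict hab with
      invFun := fun y => ⟨b y, hba y y.2⟩
      left_inv := fun x => Subtype.ext (hl x x.2)
      right_inv := fun y => Subtype.ext (hr y y.2) }
  map_act c x := Subtype.ext (ha.map_act c x.1)
  map_gr x := Subtype.ext (ha.2 x.1)

theorem subCls_congr {M M' : CliffMod Q} {N : Submodule R M.carrier} {N' : Submodule R M'.carrier}
    (hN : M.Stable N) (hN' : M'.Stable N') (a : M.carrier →ₗ[R] M'.carrier) (ha : IsMor M M' a)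
    (b : M'.carrier → M.carrier) (hab : ∀ x ∈ N, a x ∈ N') (hba : ∀ y ∈ N', b y ∈ N)
    (hl : ∀ x ∈ N, b (a x) = x) (hr : ∀ y ∈ N', a (b y) = y) :
    M.subCls N = M'.subCls N' := by
  rw [subCls_eq hN, subCls_eq hN']
  exact (isoOfStable hN hN' a ha b hab hba hl hr).cls_eq

theorem SubFGP.congr {M M' : CliffMod Q} {N : Submodule R M.carrier}
    {N' : Submodule R M'.carrier} (hN : M.SubFGP N) (hN' : M'.Stable N')
    (a : M.carrier →ₗ[R] M'.carrier) (ha : IsMor M M' a)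
    (b : M'.carrier → M.carrier) (hab : ∀ x ∈ N, a x ∈ N') (hba : ∀ y ∈ N', b y ∈ N)
    (hl : ∀ x ∈ N, b (a x) = x) (hr : ∀ y ∈ N', a (b y) = y) : M'.SubFGP N' := by
  obtain ⟨h, h'⟩ := hN
  exact ⟨hN', (isoOfStable h hN' a ha b hab hba hl hr).isFGP h'⟩

/-- The whole module, as a stable submodule. -/
def isoTop (M : CliffMod Q) : Iso (M.ofStable ⊤ Stable.top) M where
  toEquiv := Submodule.topEquiv
  map_act _ _ := rfl
  map_gr _ := rfl

theorem subCls_top (M : CliffMod Q) : M.subCls ⊤ = M.cls := by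
  rw [subCls_eq Stable.top]
  exact (isoTop M).cls_eq

theorem subFGP_top {M : CliffMod Q} (h : M.IsFGP) : M.SubFGP ⊤ :=
  ⟨Stable.top, (isoTop M).symm.isFGP h⟩

/-- A stable submodule which is a retract of a finitely generated projective one. -/
theorem SubFGP.of_retract {M : CliffMod Q} {N N' : Submodule R M.carrier} (h : M.SubFGP N)
    (hN' : M.Stable N') (hle : N' ≤ N) (p : Module.End R M.carrier) (hp : IsMor M M p)
    (hpN : ∀ x ∈ N, p x ∈ N') (hpN' : ∀ x ∈ N', p x = x) : M.SubFGP N' := by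
  obtain ⟨hN, hF⟩ := h
  refine ⟨hN', IsFGP.of_retr (Retr.of_leftInverse
    ⟨Submodule.inclusion hle, fun v x => rfl⟩
    ⟨p.restrict hpN, fun v x => Subtype.ext (hp.1 v (Subtype.val x))⟩
    fun x => Subtype.ext (hpN' x x.2)) hF⟩

/-- A morphism which is idempotent on `N` splits `N`. -/
theorem subCls_add {M : CliffMod Q} {N : Submodule R M.carrier} (h : M.SubFGP N)
    (p : Module.End R M.carrier) (hp : IsMor M M p) (hpN : ∀ x ∈ N, p x ∈ N)
    (hpp : ∀ x ∈ N, p (p x) = p x) :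
    M.SubFGP (N ⊓ Module.End.eigenspace p 1) ∧ M.SubFGP (N ⊓ LinearMap.ker p) ∧
      M.subCls N = M.subCls (N ⊓ Module.End.eigenspace p 1) + M.subCls (N ⊓ LinearMap.ker p) := by
  have hS := h.1
  have h1 : M.Stable (N ⊓ Module.End.eigenspace p 1) := hS.inf (Stable.eigenspace hp 1)
  have h2 : M.Stable (N ⊓ LinearMap.ker p) := hS.inf (Stable.ker hp)
  have m1 : ∀ x ∈ N, p x ∈ N ⊓ Module.End.eigenspace p 1 := fun x hx =>
    ⟨hpN x hx, by rw [SetLike.mem_coe, Module.End.mem_eigenspace_iff, hpp x hx, one_smul]⟩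
  have m2 : ∀ x ∈ N, x - p x ∈ N ⊓ LinearMap.ker p := fun x hx =>
    ⟨N.sub_mem hx (hpN x hx), by rw [SetLike.mem_coe, LinearMap.mem_ker, map_sub, hpp x hx, sub_self]⟩
  have e1 : ∀ x ∈ N ⊓ Module.End.eigenspace p 1, p x = x := fun x hx => by
    have := Module.End.mem_eigenspace_iff.1 hx.2
    rwa [one_smul] at this
  have e2 : ∀ x ∈ N ⊓ LinearMap.ker p, p x = 0 := fun x hx => LinearMap.mem_ker.1 hx.2
  have f1 : M.SubFGP (N ⊓ Module.End.eigenspace p 1) := h.of_retract h1 inf_le_left p hp m1 e1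
  have f2 : M.SubFGP (N ⊓ LinearMap.ker p) := by
    refine h.of_retract h2 inf_le_left (LinearMap.id + (-1 : R) • p) (IsMor.id.add (hp.smul _))
      (fun x hx => ?_) (fun x hx => ?_)
    · have := m2 x hx
      simpa [← sub_eq_add_neg] using this
    · simp [e2 x hx]
  refine ⟨f1, f2, ?_⟩
  rw [subCls_eq hS, subCls_eq h1, subCls_eq h2]
  refine cls_prod f1.2 f2.2
    { toEquiv :=
        { toFun := fun x => (⟨p x, m1 x x.2⟩, ⟨x - p x, m2 x x.2⟩)
          map_add' := fun x y => Prod.ext (Subtype.ext (by simp)) (Subtype.ext (by simp; abel))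
          map_smul' := fun r x =>
            Prod.ext (Subtype.ext (by simp)) (Subtype.ext (by simp [smul_sub]))
          invFun := fun y => ⟨y.1 + y.2, N.add_mem y.1.2.1 y.2.2.1⟩
          left_inv := fun x => Subtype.ext (by simp)
          right_inv := fun y => Prod.ext (Subtype.ext (by simp [e1 _ y.1.2, e2 _ y.2.2]))
            (Subtype.ext (by simp [e1 _ y.1.2, e2 _ y.2.2])) }
      map_act := fun c x => Prod.ext (Subtype.ext (hp.map_act c x.1))
        (Subtype.ext ?_)
      map_gr := fun x => Prod.ext (Subtype.ext (hp.2 x.1)) (Subtype.ext ?_) }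
  · change M.act c x.1 - p (M.act c x.1) = M.act c (x.1 - p x.1)
    rw [hp.map_act, map_sub]
  · change M.gr x.1 - p (M.gr x.1) = M.gr (x.1 - p x.1)
    rw [hp.2, map_sub]

/-- A finite family of orthogonal idempotent morphisms with sum `1` on `N` decomposes `N`. -/
theorem subCls_decomp {κ : Type*} (s : Finset κ) {M : CliffMod Q}
    {N : Submodule R M.carrier} (h : M.SubFGP N) (p : κ → Module.End R M.carrier)
    (hp : ∀ i ∈ s, IsMor M M (p i)) (hpN : ∀ i ∈ s, ∀ x ∈ N, p i x ∈ N)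
    (hpp : ∀ i ∈ s, ∀ x ∈ N, p i (p i x) = p i x)
    (hpq : ∀ i ∈ s, ∀ j ∈ s, i ≠ j → ∀ x ∈ N, p i (p j x) = 0)
    (hsum : ∀ x ∈ N, ∑ i ∈ s, p i x = x) :
    (∀ i ∈ s, M.SubFGP (N ⊓ Module.End.eigenspace (p i) 1)) ∧
      M.subCls N = ∑ i ∈ s, M.subCls (N ⊓ Module.End.eigenspace (p i) 1) := by
  classical
  refine ⟨fun i hi => (subCls_add h (p i) (hp i hi) (hpN i hi) (hpp i hi)).1, ?_⟩
  induction s using Finset.induction_on generalizing N with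
  | empty =>
    have : N = ⊥ := by
      rw [Submodule.eq_bot_iff]
      intro x hx
      rw [← hsum x hx, Finset.sum_empty]
    rw [this, subCls_bot, Finset.sum_empty]
  | insert a s ha ih =>
    have hma := Finset.mem_insert_self a s
    have hms : ∀ {i}, i ∈ s → i ∈ insert a s := fun h => Finset.mem_insert_of_mem h
    have hne : ∀ {i}, i ∈ s → a ≠ i := fun hi e => ha (e ▸ hi)
    obtain ⟨-, h2, h3⟩ := subCls_add h (p a) (hp a hma) (hpN a hma) (hpp a hma)
    rw [h3, Finset.sum_insert ha]
    congr 1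
    have := ih h2 (fun i hi => hp i (hms hi))
      (fun i hi x hx => ⟨hpN i (hms hi) x hx.1,
        LinearMap.mem_ker.2 (hpq a hma i (hms hi) (hne hi) x hx.1)⟩)
      (fun i hi x hx => hpp i (hms hi) x hx.1)
      (fun i hi j hj hij x hx => hpq i (hms hi) j (hms hj) hij x hx.1)
      (fun x hx => by
        have h4 := hsum x hx.1
        rw [Finset.sum_insert ha, LinearMap.mem_ker.1 hx.2, zero_add] at h4
        exact h4)
    rw [this]
    refine Finset.sum_congr rfl fun i hi => congrArg _ ?_
    ext x
    simp only [Submodule.mem_inf, LinearMap.mem_ker, Module.End.mem_eigenspace_iff, one_smul]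
    refine ⟨fun hx => ⟨hx.1.1, hx.2⟩, fun hx => ⟨⟨hx.1, ?_⟩, hx.2⟩⟩
    rw [← hx.2]
    exact hpq a hma i (hms hi) (hne hi) x hx.1

/-! ### Roots of unity -/

/-- `z` behaves like a primitive `k`-th root of unity: its powers satisfy the orthogonality
relations. In a ring in which `k` is invertible, this holds for the roots of `Φ_k`. -/
structure IsCycRoot {A : Type*} [CommRing A] (k : ℕ) (z : A) : Prop where
  pow_eq : z ^ k = 1
  sum_eq : ∀ j, ¬ k ∣ j → ∑ i ∈ Finset.range k, z ^ (i * j) = 0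

theorem IsCycRoot.map {A B : Type*} [CommRing A] [CommRing B] {k : ℕ} {z : A} (h : IsCycRoot k z)
    (f : A →+* B) : IsCycRoot k (f z) :=
  ⟨by rw [← map_pow, h.pow_eq, map_one], fun j hj => by
    simp only [← map_pow, ← map_sum, h.sum_eq j hj, map_zero]⟩

theorem IsCycRoot.pow_mod {A : Type*} [CommRing A] {k : ℕ} {z : A} (h : IsCycRoot k z) (j : ℕ) :
    z ^ (j % k) = z ^ j := by
  conv_rhs => rw [← Nat.mod_add_div j k, pow_add, pow_mul, h.pow_eq, one_pow, mul_one]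

instance (k : ℕ) [NeZero k] : IsDomain (Omega k) :=
  AdjoinRoot.isDomain_of_prime
    (Polynomial.cyclotomic.irreducible (Nat.pos_of_ne_zero (NeZero.ne k))).prime

instance (k : ℕ) [NeZero k] : CharZero (Omega k) := by
  have h : Function.Injective (AdjoinRoot.of (Polynomial.cyclotomic k ℤ)) := by
    refine AdjoinRoot.of.injective_of_degree_ne_zero ?_
    rw [Polynomial.degree_cyclotomic]
    exact_mod_cast (Nat.totient_pos.2 (Nat.pos_of_ne_zero (NeZero.ne k))).ne'
  exact ⟨fun a b hab => by
    have : AdjoinRoot.of (Polynomial.cyclotomic k ℤ) (a : ℤ) =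
        AdjoinRoot.of (Polynomial.cyclotomic k ℤ) (b : ℤ) := by
      simpa using hab
    exact_mod_cast h this⟩

theorem isPrimitiveRoot_omegaRoot (k : ℕ) [NeZero k] : IsPrimitiveRoot (omegaRoot k) k := by
  have : NeZero (k : Omega k) := ⟨Nat.cast_ne_zero.2 (NeZero.ne k)⟩
  rw [← Polynomial.isRoot_cyclotomic_iff, Polynomial.IsRoot,
    ← Polynomial.map_cyclotomic k (algebraMap ℤ (Omega k)), Polynomial.eval_map]
  exact AdjoinRoot.eval₂_root _

theorem isCycRoot_omegaRoot (k : ℕ) [NeZero k] : IsCycRoot k (omegaRoot k) := by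
  have h := isPrimitiveRoot_omegaRoot k
  refine ⟨h.pow_eq_one, fun j hj => ?_⟩
  have h1 : omegaRoot k ^ j - 1 ≠ 0 := fun e =>
    hj ((h.pow_eq_one_iff_dvd j).1 (sub_eq_zero.1 e))
  refine (mul_eq_zero.1 ?_).resolve_left h1
  simp only [mul_comm _ j, pow_mul]
  rw [mul_geom_sum, ← pow_mul, mul_comm, pow_mul, h.pow_eq_one, one_pow, sub_self]

theorem exists_ringHom_of_isRoot {k : ℕ} {ζ : R} (hζ : (Polynomial.cyclotomic k R).IsRoot ζ) :
    ∃ f : Omega k →+* R, f (omegaRoot k) = ζ := by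
  refine ⟨AdjoinRoot.lift (Int.castRingHom R) ζ ?_, AdjoinRoot.lift_root _⟩
  rwa [← Polynomial.eval_map, Polynomial.map_cyclotomic]

theorem isCycRoot_of_isRoot {k : ℕ} (hk : 0 < k) {ζ : R}
    (hζ : (Polynomial.cyclotomic k R).IsRoot ζ) : IsCycRoot k ζ := by
  have : NeZero k := ⟨hk.ne'⟩
  obtain ⟨f, hf⟩ := exists_ringHom_of_isRoot hζ
  exact hf ▸ (isCycRoot_omegaRoot k).map f

theorem sum_range_shift {A : Type*} [AddCommMonoid A] {k : ℕ} (f : ℕ → A)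
    (hf : ∀ j, f (j + k) = f j) (w : ℕ) :
    ∑ j ∈ Finset.range k, f (j + w) = ∑ j ∈ Finset.range k, f j := by
  induction w with
  | zero => rfl
  | succ w ih =>
    rw [← ih]
    have h1 := Finset.sum_range_succ (fun j => f (j + w)) k
    have h2 := Finset.sum_range_succ' (fun j => f (j + w)) k
    cases k with
    | zero => rfl
    | succ k =>
      rw [Finset.sum_range_succ, Finset.sum_range_succ' (fun j => f (j + w))]
      have h3 : f (k + (w + 1)) = f (0 + w) := by
        rw [← hf (0 + w)]
        congr 1
        omega
      rw [h3]
      congr 1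
      exact Finset.sum_congr rfl fun j _ => congrArg f (by omega)

theorem sum_range_mul' {A : Type*} [AddCommMonoid A] (g n : ℕ) (f : ℕ → A) :
    ∑ j ∈ Finset.range (g * n), f j =
      ∑ r ∈ Finset.range g, ∑ i ∈ Finset.range n, f (r + g * i) := by
  induction n with
  | zero => simp
  | succ n ih =>
    simp only [Finset.sum_range_succ, Finset.sum_add_distrib]
    rw [← ih, Nat.mul_succ, Finset.sum_range_add]
    congr 1
    exact Finset.sum_congr rfl fun j _ => congrArg f (by omega)

/-- If `x j` depends only on the class of `j` modulo `k` and modulo some `m` which is not a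
multiple of `k`, then `∑ x j ⊗ ω^j` vanishes: the sum of `ω^j` over each coset of the subgroup
generated by `m` is `0`. -/
theorem sum_tmul_eq_zero {A : Type*} [AddCommGroup A] {k : ℕ} [NeZero k] (x : ℕ → A) (m : ℕ)
    (hm : ¬ k ∣ m) (hx : ∀ j, x (j + k) = x j) (hxm : ∀ j, x (j + m) = x j) :
    ∑ j ∈ Finset.range k, x j ⊗ₜ[ℤ] (omegaRoot k ^ j) = 0 := by
  have hk : 0 < k := Nat.pos_of_ne_zero (NeZero.ne k)
  have hg : ¬ k ∣ m.gcd k := fun h => hm (h.trans (Nat.gcd_dvd_left m k))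
  have hglt : m.gcd k < k := lt_of_le_of_ne (Nat.le_of_dvd hk (Nat.gcd_dvd_right m k))
    fun h => hg (by rw [h])
  obtain ⟨s, -, hs⟩ := Nat.exists_mul_mod_eq_gcd hglt
  have hmul : ∀ (a j i : ℕ), (∀ j, x (j + a) = x j) → x (j + a * i) = x j := by
    intro a j i ha
    induction i with
    | zero => rfl
    | succ i ih => rw [Nat.mul_succ, ← add_assoc, ha, ih]
  have hxg : ∀ j, x (j + m.gcd k) = x j := by
    intro j
    rw [← hmul k _ (m * s / k) hx, add_assoc, ← hs, Nat.mod_add_div, hmul m j s hxm]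
  obtain ⟨n, hn⟩ := Nat.gcd_dvd_right m k
  have hsum : ∑ i ∈ Finset.range n, omegaRoot k ^ (m.gcd k * i) = 0 := by
    have h := isPrimitiveRoot_omegaRoot k
    have h1 : omegaRoot k ^ m.gcd k - 1 ≠ 0 := fun e =>
      hg ((h.pow_eq_one_iff_dvd _).1 (sub_eq_zero.1 e))
    refine (mul_eq_zero.1 ?_).resolve_left h1
    simp only [pow_mul]
    rw [mul_geom_sum, ← pow_mul, ← hn, h.pow_eq_one, sub_self]
  have h1 : ∑ j ∈ Finset.range k, x j ⊗ₜ[ℤ] (omegaRoot k ^ j) =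
      ∑ j ∈ Finset.range (m.gcd k * n), x j ⊗ₜ[ℤ] (omegaRoot k ^ j) := by rw [← hn]
  rw [h1, sum_range_mul']
  refine Finset.sum_eq_zero fun r _ => ?_
  simp only [hmul _ _ _ hxg, pow_add]
  rw [← TensorProduct.tmul_sum, ← Finset.mul_sum, hsum, mul_zero, TensorProduct.tmul_zero]

/-! ### Eigenspaces of automorphisms of finite order -/

section Eigen

variable {X : Type*} [AddCommGroup X] [Module R X]

/-- For `T` with `T^k = 1`, the projection onto the eigenspace of `T` for the eigenvalue `ζ^j`;
here `ζ^((k - 1) * j)` is the inverse of `ζ^j`. -/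
def eigProj (k : ℕ) (ζ : R) (T : Module.End R X) (j : ℕ) : Module.End R X :=
  Ring.inverse (k : R) • ∑ i ∈ Finset.range k, ζ ^ (i * ((k - 1) * j)) • T ^ i

theorem IsCycRoot.pow_neg_mul {k : ℕ} (hk : 0 < k) {ζ : R} (h : IsCycRoot k ζ) (j : ℕ) :
    ζ ^ ((k - 1) * j) * ζ ^ j = 1 := by
  rw [← pow_add, show (k - 1) * j + j = k * j by
    rw [← Nat.succ_mul, Nat.succ_eq_add_one, Nat.sub_add_cancel hk], pow_mul, h.pow_eq, one_pow]

variable {k : ℕ} {ζ : R} (hk : 0 < k) (hu : IsUnit (k : R)) (hζ : IsCycRoot k ζ)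

theorem eigProj_apply (T : Module.End R X) (j : ℕ) (x : X) :
    eigProj k ζ T j x =
      Ring.inverse (k : R) • ∑ i ∈ Finset.range k, ζ ^ (i * ((k - 1) * j)) • (T ^ i) x := by
  simp [eigProj, LinearMap.sum_apply]

theorem eigProj_mem {N : Submodule R X} {T : Module.End R X} (hT : ∀ x ∈ N, T x ∈ N) (j : ℕ) :
    ∀ x ∈ N, eigProj k ζ T j x ∈ N := by
  intro x hx
  rw [eigProj_apply]
  have h : ∀ i, (T ^ i) x ∈ N := fun i => ?_
  · exact N.smul_mem _ (N.sum_mem fun i _ => N.smul_mem _ (h i))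
  induction i with
  | zero => exact hx
  | succ i ih =>
    rw [pow_succ']
    exact hT _ ih

include hk hζ in
theorem apply_eigProj {T : Module.End R X} {x : X} (hx : (T ^ k) x = x) (j : ℕ) :
    T (eigProj k ζ T j x) = ζ ^ j • eigProj k ζ T j x := by
  rw [eigProj_apply, map_smul, smul_comm]
  congr 1
  have h1 := sum_range_shift (k := k) (fun i => ζ ^ (i * ((k - 1) * j)) • (T ^ i) x)
    (fun i => by
      simp only [add_mul, pow_add, Module.End.mul_apply, hx]
      rw [pow_mul ζ k, hζ.pow_eq, one_pow, mul_one]) 1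
  conv_rhs => rw [← h1]
  rw [map_sum, Finset.smul_sum]
  refine Finset.sum_congr rfl fun i _ => ?_
  rw [map_smul, pow_succ' T, Module.End.mul_apply, smul_smul]
  congr 1
  rw [add_mul, one_mul, pow_add]
  linear_combination -(ζ ^ (i * ((k - 1) * j))) * hζ.pow_neg_mul hk j

include hk hu hζ in
theorem sum_eigProj (T : Module.End R X) (x : X) :
    ∑ j ∈ Finset.range k, eigProj k ζ T j x = x := by
  simp only [eigProj_apply]
  rw [← Finset.smul_sum, Finset.sum_comm]
  simp only [← Finset.sum_smul]
  rw [Finset.sum_eq_single_of_mem 0 (Finset.mem_range.2 hk)]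
  · simp [smul_smul, Ring.inverse_mul_cancel _ hu]
  · intro i hi hi0
    have : ∑ j ∈ Finset.range k, ζ ^ (i * ((k - 1) * j)) = 0 := by
      have h1 := hζ.sum_eq (i * (k - 1)) fun hd => by
        have hc : Nat.Coprime k (k - 1) := by
          obtain ⟨l, rfl⟩ : ∃ l, k = l + 1 := ⟨k - 1, (Nat.sub_add_cancel hk).symm⟩
          simp
        exact hi0 (Nat.eq_zero_of_dvd_of_lt (hc.dvd_of_dvd_mul_right hd) (Finset.mem_range.1 hi))
      rw [← h1]
      exact Finset.sum_congr rfl fun j _ => congrArg _ (by ring)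
    rw [this, zero_smul]

include hk hu hζ in
theorem eigProj_of_eigen {T : Module.End R X} {x : X} {j : ℕ} (hx : T x = ζ ^ j • x) :
    eigProj k ζ T j x = x := by
  have h1 : ∀ i, (T ^ i) x = ζ ^ (i * j) • x := by
    intro i
    induction i with
    | zero => simp
    | succ i ih => rw [pow_succ', Module.End.mul_apply, ih, map_smul, hx, smul_smul, ← pow_add,
        add_mul, one_mul]
  rw [eigProj_apply]
  simp only [h1, smul_smul]
  have h2 : ∀ i, ζ ^ (i * ((k - 1) * j)) * ζ ^ (i * j) = 1 := by
    intro i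
    rw [mul_comm i, pow_mul _ _ i, mul_comm i, pow_mul _ _ i, ← mul_pow, hζ.pow_neg_mul hk, one_pow]
  simp only [h2, one_smul, Finset.sum_const, Finset.card_range]
  rw [← Nat.cast_smul_eq_nsmul R, smul_smul, Ring.inverse_mul_cancel _ hu, one_smul]

include hu hζ in
theorem eq_zero_of_pow_smul_eq {i j : ℕ} (hi : i < k) (hj : j < k) (hij : i ≠ j) {x : X}
    (hx : ζ ^ i • x = ζ ^ j • x) : x = 0 := by
  wlog h : j < i generalizing i j
  · exact this hj hi hij.symm hx.symm (lt_of_le_of_ne (not_lt.1 h) hij)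
  have hk : 0 < k := by omega
  have h1 : ζ ^ (i - j) • x = x := by
    have h2 := congrArg (fun y => ζ ^ ((k - 1) * j) • y) hx
    simp only [smul_smul] at h2
    rw [hζ.pow_neg_mul hk, one_smul, show i = j + (i - j) by omega, pow_add, ← mul_assoc,
      hζ.pow_neg_mul hk, one_mul] at h2
    exact h2
  have h2 : ∀ l, ζ ^ (l * (i - j)) • x = x := by
    intro l
    induction l with
    | zero => simp
    | succ l ih => rw [add_mul, one_mul, pow_add, ← smul_smul, h1, ih]
  have h3 := hζ.sum_eq (i - j) fun hd =>
    absurd (Nat.eq_zero_of_dvd_of_lt hd (by omega)) (by omega)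
  have h4 : (∑ l ∈ Finset.range k, ζ ^ (l * (i - j))) • x = (k : R) • x := by
    rw [Finset.sum_smul]
    simp only [h2, Finset.sum_const, Finset.card_range]
    rw [Nat.cast_smul_eq_nsmul]
  rw [h3, zero_smul] at h4
  rw [← one_smul R x, ← Ring.inverse_mul_cancel _ hu, ← smul_smul, ← h4, smul_zero]

include hk hu hζ in
/-- An automorphism `T` with `T^k = 1` is diagonalizable. -/
theorem isInternal_eigenspace {T : Module.End R X} (hT : T ^ k = 1) :
    DirectSum.IsInternal (fun j : Fin k => Module.End.eigenspace T (ζ ^ (j : ℕ))) := by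
  classical
  have hTk : ∀ x, (T ^ k) x = x := fun x => by rw [hT]; rfl
  have hz : ∀ (i j : Fin k), i ≠ j → ∀ x ∈ Module.End.eigenspace T (ζ ^ (j : ℕ)),
      eigProj k ζ T i x = 0 := by
    intro i j hij x hx
    rw [Module.End.mem_eigenspace_iff] at hx
    refine eq_zero_of_pow_smul_eq hu hζ i.2 j.2 (fun h => hij (Fin.ext h)) ?_
    have hc : T * eigProj k ζ T i = eigProj k ζ T i * T :=
      ((Commute.sum_right _ _ _ fun l _ =>
        ((Commute.refl T).pow_right l).smul_right _).smul_right _)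
    rw [← apply_eigProj hk hζ (hTk x), ← map_smul, ← hx]
    exact LinearMap.congr_fun hc x
  constructor
  · refine (injective_iff_map_eq_zero (DirectSum.coeAddMonoidHom
      (fun j : Fin k => Module.End.eigenspace T (ζ ^ (j : ℕ))))).2 fun y hy => ?_
    refine DFinsupp.ext fun i => Subtype.ext ?_
    have h1 : eigProj k ζ T i (DirectSum.coeAddMonoidHom
        (fun j : Fin k => Module.End.eigenspace T (ζ ^ (j : ℕ))) y) = y i := by
      clear hy
      induction y using DirectSum.induction_on with
      | zero => simp
      | of j z =>
        rw [DirectSum.coeAddMonoidHom_of]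
        by_cases hij : i = j
        · subst hij
          rw [DirectSum.of_eq_same]
          exact eigProj_of_eigen hk hu hζ (Module.End.mem_eigenspace_iff.1 z.2)
        · rw [hz i j hij z z.2, DirectSum.of_eq_of_ne _ _ _ hij]
          rfl
      | add y z hy hz => rw [map_add, map_add, hy, hz, DirectSum.add_apply]; rfl
    rw [hy, map_zero] at h1
    exact h1.symm
  · intro x
    refine ⟨∑ j : Fin k, DirectSum.of (fun j : Fin k => Module.End.eigenspace T (ζ ^ (j : ℕ))) j
      ⟨eigProj k ζ T j x, Module.End.mem_eigenspace_iff.2 (apply_eigProj hk hζ (hTk x) j)⟩, ?_⟩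
    rw [map_sum]
    simp only [DirectSum.coeAddMonoidHom_of]
    rw [Fin.sum_univ_eq_sum_range (fun j => eigProj k ζ T j x)]
    exact sum_eigProj hk hu hζ T x

theorem IsMor.eigProj {M : CliffMod Q} {T : Module.End R M.carrier} (hT : IsMor M M T) (j : ℕ) :
    IsMor M M (eigProj k ζ T j) :=
  (IsMor.sum _ fun i _ => (hT.pow i).smul _).smul _

end Eigen

/-! ### The class of a module with an automorphism of finite order -/

/-- The class `∑_{j < k} N_{ζ^j} · ω^j` of a stable submodule `N` of `M` equipped with an
automorphism `T` of order `k`, where `N_μ` is the eigenmodule of `T` on `N`. -/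
def chi (k : ℕ) (ζ : R) (M : CliffMod Q) (T : Module.End R M.carrier)
    (N : Submodule R M.carrier) : GrK Q ⊗[ℤ] Omega k :=
  ∑ j ∈ Finset.range k, M.subCls (N ⊓ Module.End.eigenspace T (ζ ^ j)) ⊗ₜ[ℤ] (omegaRoot k ^ j)

section Chi

variable {k : ℕ} {ζ : R} {M M' : CliffMod Q}

theorem SubFGP.eigen (hk : 0 < k) (hu : IsUnit (k : R)) (hζ : IsCycRoot k ζ)
    {N : Submodule R M.carrier} (h : M.SubFGP N) {T : Module.End R M.carrier} (hT : IsMor M M T)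
    (hTN : ∀ x ∈ N, T x ∈ N) (hTk : ∀ x ∈ N, (T ^ k) x = x) (j : ℕ) :
    M.SubFGP (N ⊓ Module.End.eigenspace T (ζ ^ j)) := by
  refine h.of_retract (h.1.inf (Stable.eigenspace hT _)) inf_le_left (eigProj k ζ T j)
    (hT.eigProj j) (fun x hx => ⟨eigProj_mem hTN j x hx, ?_⟩) (fun x hx => ?_)
  · exact Module.End.mem_eigenspace_iff.2 (apply_eigProj hk hζ (hTk x hx) j)
  · exact eigProj_of_eigen hk hu hζ (Module.End.mem_eigenspace_iff.1 hx.2)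

/-- A morphism which restricts to a bijection `N → N'` commuting with the automorphisms preserves the
class. The inverse `b` need not be linear. -/
theorem chi_congr {N : Submodule R M.carrier} {N' : Submodule R M'.carrier} (hN : M.Stable N)
    (hN' : M'.Stable N') {T : Module.End R M.carrier} {T' : Module.End R M'.carrier}
    (hT : IsMor M M T) (hT' : IsMor M' M' T') (hTN : ∀ x ∈ N, T x ∈ N)
    (a : M.carrier →ₗ[R] M'.carrier) (ha : IsMor M M' a)
    (b : M'.carrier → M.carrier) (hab : ∀ x ∈ N, a x ∈ N') (hba : ∀ y ∈ N', b y ∈ N)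
    (hl : ∀ x ∈ N, b (a x) = x) (hr : ∀ y ∈ N', a (b y) = y)
    (haT : ∀ x ∈ N, a (T x) = T' (a x)) : chi k ζ M T N = chi k ζ M' T' N' := by
  refine Finset.sum_congr rfl fun j _ => congrArg (· ⊗ₜ[ℤ] (omegaRoot k ^ j)) ?_
  refine subCls_congr (hN.inf (Stable.eigenspace hT _)) (hN'.inf (Stable.eigenspace hT' _)) a ha b
    (fun x hx => ⟨hab x hx.1, ?_⟩) (fun y hy => ⟨hba y hy.1, ?_⟩) (fun x hx => hl x hx.1)
    (fun y hy => hr y hy.1)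
  · have := Module.End.mem_eigenspace_iff.1 hx.2
    refine Module.End.mem_eigenspace_iff.2 ?_
    rw [← haT x hx.1, this, map_smul]
  · have hy2 := Module.End.mem_eigenspace_iff.1 hy.2
    refine Module.End.mem_eigenspace_iff.2 ?_
    have hby := hba y hy.1
    rw [← hl _ (hTN _ hby), ← hl _ (N.smul_mem (ζ ^ j) hby), haT _ hby, map_smul, hr y hy.1, hy2]

/-- Orthogonal idempotent morphisms `p i` with sum `1` on `N`, which commute with `T`, decompose the
class of `(N, T)`. -/
theorem chi_decomp (hk : 0 < k) (hu : IsUnit (k : R)) (hζ : IsCycRoot k ζ)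
    {N : Submodule R M.carrier} (h : M.SubFGP N) {T : Module.End R M.carrier} (hT : IsMor M M T)
    (hTN : ∀ x ∈ N, T x ∈ N) (hTk : ∀ x ∈ N, (T ^ k) x = x)
    {κ : Type*} (s : Finset κ) (p : κ → Module.End R M.carrier)
    (hp : ∀ i ∈ s, IsMor M M (p i)) (hpN : ∀ i ∈ s, ∀ x ∈ N, p i x ∈ N)
    (hpp : ∀ i ∈ s, ∀ x ∈ N, p i (p i x) = p i x)
    (hpq : ∀ i ∈ s, ∀ j ∈ s, i ≠ j → ∀ x ∈ N, p i (p j x) = 0)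
    (hsum : ∀ x ∈ N, ∑ i ∈ s, p i x = x) (hpT : ∀ i ∈ s, ∀ x ∈ N, T (p i x) = p i (T x)) :
    chi k ζ M T N = ∑ i ∈ s, chi k ζ M T (N ⊓ Module.End.eigenspace (p i) 1) := by
  unfold chi
  rw [Finset.sum_comm]
  refine Finset.sum_congr rfl fun j _ => ?_
  rw [← TensorProduct.sum_tmul]
  congr 1
  rw [(subCls_decomp s (h.eigen hk hu hζ hT hTN hTk j) p hp (fun i hi x hx => ⟨hpN i hi x hx.1, ?_⟩)
    (fun i hi x hx => hpp i hi x hx.1) (fun i hi i' hi' hii x hx => hpq i hi i' hi' hii x hx.1)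
    (fun x hx => hsum x hx.1)).2]
  · exact Finset.sum_congr rfl fun i _ => congrArg _ (inf_right_comm _ _ _)
  · refine Module.End.mem_eigenspace_iff.2 ?_
    rw [hpT i hi x hx.1, Module.End.mem_eigenspace_iff.1 hx.2, map_smul]

/-- An operator `D` on `N` with `D T = ζ^m T D` identifies the eigenmodules of `T` for `ζ^(j+m)`
and `ζ^j`, so that the class of `(N, T)` vanishes if `m` is not a multiple of `k`. -/
theorem chi_eq_zero (hk : 0 < k) (hζ : IsCycRoot k ζ)
    {N : Submodule R M.carrier} (hN : M.Stable N) {T : Module.End R M.carrier} (hT : IsMor M M T)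
    (hTN : ∀ x ∈ N, T x ∈ N) {m : ℕ} (hm : ¬ k ∣ m) (D : Module.End R M.carrier)
    (hD : IsMor M M D) (D' : M.carrier → M.carrier)
    (hDN : ∀ x ∈ N, D x ∈ N) (hDN' : ∀ x ∈ N, D' x ∈ N) (hl : ∀ x ∈ N, D' (D x) = x)
    (hr : ∀ x ∈ N, D (D' x) = x) (hDT : ∀ x ∈ N, D (T x) = ζ ^ m • T (D x)) :
    chi k ζ M T N = 0 := by
  have : NeZero k := ⟨hk.ne'⟩
  refine sum_tmul_eq_zero (fun j => M.subCls (N ⊓ Module.End.eigenspace T (ζ ^ j))) m hm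
    (fun j => by simp only [pow_add, hζ.pow_eq, mul_one]) fun j => ?_
  have hcancel : ∀ x y : M.carrier, ζ ^ m • x = ζ ^ m • y → x = y := by
    intro x y hxy
    have := congrArg (fun z => ζ ^ ((k - 1) * m) • z) hxy
    simpa only [smul_smul, hζ.pow_neg_mul hk, one_smul] using this
  refine subCls_congr (hN.inf (Stable.eigenspace hT _)) (hN.inf (Stable.eigenspace hT _)) D hD D'
    (fun x hx => ⟨hDN x hx.1, Module.End.mem_eigenspace_iff.2 ?_⟩)
    (fun y hy => ⟨hDN' y hy.1, Module.End.mem_eigenspace_iff.2 ?_⟩)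
    (fun x hx => hl x hx.1) (fun y hy => hr y hy.1)
  · apply hcancel
    rw [← hDT x hx.1, Module.End.mem_eigenspace_iff.1 hx.2, map_smul, smul_smul, pow_add, mul_comm]
  · have hy' := hDN' y hy.1
    have h1 : D (T (D' y)) = D (ζ ^ (j + m) • D' y) := by
      rw [hDT _ hy', hr y hy.1, Module.End.mem_eigenspace_iff.1 hy.2, map_smul, hr y hy.1,
        smul_smul, pow_add, mul_comm]
    rw [← hl _ (hTN _ hy'), h1, hl _ (N.smul_mem _ hy')]

/-- If `T` is multiplication by `ζ^w` on `N`, only the eigenmodule for `ζ^w` is nonzero. -/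
theorem chi_scalar (hk : 0 < k) (hu : IsUnit (k : R)) (hζ : IsCycRoot k ζ)
    {N : Submodule R M.carrier} {T : Module.End R M.carrier} (w : ℕ)
    (hTw : ∀ x ∈ N, T x = ζ ^ w • x) :
    chi k ζ M T N = M.subCls N ⊗ₜ[ℤ] (omegaRoot k ^ w) := by
  have : NeZero k := ⟨hk.ne'⟩
  have hw : w % k < k := Nat.mod_lt _ hk
  have hTw' : ∀ x ∈ N, T x = ζ ^ (w % k) • x := fun x hx => by rw [hζ.pow_mod, hTw x hx]
  unfold chi
  rw [Finset.sum_eq_single_of_mem (w % k) (Finset.mem_range.2 hw)]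
  · rw [(isCycRoot_omegaRoot k).pow_mod, inf_eq_left.2]
    exact fun x hx => Module.End.mem_eigenspace_iff.2 (hTw' x hx)
  · intro j hj hjw
    have : N ⊓ Module.End.eigenspace T (ζ ^ j) = ⊥ := by
      rw [Submodule.eq_bot_iff]
      intro x hx
      refine eq_zero_of_pow_smul_eq hu hζ (Finset.mem_range.1 hj) hw hjw ?_
      rw [← Module.End.mem_eigenspace_iff.1 hx.2, hTw' x hx.1]
    rw [this, subCls_bot, TensorProduct.zero_tmul]

/-- Multiplication by `α` on the coefficients. -/
def mulOmega (k : ℕ) (Q : QuadraticForm R V) (α : Omega k) :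
    GrK Q ⊗[ℤ] Omega k →ₗ[ℤ] GrK Q ⊗[ℤ] Omega k :=
  TensorProduct.map LinearMap.id (LinearMap.mulRight ℤ α)

/-- Replacing `T` by `ζ^w T` shifts the eigenvalues, which multiplies the class by `ω^w`. -/
theorem chi_smul (hk : 0 < k) (hζ : IsCycRoot k ζ) (N : Submodule R M.carrier)
    {T T' : Module.End R M.carrier} (w : ℕ) (hT : ∀ x ∈ N, T' x = ζ ^ w • T x) :
    chi k ζ M T' N = mulOmega k Q (omegaRoot k ^ w) (chi k ζ M T N) := by
  have : NeZero k := ⟨hk.ne'⟩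
  have hω := isCycRoot_omegaRoot k
  unfold chi
  rw [← sum_range_shift (fun j => M.subCls (N ⊓ Module.End.eigenspace T' (ζ ^ j)) ⊗ₜ[ℤ]
    (omegaRoot k ^ j)) (fun j => by simp only [pow_add, hζ.pow_eq, hω.pow_eq, mul_one]) w, map_sum]
  refine Finset.sum_congr rfl fun j _ => ?_
  refine Eq.trans ?_ (TensorProduct.map_tmul _ _ _ _).symm
  rw [LinearMap.mulRight_apply, ← pow_add, LinearMap.id_apply]
  congr 2
  ext x
  simp only [Submodule.mem_inf, Module.End.mem_eigenspace_iff]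
  refine and_congr_right fun hx => ?_
  rw [hT x hx]
  constructor
  · intro h
    have := congrArg (fun z => ζ ^ ((k - 1) * w) • z) h
    simp only [smul_smul, hζ.pow_neg_mul hk, one_smul] at this
    rw [this, pow_add, mul_left_comm, hζ.pow_neg_mul hk, mul_one]
  · intro h
    rw [h, smul_smul, ← pow_add, add_comm]

end Chi

/-! ### Projectivity of tensor products -/

section Induced

/-- The `R`-module `N` is finitely generated and projective, in terms of coordinates. -/
def HasCoords (R N : Type u) [CommRing R] [AddCommGroup N] [Module R N] : Prop :=
  ∃ (κ : Type) (_ : Fintype κ) (i : κ → N →ₗ[R] R) (p : κ → N), ∀ x, ∑ j, i j x • p j = x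

variable (Q₁ Q₃) (N : CliffMod Q₂)

/-- The operator on `C(V, Q₃) ⊗ N` which corresponds to the action of `v` on the factor `N` under
`indMap`. -/
def indOp (v : V) : Module.End R (CliffordAlgebra Q₃ ⊗[R] N.carrier) :=
  TensorProduct.map (contractLeft (QuadraticMap.polarBilin Q₂ v)) LinearMap.id +
    TensorProduct.map (involute (Q := Q₃)).toLinearMap (N.act (ι Q₂ v))

/-- Left multiplication by `v` on `C(V, Q) ⊗ N`. -/
def leftOp (Q : QuadraticForm R V) (v : V) :
    Module.End R (CliffordAlgebra Q ⊗[R] N.carrier) :=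
  TensorProduct.map (LinearMap.mulLeft R (ι Q v)) LinearMap.id

/-- The action of `v` on the second factor of `C(V, Q) ⊗ N`, by the sign rule. -/
def rightOp (Q : QuadraticForm R V) (v : V) :
    Module.End R (CliffordAlgebra Q ⊗[R] N.carrier) :=
  TensorProduct.map (involute (Q := Q)).toLinearMap (N.act (ι Q₂ v))

theorem leftOp_tmul (Q : QuadraticForm R V) (v : V) (a : CliffordAlgebra Q) (n : N.carrier) :
    leftOp N Q v (a ⊗ₜ n) = (ι Q v * a) ⊗ₜ n := rfl

theorem rightOp_tmul (Q : QuadraticForm R V) (v : V) (a : CliffordAlgebra Q) (n : N.carrier) :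
    rightOp N Q v (a ⊗ₜ n) = involute a ⊗ₜ N.act (ι Q₂ v) n := rfl

theorem indOp_tmul (v : V) (a : CliffordAlgebra Q₃) (n : N.carrier) :
    indOp Q₃ N v (a ⊗ₜ n) = contractLeft (QuadraticMap.polarBilin Q₂ v) a ⊗ₜ n +
      involute a ⊗ₜ N.act (ι Q₂ v) n := rfl

theorem involute_contractLeft (d : Module.Dual R V) (a : CliffordAlgebra Q) :
    involute (contractLeft d a) = -contractLeft d (involute a) := by
  induction a using CliffordAlgebra.left_induction with
  | algebraMap r => simp
  | add x y hx hy => simp only [map_add, hx, hy, neg_add]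
  | ι_mul x m hx =>
    simp only [contractLeft_ι_mul, map_sub, map_mul, map_smul, involute_ι, hx, neg_mul, map_neg]
    simp only [mul_neg, neg_sub, neg_neg]

theorem rightOp_sq (Q : QuadraticForm R V) (v : V) :
    rightOp N Q v * rightOp N Q v = Q₂ v • 1 := by
  refine TensorProduct.ext' fun a n => ?_
  simp [rightOp_tmul, N.act_ι_sq]

theorem rightOp_leftOp (Q : QuadraticForm R V) (v w : V) :
    rightOp N Q v * leftOp N Q w = -(leftOp N Q w * rightOp N Q v) := by
  refine TensorProduct.ext' fun a n => ?_
  simp [rightOp_tmul, leftOp_tmul, TensorProduct.neg_tmul]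

theorem indOp_sq (v : V) : indOp Q₃ N v * indOp Q₃ N v = Q₂ v • 1 := by
  refine TensorProduct.ext' fun a n => ?_
  simp [indOp_tmul, N.act_ι_sq, involute_contractLeft, contractLeft_contractLeft,
    TensorProduct.neg_tmul]

theorem indOp_leftOp (v w : V) : indOp Q₃ N v * leftOp N Q₃ w =
    QuadraticMap.polar Q₂ v w • 1 - leftOp N Q₃ w * indOp Q₃ N v := by
  refine TensorProduct.ext' fun a n => ?_
  simp only [Module.End.mul_apply, LinearMap.sub_apply, LinearMap.smul_apply, Module.End.one_apply,
    indOp_tmul, leftOp_tmul, map_add, contractLeft_ι_mul, map_mul, involute_ι, neg_mul,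
    TensorProduct.neg_tmul, TensorProduct.sub_tmul, QuadraticMap.polarBilin_apply_apply,
    TensorProduct.smul_tmul']
  abel

theorem anticomm_of_sq {A : Type*} [Ring A] [Algebra R A] (Q : QuadraticForm R V) (f : V → A)
    (hadd : ∀ v w, f (v + w) = f v + f w) (hf : ∀ v, f v * f v = Q v • 1) (v w : V) :
    f v * f w = QuadraticMap.polar Q v w • 1 - f w * f v := by
  have h := hf (v + w)
  rw [hadd, mul_add, add_mul, add_mul, hf, hf] at h
  rw [QuadraticMap.polar, sub_smul, sub_smul, ← h]
  abel

theorem rightOp_rightOp (Q : QuadraticForm R V) (v w : V) : rightOp N Q v * rightOp N Q w =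
    QuadraticMap.polar Q₂ v w • 1 - rightOp N Q w * rightOp N Q v := by
  refine anticomm_of_sq Q₂ (rightOp N Q) (fun v w => ?_) (rightOp_sq N Q) v w
  refine TensorProduct.ext' fun a n => ?_
  simp [rightOp_tmul, TensorProduct.tmul_add]

theorem indOp_add (v w : V) : indOp Q₃ N (v + w) = indOp Q₃ N v + indOp Q₃ N w := by
  refine TensorProduct.ext' fun a n => ?_
  simp only [indOp_tmul, LinearMap.add_apply, map_add, TensorProduct.tmul_add,
    TensorProduct.add_tmul]
  abel

theorem indOp_indOp (v w : V) : indOp Q₃ N v * indOp Q₃ N w =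
    QuadraticMap.polar Q₂ v w • 1 - indOp Q₃ N w * indOp Q₃ N v := by
  exact anticomm_of_sq Q₂ (indOp Q₃ N) (indOp_add Q₃ N) (indOp_sq Q₃ N) v w

variable {Q₁ Q₃} (h : ∀ v, Q₃ v = Q₁ v + Q₂ v)

theorem tensor_reg_act (v : V) : (tensor h (reg Q₁) N).act (ι Q₃ v) =
    leftOp N Q₁ v + rightOp N Q₁ v :=
  TensorProduct.ext' fun a n => tensor_act_ι h (reg Q₁) N v a n

/-- The map `C(V, Q₃) ⊗ N → C(V, Q₁) ⊗ N`, `a ⊗ n ↦ a · (1 ⊗ n)`, where `Q₃ = Q₁ + Q₂` and `N` is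
a graded `C(V, Q₂)`-module. It identifies `C(V, Q₁) ⊗ N` with an induced module. -/
def indMap : CliffordAlgebra Q₃ ⊗[R] N.carrier →ₗ[R] CliffordAlgebra Q₁ ⊗[R] N.carrier :=
  TensorProduct.lift (LinearMap.mk₂ R
    (fun a n => (tensor h (reg Q₁) N).act a ((1 : CliffordAlgebra Q₁) ⊗ₜ[R] n))
    (fun a b n => by rw [map_add]; rfl) (fun r a n => by rw [map_smul]; rfl)
    (fun a m n => by rw [TensorProduct.tmul_add, map_add])
    (fun r a n => by rw [TensorProduct.tmul_smul, map_smul]))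

theorem indMap_tmul (a : CliffordAlgebra Q₃) (n : N.carrier) :
    indMap N h (a ⊗ₜ n) = (tensor h (reg Q₁) N).act a ((1 : CliffordAlgebra Q₁) ⊗ₜ[R] n) := rfl

theorem indMap_leftOp (v : V) :
    indMap N h ∘ₗ leftOp N Q₃ v = (leftOp N Q₁ v + rightOp N Q₁ v) ∘ₗ indMap N h := by
  refine TensorProduct.ext' fun a n => ?_
  rw [LinearMap.comp_apply, leftOp_tmul, indMap_tmul, map_mul, ← tensor_reg_act N h]
  rfl

theorem indMap_indOp (v : V) : indMap N h ∘ₗ indOp Q₃ N v = rightOp N Q₁ v ∘ₗ indMap N h := by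
  refine TensorProduct.ext' fun a n => ?_
  simp only [LinearMap.comp_apply]
  induction a using CliffordAlgebra.left_induction with
  | algebraMap r =>
    rw [indOp_tmul, contractLeft_algebraMap, TensorProduct.zero_tmul, zero_add, AlgHom.commutes,
      indMap_tmul, indMap_tmul, AlgHom.commutes, Module.algebraMap_end_apply,
      Module.algebraMap_end_apply, map_smul, rightOp_tmul, map_one]
  | add x y hx hy => simp only [TensorProduct.add_tmul, map_add, hx, hy]
  | ι_mul x w hx =>
    have h1 : ∀ z, indMap N h (leftOp N Q₃ w z) =
        leftOp N Q₁ w (indMap N h z) + rightOp N Q₁ w (indMap N h z) :=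
      fun z => LinearMap.congr_fun (indMap_leftOp N h w) z
    have h2 := LinearMap.congr_fun (indOp_leftOp Q₃ N v w) (x ⊗ₜ n)
    have h3 := LinearMap.congr_fun (rightOp_leftOp N Q₁ v w) (indMap N h (x ⊗ₜ n))
    have h4 := LinearMap.congr_fun (rightOp_rightOp N Q₁ v w) (indMap N h (x ⊗ₜ n))
    simp only [Module.End.mul_apply, LinearMap.sub_apply, LinearMap.smul_apply,
      Module.End.one_apply, LinearMap.neg_apply] at h2 h3 h4
    rw [← leftOp_tmul, h2, map_sub, map_smul, h1, h1, hx, map_add, h3, h4]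
    abel

/-- The action of `C(V, Q₁)` on `C(V, Q₃) ⊗ N` which corresponds to left multiplication under
`indMap`. -/
def indAct : CliffordAlgebra Q₁ →ₐ[R] Module.End R (CliffordAlgebra Q₃ ⊗[R] N.carrier) :=
  CliffordAlgebra.lift Q₁
    ⟨{ toFun := fun v => leftOp N Q₃ v - indOp Q₃ N v
       map_add' := fun v w => by
        refine TensorProduct.ext' fun a n => ?_
        simp only [leftOp_tmul, indOp_add, LinearMap.add_apply, LinearMap.sub_apply, map_add,
          TensorProduct.add_tmul, add_mul]
        abel
       map_smul' := fun r v => by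
        refine TensorProduct.ext' fun a n => ?_
        simp only [leftOp_tmul, indOp_tmul, LinearMap.smul_apply, LinearMap.sub_apply, map_smul,
          TensorProduct.tmul_smul, TensorProduct.smul_tmul', RingHom.id_apply, smul_mul_assoc,
          smul_add, smul_sub] }, fun v => by
      change (leftOp N Q₃ v - indOp Q₃ N v) * (leftOp N Q₃ v - indOp Q₃ N v) = _
      have h1 : leftOp N Q₃ v * leftOp N Q₃ v = Q₃ v • 1 := by
        refine TensorProduct.ext' fun a n => ?_
        simp only [Module.End.mul_apply, leftOp_tmul, ← mul_assoc, ι_sq_scalar]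
        rw [← Algebra.smul_def]
        rfl
      have h2 := indOp_leftOp Q₃ N v v
      rw [QuadraticMap.polar_self] at h2
      refine LinearMap.ext fun z => ?_
      have e1 := LinearMap.congr_fun h1 z
      have e2 := LinearMap.congr_fun h2 z
      have e3 := LinearMap.congr_fun (indOp_sq Q₃ N v) z
      simp only [Module.End.mul_apply, LinearMap.sub_apply, LinearMap.smul_apply,
        Module.End.one_apply] at e1 e2 e3
      simp only [Module.End.mul_apply, LinearMap.sub_apply, map_sub,
        Module.algebraMap_end_apply, e1, e2, e3, h]
      module⟩

theorem indAct_ι (v : V) : indAct N h (ι Q₁ v) = leftOp N Q₃ v - indOp Q₃ N v :=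
  CliffordAlgebra.lift_ι_apply _ _ _

/-- The inverse of `indMap`. -/
def indInv : CliffordAlgebra Q₁ ⊗[R] N.carrier →ₗ[R] CliffordAlgebra Q₃ ⊗[R] N.carrier :=
  TensorProduct.lift (LinearMap.mk₂ R
    (fun a n => indAct N h a ((1 : CliffordAlgebra Q₃) ⊗ₜ[R] n))
    (fun a b n => by rw [map_add]; rfl) (fun r a n => by rw [map_smul]; rfl)
    (fun a m n => by rw [TensorProduct.tmul_add, map_add])
    (fun r a n => by rw [TensorProduct.tmul_smul, map_smul]))

theorem indInv_tmul (a : CliffordAlgebra Q₁) (n : N.carrier) :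
    indInv N h (a ⊗ₜ n) = indAct N h a ((1 : CliffordAlgebra Q₃) ⊗ₜ[R] n) := rfl

theorem indInv_leftOp (v : V) (z) : indInv N h (leftOp N Q₁ v z) =
    leftOp N Q₃ v (indInv N h z) - indOp Q₃ N v (indInv N h z) := by
  induction z using TensorProduct.induction_on with
  | zero => simp only [map_zero, sub_zero]
  | add x y hx hy => simp only [map_add, hx, hy]; abel
  | tmul a n => rw [leftOp_tmul, indInv_tmul, map_mul, indAct_ι]; rfl

theorem indInv_rightOp (v : V) (z) :
    indInv N h (rightOp N Q₁ v z) = indOp Q₃ N v (indInv N h z) := by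
  induction z using TensorProduct.induction_on with
  | zero => simp only [map_zero]
  | add x y hx hy => simp only [map_add, hx, hy]
  | tmul a n =>
    induction a using CliffordAlgebra.left_induction with
    | algebraMap r =>
      rw [rightOp_tmul, AlgHom.commutes, indInv_tmul, indInv_tmul, AlgHom.commutes,
        Module.algebraMap_end_apply, Module.algebraMap_end_apply, map_smul, indOp_tmul,
        contractLeft_one, map_one, TensorProduct.zero_tmul, zero_add]
    | add x y hx hy => simp only [TensorProduct.add_tmul, map_add, hx, hy]
    | ι_mul x w hx =>
      have h2 := LinearMap.congr_fun (indOp_leftOp Q₃ N v w) (indInv N h (x ⊗ₜ n))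
      have h3 := LinearMap.congr_fun (rightOp_leftOp N Q₁ v w) (x ⊗ₜ n)
      have h4 := LinearMap.congr_fun (indOp_indOp Q₃ N v w) (indInv N h (x ⊗ₜ n))
      simp only [Module.End.mul_apply, LinearMap.sub_apply, LinearMap.smul_apply,
        Module.End.one_apply, LinearMap.neg_apply] at h2 h3 h4
      rw [← leftOp_tmul, h3, map_neg, indInv_leftOp, indInv_leftOp, hx, map_sub, h2, h4]
      abel

theorem indMap_indInv (z) : indMap N h (indInv N h z) = z := by
  induction z using TensorProduct.induction_on with
  | zero => simp only [map_zero]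
  | add x y hx hy => simp only [map_add, hx, hy]
  | tmul a n =>
    induction a using CliffordAlgebra.left_induction with
    | algebraMap r =>
      rw [indInv_tmul, AlgHom.commutes, Module.algebraMap_end_apply, map_smul, indMap_tmul,
        map_one, Module.End.one_apply, TensorProduct.smul_tmul', Algebra.algebraMap_eq_smul_one]
    | add x y hx hy => simp only [TensorProduct.add_tmul, map_add, hx, hy]
    | ι_mul x w hx =>
      have h1 : ∀ z, indMap N h (leftOp N Q₃ w z) =
          leftOp N Q₁ w (indMap N h z) + rightOp N Q₁ w (indMap N h z) :=
        fun z => LinearMap.congr_fun (indMap_leftOp N h w) z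
      have h2 : ∀ z, indMap N h (indOp Q₃ N w z) = rightOp N Q₁ w (indMap N h z) :=
        fun z => LinearMap.congr_fun (indMap_indOp N h w) z
      rw [← leftOp_tmul, indInv_leftOp, map_sub, h1, h2, hx, add_sub_cancel_right]

theorem retr_reg_tensor (hN : HasCoords R N.carrier) :
    Retr (tensor h (reg Q₁) N) (reg Q₃) := by
  obtain ⟨κ, _, i, p, hip⟩ := hN
  refine ⟨κ, inferInstance,
    fun j => ⟨(TensorProduct.rid R (CliffordAlgebra Q₃)).toLinearMap ∘ₗ
      TensorProduct.map LinearMap.id (i j) ∘ₗ indInv N h, fun v x => ?_⟩,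
    fun j => ⟨indMap N h ∘ₗ (TensorProduct.mk R (CliffordAlgebra Q₃) N.carrier).flip (p j),
      fun v x => ?_⟩, fun x => ?_⟩
  · have h1 : indInv N h ((tensor h (reg Q₁) N).act (ι Q₃ v) x) =
        leftOp N Q₃ v (indInv N h x) := by
      rw [tensor_reg_act, LinearMap.add_apply, map_add, indInv_leftOp, indInv_rightOp,
        sub_add_cancel]
    simp only [LinearMap.comp_apply, h1]
    generalize indInv N h x = y
    induction y using TensorProduct.induction_on with
    | zero => simp only [map_zero]
    | add x y hx hy => simp only [map_add, hx, hy]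
    | tmul a n =>
      rw [leftOp_tmul]
      simp
  · exact (LinearMap.congr_fun (indMap_leftOp N h v) (x ⊗ₜ p j)).trans
      (by rw [tensor_reg_act]; rfl)
  · have h1 : ∀ y : CliffordAlgebra Q₃ ⊗[R] N.carrier,
        ∑ j, (TensorProduct.rid R (CliffordAlgebra Q₃)
          (TensorProduct.map LinearMap.id (i j) y)) ⊗ₜ p j = y := by
      intro y
      induction y using TensorProduct.induction_on with
      | zero => simp only [map_zero, TensorProduct.zero_tmul, Finset.sum_const_zero]
      | add x y hx hy =>
        simp only [map_add, TensorProduct.add_tmul, Finset.sum_add_distrib] at *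
        rw [hx, hy]
      | tmul a n =>
        conv_rhs => rw [← hip n, TensorProduct.tmul_sum]
        refine Finset.sum_congr rfl fun j _ => ?_
        simp [TensorProduct.smul_tmul]
    conv_rhs => rw [← indMap_indInv N h x, ← h1 (indInv N h x), map_sum]
    rfl

end Induced

section FGP

variable [Invertible (2 : R)] [Module.Finite R V] [Module.Projective R V]

theorem IsFGP.hasCoords {M : CliffMod Q} (hM : M.IsFGP) : HasCoords R M.carrier := by
  rw [isFGP_iff] at hM
  obtain ⟨κ, _, i, p, h⟩ := hM
  obtain ⟨κ', _, i', p', h'⟩ := finite_retract_cliffordAlgebra Q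
  refine ⟨κ × κ', inferInstance, fun j => i' j.2 ∘ₗ (i j.1).1, fun j => (p j.1).1 (p' j.2),
    fun x => ?_⟩
  rw [Fintype.sum_prod_type]
  conv_rhs => rw [← h x]
  refine Finset.sum_congr rfl fun j _ => ?_
  have h1 := congrArg (p j).1 (h' ((i j).1 x))
  rw [map_sum] at h1
  simp only [map_smul] at h1
  exact h1

/-- The tensor product of finitely generated projective modules is finitely generated projective
along the diagonal, for arbitrary quadratic forms. -/
theorem IsFGP.tensor' (h : ∀ v, Q₃ v = Q₁ v + Q₂ v) {M : CliffMod Q₁} {N : CliffMod Q₂}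
    (hM : M.IsFGP) (hN : N.IsFGP) : (CliffMod.tensor h M N).IsFGP := by
  have hc := hN.hasCoords
  rw [isFGP_iff] at hM ⊢
  have h' : ∀ v, Q₃ v = Q₂ v + Q₁ v := fun v => by rw [h, add_comm]
  exact (Retr.swap h h' M N).trans ((Retr.tensor_right h' N hM).trans
    ((Retr.swap h' h N (reg Q₁)).trans (retr_reg_tensor N h hc)))

end FGP

/-! ### Tensor powers as iterated tensor products -/

section Concat

theorem mulEquiv_tprod {M : Type u} [AddCommGroup M] [Module R M] {a b : ℕ} (x : Fin a → M)
    (y : Fin b → M) :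
    TensorPower.mulEquiv (PiTensorProduct.tprod R x ⊗ₜ[R] PiTensorProduct.tprod R y) =
      PiTensorProduct.tprod R (Fin.append x y) := by
  have := TensorPower.tprod_mul_tprod R x y
  rwa [TensorPower.gMul_def] at this

end Concat

section Concat

variable (M : CliffMod Q) {a b : ℕ}

/-- The permutation of `Fin (a + b)` acting by `σ` on the first `a` and by `τ` on the last `b`
places. -/
def concat (σ : Equiv.Perm (Fin a)) (τ : Equiv.Perm (Fin b)) : Equiv.Perm (Fin (a + b)) :=
  finSumFinEquiv.permCongr (Equiv.Perm.sumCongr σ τ)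

@[simp]
theorem concat_castAdd (σ : Equiv.Perm (Fin a)) (τ : Equiv.Perm (Fin b)) (i : Fin a) :
    concat σ τ (Fin.castAdd b i) = Fin.castAdd b (σ i) := by
  simp [concat, Equiv.permCongr_apply]

@[simp]
theorem concat_natAdd (σ : Equiv.Perm (Fin a)) (τ : Equiv.Perm (Fin b)) (i : Fin b) :
    concat σ τ (Fin.natAdd a i) = Fin.natAdd a (τ i) := by
  simp [concat, Equiv.permCongr_apply]

theorem concat_symm (σ : Equiv.Perm (Fin a)) (τ : Equiv.Perm (Fin b)) :
    (concat σ τ).symm = concat σ.symm τ.symm := by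
  refine Equiv.ext fun i => ?_
  rw [Equiv.symm_apply_eq]
  refine Fin.addCases (fun i => ?_) (fun i => ?_) i <;> simp

theorem sign_concat (σ : Equiv.Perm (Fin a)) (τ : Equiv.Perm (Fin b)) :
    Equiv.Perm.sign (concat σ τ) = Equiv.Perm.sign σ * Equiv.Perm.sign τ := by
  rw [concat, Equiv.Perm.sign_permCongr, Equiv.Perm.sign_sumCongr]

theorem append_slot (i : Fin a) (f : Module.End R M.carrier) (x : Fin a → M.carrier)
    (y : Fin b → M.carrier) :
    (fun j => M.slot (Fin.castAdd b i) f j (Fin.append x y j)) =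
      Fin.append (fun j => M.slot i f j (x j)) y := by
  funext j
  refine Fin.addCases (fun j => ?_) (fun j => ?_) j
  · have h1 : Fin.castAdd b j < Fin.castAdd b i ↔ j < i := Iff.rfl
    simp [slot, Fin.append_left, h1]
  · have h1 : ¬ Fin.natAdd a j < Fin.castAdd b i := by
      simp only [Fin.lt_def, Fin.val_natAdd, Fin.val_castAdd]; omega
    have h2 : Fin.natAdd a j ≠ Fin.castAdd b i := by
      simp only [ne_eq, Fin.ext_iff, Fin.val_natAdd, Fin.val_castAdd]; omega
    simp [slot, Fin.append_right, h1, h2]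

theorem append_slot' (i : Fin b) (f : Module.End R M.carrier) (x : Fin a → M.carrier)
    (y : Fin b → M.carrier) :
    (fun j => M.slot (Fin.natAdd a i) f j (Fin.append x y j)) =
      Fin.append (fun j => M.gr (x j)) (fun j => M.slot i f j (y j)) := by
  funext j
  refine Fin.addCases (fun j => ?_) (fun j => ?_) j
  · have h1 : Fin.castAdd b j < Fin.natAdd a i := by
      simp only [Fin.lt_def, Fin.val_natAdd, Fin.val_castAdd]; omega
    simp [slot, Fin.append_left, h1]
  · have h1 : Fin.natAdd a j < Fin.natAdd a i ↔ j < i := by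
      simp only [Fin.lt_def, Fin.val_natAdd]; omega
    simp [slot, Fin.append_right, h1]

/-- Linear maps on the product of two tensor powers are equal as soon as they agree on the products
of pure tensors. -/
theorem tprod_tmul_tprod_ext {X Y P : Type*} [AddCommGroup X] [Module R X] [AddCommGroup Y]
    [Module R Y] [AddCommGroup P] [Module R P]
    {f g : (⨂[R] _ : Fin a, X) ⊗[R] (⨂[R] _ : Fin b, Y) →ₗ[R] P}
    (h : ∀ (x : Fin a → X) (y : Fin b → Y),
      f (PiTensorProduct.tprod R x ⊗ₜ PiTensorProduct.tprod R y) =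
        g (PiTensorProduct.tprod R x ⊗ₜ PiTensorProduct.tprod R y)) : f = g :=
  TensorProduct.ext (PiTensorProduct.ext (MultilinearMap.ext fun x =>
    PiTensorProduct.ext (MultilinearMap.ext fun y => h x y)))

theorem tprod_tmul_tprod_hom_ext [Invertible (2 : R)] (M : CliffMod Q₁) (N : CliffMod Q₂)
    {P : Type*} [AddCommGroup P] [Module R P]
    {f g : (⨂[R] _ : Fin a, M.carrier) ⊗[R] (⨂[R] _ : Fin b, N.carrier) →ₗ[R] P}
    (h : ∀ (s : Fin a → Bool) (x : Fin a → M.carrier) (t : Fin b → Bool) (y : Fin b → N.carrier),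
      (∀ i, M.IsHom (s i) (x i)) → (∀ i, N.IsHom (t i) (y i)) →
      f (PiTensorProduct.tprod R x ⊗ₜ PiTensorProduct.tprod R y) =
        g (PiTensorProduct.tprod R x ⊗ₜ PiTensorProduct.tprod R y)) : f = g :=
  TensorProduct.ext (tprod_hom_ext M fun s x hx => tprod_hom_ext N fun t y hy => h s x t y hx hy)

/-- Concatenation of tensors is an isomorphism of graded modules. -/
theorem isMor_mulEquiv {Qa Qb Qc : QuadraticForm R V} (ha : ∀ v, Qa v = a • Q v)
    (hb : ∀ v, Qb v = b • Q v) (hc : ∀ v, Qc v = (a + b) • Q v) (hab : ∀ v, Qc v = Qa v + Qb v) :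
    IsMor (tensor hab (M.power a ha) (M.power b hb)) (M.power (a + b) hc)
      (TensorPower.mulEquiv (R := R) (M := M.carrier) (n := a) (m := b)).toLinearMap := by
  constructor
  · intro v z
    refine LinearMap.congr_fun (f := TensorPower.mulEquiv.toLinearMap ∘ₗ
      (tensor hab (M.power a ha) (M.power b hb)).act (ι Qc v))
      (g := (M.power (a + b) hc).act (ι Qc v) ∘ₗ TensorPower.mulEquiv.toLinearMap) ?_ z
    refine tprod_tmul_tprod_ext fun x y => ?_
    simp only [LinearMap.comp_apply, LinearEquiv.coe_coe]
    refine (congrArg TensorPower.mulEquiv (tensor_act_ι hab (M.power a ha) (M.power b hb) v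
      (PiTensorProduct.tprod R x) (PiTensorProduct.tprod R y))).trans ?_
    rw [power_act_ι, power_act_ι, power_act_ι, mulEquiv_tprod, LinearMap.sum_apply,
      LinearMap.sum_apply, LinearMap.sum_apply, Fin.sum_univ_add, TensorProduct.sum_tmul,
      TensorProduct.tmul_sum, map_add, map_sum, map_sum]
    congr 1
    · refine Finset.sum_congr rfl fun i _ => ?_
      rw [slotMap_apply, slotMap_apply, PiTensorProduct.map_tprod, PiTensorProduct.map_tprod,
        mulEquiv_tprod, append_slot]
    · refine Finset.sum_congr rfl fun i _ => ?_
      rw [slotMap_apply, slotMap_apply, PiTensorProduct.map_tprod, PiTensorProduct.map_tprod,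
        PiTensorProduct.map_tprod, mulEquiv_tprod, append_slot']
  · intro z
    refine LinearMap.congr_fun (f := TensorPower.mulEquiv.toLinearMap ∘ₗ
      (tensor hab (M.power a ha) (M.power b hb)).gr)
      (g := (M.power (a + b) hc).gr ∘ₗ TensorPower.mulEquiv.toLinearMap) ?_ z
    refine tprod_tmul_tprod_ext fun x y => ?_
    simp only [LinearMap.comp_apply, LinearEquiv.coe_coe, TensorProduct.map_tmul, mulEquiv_tprod,
      PiTensorProduct.map_tprod]
    congr 1
    funext j
    refine Fin.addCases (fun j => ?_) (fun j => ?_) j <;>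
      simp [Fin.append_left, Fin.append_right]

theorem koszulSign_concat (σ : Equiv.Perm (Fin a)) (τ : Equiv.Perm (Fin b)) (s : Fin a → Bool)
    (t : Fin b → Bool) :
    koszulSign (concat σ τ) (Fin.append s t) = koszulSign σ s * koszulSign τ t := by
  have h1 : ∀ (i : Fin a) (j : Fin b), ¬ Fin.natAdd a j < Fin.castAdd b i := fun i j => by
    simp only [Fin.lt_def, Fin.val_natAdd, Fin.val_castAdd]; omega
  have h2 : ∀ i j : Fin a, Fin.castAdd b i < Fin.castAdd b j ↔ i < j := fun _ _ => Iff.rfl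
  have h3 : ∀ i j : Fin b, Fin.natAdd a i < Fin.natAdd a j ↔ i < j := fun _ _ => by
    simp only [Fin.lt_def, Fin.val_natAdd]; omega
  unfold koszulSign
  simp [Fin.prod_univ_add, Fin.append_left, Fin.append_right, h1, h2, h3]

/-- The permutation by the sign rule of two blocks of tensors is the product of the permutations of
the blocks: no two factors of different blocks are interchanged. -/
theorem perm_concat [Invertible (2 : R)] (σ : Equiv.Perm (Fin a)) (τ : Equiv.Perm (Fin b))
    (z : (⨂[R]^a M.carrier) ⊗[R] (⨂[R]^b M.carrier)) :
    M.perm (concat σ τ) (TensorPower.mulEquiv z) =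
      TensorPower.mulEquiv (TensorProduct.map (M.perm σ) (M.perm τ) z) := by
  refine LinearMap.congr_fun (f := M.perm (concat σ τ) ∘ₗ TensorPower.mulEquiv.toLinearMap)
    (g := TensorPower.mulEquiv.toLinearMap ∘ₗ TensorProduct.map (M.perm σ) (M.perm τ)) ?_ z
  refine tprod_tmul_tprod_hom_ext M M fun s x t y hx hy => ?_
  simp only [LinearMap.comp_apply,
    LinearEquiv.coe_coe, TensorProduct.map_tmul, mulEquiv_tprod]
  rw [perm_tprod M σ hx, perm_tprod M τ hy, perm_tprod M (s := Fin.append s t),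
    koszulSign_concat, concat_symm, TensorProduct.smul_tmul_smul, map_smul, mulEquiv_tprod]
  · push_cast
    congr 2
    funext j
    refine Fin.addCases (fun j => ?_) (fun j => ?_) j <;>
      simp [Fin.append_left, Fin.append_right]
  · intro i
    refine Fin.addCases (fun j => ?_) (fun j => ?_) i
    · simpa [Fin.append_left] using hx j
    · simpa [Fin.append_right] using hy j

end Concat

/-! ### Functoriality -/

section Functoriality

theorem IsMor.isHom {M N : CliffMod Q} {f : M.carrier →ₗ[R] N.carrier} (hf : IsMor M N f)
    {b : Bool} {x : M.carrier} (hx : M.IsHom b x) : N.IsHom b (f x) := by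
  unfold IsHom at *
  rw [← hf.2, hx, map_smul]

/-- The tensor product of a family of morphisms. -/
theorem IsMor.power {M N : CliffMod Q} {n : ℕ} (h : ∀ v, Q' v = n • Q v)
    {f : Fin n → M.carrier →ₗ[R] N.carrier} (hf : ∀ i, IsMor M N (f i)) :
    IsMor (M.power n h) (N.power n h) (PiTensorProduct.map f) := by
  constructor
  · intro v x
    rw [power_act_ι, power_act_ι, LinearMap.sum_apply, LinearMap.sum_apply, map_sum]
    refine Finset.sum_congr rfl fun i _ => ?_
    rw [slotMap_apply, slotMap_apply, ← LinearMap.comp_apply, ← LinearMap.comp_apply,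
      ← PiTensorProduct.map_comp, ← PiTensorProduct.map_comp]
    congr 2
    funext j
    refine LinearMap.ext fun x => ?_
    unfold slot
    simp only [LinearMap.comp_apply]
    split_ifs with h1 h2
    · exact (hf j).2 x
    · exact (hf j).1 v x
    · rfl
  · intro x
    change (PiTensorProduct.map f ∘ₗ PiTensorProduct.map fun _ => M.gr) x =
      ((PiTensorProduct.map fun _ => N.gr) ∘ₗ PiTensorProduct.map f) x
    rw [← PiTensorProduct.map_comp, ← PiTensorProduct.map_comp]
    congr 2
    funext j
    exact LinearMap.ext (hf j).2

theorem perm_map [Invertible (2 : R)] {M N : CliffMod Q} {n : ℕ} (σ : Equiv.Perm (Fin n))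
    {f : Fin n → M.carrier →ₗ[R] N.carrier} (hf : ∀ i, IsMor M N (f i))
    (x : ⨂[R] _ : Fin n, M.carrier) :
    N.perm σ (PiTensorProduct.map f x) =
      PiTensorProduct.map (fun i => f (σ.symm i)) (M.perm σ x) := by
  refine LinearMap.congr_fun (f := N.perm σ ∘ₗ PiTensorProduct.map f)
    (g := (PiTensorProduct.map fun i => f (σ.symm i)) ∘ₗ M.perm σ) ?_ x
  refine tprod_hom_ext M fun s x hx => ?_
  rw [LinearMap.comp_apply, LinearMap.comp_apply, PiTensorProduct.map_tprod,
    perm_tprod N σ fun i => (hf i).isHom (hx i), perm_tprod M σ hx, map_smul,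
    PiTensorProduct.map_tprod]

theorem IsMor.tensor (h : ∀ v, Q₃ v = Q₁ v + Q₂ v) {M M' : CliffMod Q₁} {N N' : CliffMod Q₂}
    {f : M.carrier →ₗ[R] M'.carrier} {g : N.carrier →ₗ[R] N'.carrier} (hf : IsMor M M' f)
    (hg : IsMor N N' g) :
    IsMor (CliffMod.tensor h M N) (CliffMod.tensor h M' N') (TensorProduct.map f g) := by
  constructor
  · intro v x
    induction x using TensorProduct.induction_on with
    | zero => simp only [map_zero]
    | add x y hx hy => simp only [map_add, hx, hy]
    | tmul x y =>
      rw [tensor_act_ι, map_add, TensorProduct.map_tmul, TensorProduct.map_tmul,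
        TensorProduct.map_tmul, tensor_act_ι, hf.1, hf.2, hg.1]
  · intro x
    induction x using TensorProduct.induction_on with
    | zero => simp only [map_zero]
    | add x y hx hy => simp only [map_add, hx, hy]
    | tmul x y => simp [hf.2, hg.2]

theorem isMor_perm [Invertible (2 : R)] (M : CliffMod Q) {n : ℕ} (h : ∀ v, Q' v = n • Q v)
    (σ : Equiv.Perm (Fin n)) : IsMor (M.power n h) (M.power n h) (M.perm σ) :=
  ⟨fun v x => M.perm_act n h σ (ι Q' v) x, M.perm_gr n h σ⟩

end Functoriality

/-! ### Projectivity of tensor powers and classes of products -/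

section FGP

variable [Invertible (2 : R)] [Module.Finite R V] [Module.Projective R V]

theorem IsFGP.power {M : CliffMod Q} (hM : M.IsFGP) {n : ℕ} (hn : 0 < n)
    (h : ∀ v, Q' v = n • Q v) : (M.power n h).IsFGP := by
  obtain ⟨n, rfl⟩ : ∃ m, n = m + 1 := ⟨n - 1, by omega⟩
  have h1 : ∀ {Q' : QuadraticForm R V} (h : ∀ v, Q' v = 1 • Q v), (M.power 1 h).IsFGP := by
    intro Q' h
    obtain rfl : Q' = Q := by
      ext v
      simpa using h v
    let e := PiTensorProduct.subsingletonEquiv (R := R) (s := fun _ : Fin 1 => M.carrier) 0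
    have he : ∀ v x, e ((M.power 1 h).act (ι Q' v) x) = M.act (ι Q' v) (e x) := fun v x => by
      rw [power_act_ι, Fin.sum_univ_one]
      refine LinearMap.congr_fun (f := e.toLinearMap ∘ₗ M.slotMap (0 : Fin 1) v)
        (g := M.act (ι Q' v) ∘ₗ e.toLinearMap) ?_ x
      refine PiTensorProduct.ext (MultilinearMap.ext fun x => ?_)
      simp [e, slotMap_apply, PiTensorProduct.map_tprod, slot]
    refine IsFGP.of_retr (Retr.of_leftInverse ⟨e.toLinearMap, he⟩ ⟨e.symm.toLinearMap,
      fun v x => e.injective ?_⟩ e.symm_apply_apply) hM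
    refine (e.apply_symm_apply _).trans (Eq.trans ?_ (he v _).symm)
    exact congrArg (M.act (ι Q' v)) (e.apply_symm_apply x).symm
  induction n generalizing Q' with
  | zero => exact h1 h
  | succ n ih =>
    have hab : ∀ v, Q' v = ((n + 1) • Q) v + (1 • Q) v := fun v => by
      rw [h]; simp [add_smul]
    refine IsFGP.of_retr (Retr.of_leftInverse
      ⟨(TensorPower.mulEquiv (R := R) (M := M.carrier) (n := n + 1) (m := 1)).symm.toLinearMap,
        fun v x => ?_⟩
      ⟨(TensorPower.mulEquiv (R := R) (M := M.carrier) (n := n + 1) (m := 1)).toLinearMap,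
        (isMor_mulEquiv M (fun _ => rfl) (fun _ => rfl) h hab).1⟩ fun x => ?_)
      (IsFGP.tensor' hab (ih (by omega) fun _ => rfl) (h1 (Q' := 1 • Q) fun _ => rfl))
    · refine (TensorPower.mulEquiv (R := R) (M := M.carrier) (n := n + 1) (m := 1)).injective ?_
      refine (LinearEquiv.apply_symm_apply _ _).trans ?_
      refine Eq.trans ?_ ((isMor_mulEquiv M (fun _ => rfl) (fun _ => rfl) h hab).1 v _).symm
      exact congrArg ((M.power (n + 1 + 1) h).act (ι Q' v)) (LinearEquiv.apply_symm_apply _ _).symm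
    · exact LinearEquiv.apply_symm_apply _ _

/-- If `p` and `q` are idempotent morphisms with images `N` and `N'`, then `N ⊗ N'` is carried by the
image of `p ⊗ q`. -/
theorem tensor_subCls (h : ∀ v, Q₃ v = Q₁ v + Q₂ v) {M : CliffMod Q₁} {M' : CliffMod Q₂}
    {N : Submodule R M.carrier} {N' : Submodule R M'.carrier} (hN : M.SubFGP N)
    (hN' : M'.SubFGP N') (p : Module.End R M.carrier) (q : Module.End R M'.carrier)
    (hp : IsMor M M p) (hq : IsMor M' M' q) (hpN : ∀ x, p x ∈ N) (hqN : ∀ x, q x ∈ N')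
    (hpp : ∀ x ∈ N, p x = x) (hqq : ∀ x ∈ N', q x = x) :
    (tensor h M M').SubFGP (Module.End.eigenspace (TensorProduct.map p q) 1) ∧
    (tensor h (M.ofStable N hN.1) (M'.ofStable N' hN'.1)).cls =
      (tensor h M M').subCls (Module.End.eigenspace (TensorProduct.map p q) 1) := by
  have hF : (tensor h (M.ofStable N hN.1) (M'.ofStable N' hN'.1)).IsFGP :=
    IsFGP.tensor' h hN.2 hN'.2
  have hS : (tensor h M M').Stable (Module.End.eigenspace (TensorProduct.map p q) 1) :=
    Stable.eigenspace (IsMor.tensor h hp hq) 1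
  have ha : IsMor (tensor h (M.ofStable N hN.1) (M'.ofStable N' hN'.1)) (tensor h M M')
      (TensorProduct.map N.subtype N'.subtype) :=
    IsMor.tensor h ⟨fun _ _ => rfl, fun _ => rfl⟩ ⟨fun _ _ => rfl, fun _ => rfl⟩
  let b := TensorProduct.map (p.codRestrict N hpN) (q.codRestrict N' hqN)
  have hl : ∀ x, b (TensorProduct.map N.subtype N'.subtype x) = x := fun x => by
    refine LinearMap.congr_fun (f := b ∘ₗ TensorProduct.map N.subtype N'.subtype)
      (g := LinearMap.id) ?_ x
    refine TensorProduct.ext' fun x y => ?_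
    simp only [b, LinearMap.comp_apply, TensorProduct.map_tmul, LinearMap.id_apply]
    congr 1
    · exact Subtype.ext (hpp x x.2)
    · exact Subtype.ext (hqq y y.2)
  have hab : ∀ x, TensorProduct.map N.subtype N'.subtype (b x) = TensorProduct.map p q x := by
    intro x
    refine LinearMap.congr_fun (f := TensorProduct.map N.subtype N'.subtype ∘ₗ b) ?_ x
    exact TensorProduct.ext' fun x y => rfl
  have hm : ∀ x, TensorProduct.map N.subtype N'.subtype x ∈
      Module.End.eigenspace (TensorProduct.map p q) (1 : R) := fun x => by
    rw [Module.End.mem_eigenspace_iff, one_smul, ← hab, hl]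
  have hr : ∀ y ∈ Module.End.eigenspace (TensorProduct.map p q) (1 : R),
      TensorProduct.map N.subtype N'.subtype (b y) = y := fun y hy => by
    rw [hab, Module.End.mem_eigenspace_iff.1 hy, one_smul]
  refine ⟨SubFGP.congr (subFGP_top hF) hS _ ha b (fun x _ => hm x) (fun _ _ => trivial)
    (fun x _ => hl x) hr, ?_⟩
  rw [← subCls_top]
  exact subCls_congr Stable.top hS _ ha b (fun x _ => hm x) (fun _ _ => trivial)
    (fun x _ => hl x) hr

/-- The cup-product of the classes of the images of two idempotents. -/
theorem cup_subCls (Q : QuadraticForm R V) {a b c : ℕ} (h : a + b = c) (hc : IsUnit (c : R))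
    {M : CliffMod (a • Q)} {M' : CliffMod (b • Q)}
    {N : Submodule R M.carrier} {N' : Submodule R M'.carrier} (hN : M.SubFGP N)
    (hN' : M'.SubFGP N') (p : Module.End R M.carrier) (q : Module.End R M'.carrier)
    (hp : IsMor M M p) (hq : IsMor M' M' q) (hpN : ∀ x, p x ∈ N) (hqN : ∀ x, q x ∈ N')
    (hpp : ∀ x ∈ N, p x = x) (hqq : ∀ x ∈ N', q x = x) :
    cup Q h hc (M.subCls N) (M'.subCls N') =
      (tensor (add_nsmul_apply Q h) M M').subCls
        (Module.End.eigenspace (TensorProduct.map p q) 1) := by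
  rw [subCls_eq hN.1, subCls_eq hN'.1, cup_cls Q h hc _ _ hN.2 hN'.2]
  exact (tensor_subCls _ hN hN' p q hp hq hpN hqN hpp hqq).2

end FGP

/-! ### The cyclic permutation and the class `Ψ̄ᵏ(E)` -/

section Cyclic

variable {k : ℕ} {ζ : R}

theorem orderOf_finRotate (n : ℕ) : orderOf (finRotate (n + 2)) = n + 2 := by
  rw [isCycle_finRotate.orderOf, support_finRotate, Finset.card_univ, Fintype.card_fin]

theorem finRotate_pow_self (k : ℕ) : finRotate k ^ k = 1 := by
  match k with
  | 0 => rfl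
  | 1 => exact Subsingleton.elim _ _
  | n + 2 => rw [← orderOf_dvd_iff_pow_eq_one, orderOf_finRotate]

theorem IsCycRoot.pow_finRotate (hζ : IsCycRoot k ζ) (i : Fin k) :
    ζ ^ (finRotate k i : ℕ) = ζ ^ (i : ℕ) * ζ := by
  cases k with
  | zero => exact i.elim0
  | succ n =>
    rw [finRotate_apply, ← pow_succ, ← hζ.pow_mod (i + 1)]
    congr 1
    rw [Fin.val_add]
    simp

/-- The product of the `ζ^i` over a subset of the cyclic group of indices. -/
def cycWeight (ζ : R) (s : Fin k → Bool) : R := ∏ i, if s i = true then ζ ^ (i : ℕ) else 1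

theorem cycWeight_finRotate (hζ : IsCycRoot k ζ) (s : Fin k → Bool) :
    cycWeight ζ s = ζ ^ (Finset.univ.filter fun i => s i = true).card *
      cycWeight ζ (fun i => s (finRotate k i)) := by
  have h1 : (Finset.univ.filter fun i => s i = true).card =
      (Finset.univ.filter fun i => s (finRotate k i) = true).card :=
    (Finset.card_equiv (finRotate k) fun i => by simp).symm
  rw [h1, ← Finset.prod_const, Finset.prod_filter, cycWeight, cycWeight,
    ← Finset.prod_mul_distrib, ← Equiv.prod_comp (finRotate k)]
  refine Finset.prod_congr rfl fun i _ => ?_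
  split_ifs
  · rw [hζ.pow_finRotate, mul_comm]
  · rw [one_mul]

theorem isUnit_cycWeight (hζ : IsCycRoot k ζ) (s : Fin k → Bool) : IsUnit (cycWeight ζ s) := by
  refine IsUnit.prod_univ_iff.2 fun i => ?_
  split_ifs
  · have hk : 0 < k := i.pos
    exact (IsUnit.of_mul_eq_one (ζ ^ (k - 1)) (by
      rw [← pow_succ', Nat.sub_add_cancel hk, hζ.pow_eq])).pow _
  · exact isUnit_one

theorem exists_conj_finRotate {k a : ℕ} (hk : 1 < k) (ha : Nat.Coprime a k) :
    ∃ μ : Equiv.Perm (Fin k), μ * finRotate k = finRotate k ^ a * μ := by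
  obtain ⟨n, rfl⟩ : ∃ n, k = n + 2 := ⟨k - 2, by omega⟩
  have ha' : Nat.Coprime a (orderOf (finRotate (n + 2))) := by rwa [orderOf_finRotate]
  have hc : Equiv.Perm.IsCycle (finRotate (n + 2) ^ a) :=
    Equiv.Perm.IsCycle.pow_iff isCycle_finRotate |>.2 ha'
  obtain ⟨μ, hμ⟩ := isConj_iff.1 ((isCycle_finRotate.isConj_iff hc).2
    (by rw [Equiv.Perm.support_pow_coprime ha']))
  exact ⟨μ, by rw [← hμ, inv_mul_cancel_right]⟩

variable [Invertible (2 : R)]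

theorem perm_finRotate_pow (E : CliffMod Q) (k : ℕ) : E.perm (finRotate k) ^ k = 1 := by
  rw [← perm_pow, finRotate_pow_self, perm_one]

theorem eigen_cls (E : CliffMod Q) (h : ∀ v, Q' v = k • Q v) (μ : R) :
    (E.eigen k h μ).cls =
      (E.power k h).subCls (⊤ ⊓ Module.End.eigenspace (E.perm (finRotate k)) μ) := by
  rw [top_inf_eq, subCls_eq (Stable.eigenspace (isMor_perm E h _) μ)]
  rfl

theorem psiBar_eq_chi (E : CliffMod Q) (k : ℕ) (h : ∀ v, Q' v = k • Q v) (ζ : R) :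
    E.psiBar k h ζ = chi k ζ (E.power k h) (E.perm (finRotate k)) ⊤ :=
  Finset.sum_congr rfl fun j _ => by rw [eigen_cls]

theorem eigen_isFGP [Module.Finite R V] [Module.Projective R V] (hk : 0 < k)
    (hu : IsUnit (k : R)) (hζ : IsCycRoot k ζ) {E : CliffMod Q}
    (hE : E.IsFGP) (h : ∀ v, Q' v = k • Q v) (j : ℕ) : (E.eigen k h (ζ ^ j)).IsFGP := by
  have h1 := (subFGP_top (hE.power hk h)).eigen hk hu hζ (isMor_perm E h (finRotate k))
    (fun _ _ => trivial) (fun x _ => by rw [perm_finRotate_pow]; rfl) j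
  rw [top_inf_eq] at h1
  exact h1.2

/-- The eigenmodules for the primitive powers of `ζ` are isomorphic. -/
theorem eigen_cls_eq_of_coprime (hk : 1 < k) (hζ : IsCycRoot k ζ) (E : CliffMod Q)
    (h : ∀ v, Q' v = k • Q v) {a : ℕ} (ha : Nat.Coprime a k) :
    (E.eigen k h (ζ ^ a)).cls = (E.eigen k h (ζ ^ 1)).cls := by
  obtain ⟨μ, hμ⟩ := exists_conj_finRotate hk ha
  obtain ⟨b, -, hb⟩ := Nat.exists_mul_mod_eq_one_of_coprime ha hk
  have hpow : ∀ (σ : Equiv.Perm (Fin k)) (c : R) (x : ⨂[R] _ : Fin k, E.carrier) (n : ℕ),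
      E.perm σ x = c • x → E.perm (σ ^ n) x = c ^ n • x := by
    intro σ c x n hx
    induction n with
    | zero => simp [perm_one_apply]
    | succ n ih => rw [pow_succ, ← perm_mul_apply, hx, map_smul, ih, smul_smul, pow_succ']
  have hσ : (finRotate k ^ a) ^ b = finRotate k := by
    rw [← pow_mul, ← Nat.mod_add_div (a * b) k, hb, pow_add, pow_mul, finRotate_pow_self, one_pow,
      pow_one, mul_one]
  have hz : (ζ ^ a) ^ b = ζ ^ 1 := by rw [← pow_mul, ← hζ.pow_mod (a * b), hb]
  rw [eigen_cls, eigen_cls, top_inf_eq, top_inf_eq]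
  have hS := fun c => Stable.eigenspace (isMor_perm E h (finRotate k)) c
  refine subCls_congr (hS _) (hS _) (E.perm μ) (isMor_perm E h μ) (E.perm μ⁻¹) ?_ ?_ ?_ ?_
  · intro x hx
    rw [Module.End.mem_eigenspace_iff] at *
    have h1 : E.perm (finRotate k ^ a) (E.perm μ x) = ζ ^ a • E.perm μ x := by
      rw [perm_mul_apply, ← hμ, ← perm_mul_apply, hx, map_smul]
    have h2 := hpow _ _ _ b h1
    rwa [hσ, hz] at h2
  · intro y hy
    rw [Module.End.mem_eigenspace_iff] at *
    have h1 := hpow _ _ _ a hy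
    have h2 : finRotate k * μ⁻¹ = μ⁻¹ * finRotate k ^ a := by
      rw [eq_inv_mul_iff_mul_eq, ← mul_assoc, hμ, mul_assoc, mul_inv_cancel, mul_one]
    rw [perm_mul_apply, h2, ← perm_mul_apply, h1, map_smul, pow_one]
  · intro x _
    rw [perm_mul_apply, inv_mul_cancel, perm_one_apply]
  · intro x _
    rw [perm_mul_apply, mul_inv_cancel, perm_one_apply]

end Cyclic

/-! ### Additivity for a prime `k` -/

/-- As `Ω_k` is a free `ℤ`-module with `1` in a basis, extension of scalars to `Ω_k` is
injective. -/
theorem tmul_one_injective (A : Type*) [AddCommGroup A] (k : ℕ) (hk : 0 < k) :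
    Function.Injective (fun x : A => x ⊗ₜ[ℤ] (1 : Omega k)) := by
  let pb := AdjoinRoot.powerBasis' (Polynomial.cyclotomic.monic k ℤ)
  have hd : 0 < pb.dim := by
    rw [AdjoinRoot.powerBasis'_dim, Polynomial.natDegree_cyclotomic]
    exact Nat.totient_pos.2 hk
  have h1 : pb.basis.coord ⟨0, hd⟩ 1 = 1 := by
    have h2 : pb.basis ⟨0, hd⟩ = 1 := by rw [pb.basis_eq_pow, pow_zero]
    rw [← h2, Module.Basis.coord_apply, Module.Basis.repr_self, Finsupp.single_eq_same]
  intro x y hxy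
  have h3 := congrArg (fun z => TensorProduct.rid ℤ A
    (TensorProduct.map LinearMap.id (pb.basis.coord ⟨0, hd⟩) z)) hxy
  simpa only [TensorProduct.map_tmul, h1, TensorProduct.rid_tmul, LinearMap.id_apply, one_smul]
    using h3

section Additivity

variable {k : ℕ} {ζ : R}

/-- `∑ c(s) (f_{s 1} ⊗ ⋯ ⊗ f_{s n})` for two endomorphisms `f false`, `f true`; this is applied
to the projections of a direct sum `E₀ ⊕ E₁`. -/
def boolSum {X : Type*} [AddCommGroup X] [Module R X] {n : ℕ} (f : Bool → Module.End R X)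
    (c : (Fin n → Bool) → R) : Module.End R (⨂[R] _ : Fin n, X) :=
  ∑ s : Fin n → Bool, c s • PiTensorProduct.map fun i => f (s i)

section BoolSum

variable {X : Type u} [AddCommGroup X] [Module R X] {n : ℕ} {f : Bool → Module.End R X}

theorem map_zero_slot {n : ℕ} (g : Fin n → Module.End R X) (i : Fin n) (h : g i = 0) :
    PiTensorProduct.map g = 0 :=
  (PiTensorProduct.mapMultilinear R (fun _ : Fin n => X) (fun _ => X)).map_coord_zero i h

theorem boolSum_mul (hf : ∀ b c, f b * f c = if b = c then f b else 0)
    (c d : (Fin n → Bool) → R) :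
    boolSum f c * boolSum f d = boolSum f fun s => c s * d s := by
  classical
  unfold boolSum
  rw [Finset.sum_mul]
  refine Finset.sum_congr rfl fun s _ => ?_
  rw [Finset.mul_sum, Finset.sum_eq_single s]
  · rw [smul_mul_smul_comm, ← PiTensorProduct.map_mul]
    congr 2
    funext i
    rw [hf, if_pos rfl]
  · intro t _ ht
    obtain ⟨i, hi⟩ := Function.ne_iff.1 ht
    rw [smul_mul_smul_comm, ← PiTensorProduct.map_mul, map_zero_slot _ i, smul_zero]
    rw [hf, if_neg hi.symm]
  · intro hs
    exact absurd (Finset.mem_univ s) hs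

theorem boolSum_one (hf : f false + f true = 1) :
    boolSum f (fun _ : Fin n → Bool => (1 : R)) = 1 := by
  have h := (PiTensorProduct.mapMultilinear R (fun _ : Fin n => X) (fun _ => X)).map_sum
    fun _ b => f b
  simp only [Fintype.sum_bool, add_comm, hf] at h
  unfold boolSum
  simp only [one_smul]
  refine h.symm.trans ?_
  exact PiTensorProduct.map_one

theorem boolSum_sum {κ : Type*} (t : Finset κ) (c : κ → (Fin n → Bool) → R) :
    boolSum f (fun s => ∑ m ∈ t, c m s) = ∑ m ∈ t, boolSum f (c m) := by
  simp only [boolSum, Finset.sum_smul]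
  exact Finset.sum_comm

theorem boolSum_smul (r : R) (c : (Fin n → Bool) → R) :
    boolSum f (fun s => r * c s) = r • boolSum f c := by
  simp [boolSum, mul_smul, Finset.smul_sum]

theorem boolSum_single (t : Fin n → Bool) :
    boolSum f (fun s => if s = t then (1 : R) else 0) = PiTensorProduct.map fun i => f (t i) := by
  simp [boolSum]

end BoolSum

theorem isMor_boolSum {E : CliffMod Q} {n : ℕ} (h : ∀ v, Q' v = n • Q v)
    {f : Bool → Module.End R E.carrier} (hf : ∀ b, IsMor E E (f b)) (c : (Fin n → Bool) → R) :
    IsMor (E.power n h) (E.power n h) (boolSum f c) :=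
  IsMor.sum _ fun s _ => (IsMor.power h fun i => hf (s i)).smul (c s)

/-- The sum of the tensor products of `n` factors `f false`, `f true` in which `f true` occurs `m`
times. -/
def countProj {X : Type*} [AddCommGroup X] [Module R X] (n : ℕ) (f : Bool → Module.End R X)
    (m : ℕ) : Module.End R (⨂[R] _ : Fin n, X) :=
  boolSum f fun s => if (Finset.univ.filter fun i => s i = true).card = m then 1 else 0

theorem countProj_mul {X : Type u} [AddCommGroup X] [Module R X] {n : ℕ}
    {f : Bool → Module.End R X} (hf : ∀ b c, f b * f c = if b = c then f b else 0) (i j : ℕ) :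
    countProj n f i * countProj n f j = if i = j then countProj n f i else 0 := by
  unfold countProj
  rw [boolSum_mul hf]
  split_ifs with hij
  · subst hij
    congr 1
    funext s
    split_ifs <;> simp
  · have : (fun s : Fin n → Bool =>
        (if (Finset.univ.filter fun i => s i = true).card = i then (1 : R) else 0) *
          if (Finset.univ.filter fun i => s i = true).card = j then 1 else 0) =
        fun s => 0 * 1 := by
      funext s
      split_ifs <;> simp_all
    rw [this, boolSum_smul, zero_smul]

theorem sum_countProj {X : Type u} [AddCommGroup X] [Module R X] {n : ℕ}
    {f : Bool → Module.End R X} (hf : f false + f true = 1) :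
    ∑ m ∈ Finset.range (n + 1), countProj n f m = 1 := by
  unfold countProj
  rw [← boolSum_sum, ← boolSum_one hf]
  congr 1
  funext s
  rw [Finset.sum_ite_eq, if_pos (Finset.mem_range.2 (Nat.lt_succ_of_le
    ((Finset.card_le_univ _).trans (Fintype.card_fin n).le)))]

theorem countProj_zero {X : Type u} [AddCommGroup X] [Module R X] {n : ℕ}
    (f : Bool → Module.End R X) :
    countProj n f 0 = PiTensorProduct.map fun _ => f false := by
  rw [← boolSum_single, countProj]
  congr 1
  funext s
  congr 1
  simp [Finset.filter_eq_empty_iff, funext_iff]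

theorem countProj_self {X : Type u} [AddCommGroup X] [Module R X] {n : ℕ}
    (f : Bool → Module.End R X) :
    countProj n f n = PiTensorProduct.map fun _ => f true := by
  rw [← boolSum_single, countProj]
  congr 1
  funext s
  congr 1
  have : (Finset.univ.filter fun i => s i = true).card = n ↔
      (Finset.univ.filter fun i => s i = true).card = Fintype.card (Fin n) := by
    rw [Fintype.card_fin]
  rw [this, Finset.card_eq_iff_eq_univ]
  simp [Finset.ext_iff, funext_iff]

variable [Invertible (2 : R)]

/-- For `k` prime, the preimage of `Ψ̄ᵏ(E)` in `K(C(V(k)))`: as `1 + ω + ⋯ + ω^(k-1) = 0`, it is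
the difference of the classes of the eigenmodules for `1` and for `ζ`. -/
theorem eigen_sub_tmul_one (hk : k.Prime) (hζ : IsCycRoot k ζ) (E : CliffMod Q)
    (h : ∀ v, Q' v = k • Q v) :
    ((E.eigen k h (ζ ^ 0)).cls - (E.eigen k h (ζ ^ 1)).cls) ⊗ₜ[ℤ] (1 : Omega k) =
      E.psiBar k h ζ := by
  have : NeZero k := ⟨hk.ne_zero⟩
  obtain ⟨n, rfl⟩ : ∃ n, k = n + 1 := ⟨k - 1, by have := hk.pos; omega⟩
  have hω := (isCycRoot_omegaRoot (n + 1)).sum_eq 1 (by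
    rw [Nat.dvd_one]; exact hk.ne_one)
  simp only [mul_one] at hω
  rw [Finset.sum_range_succ', pow_zero] at hω
  rw [psiBar, Finset.sum_range_succ', pow_zero (omegaRoot (n + 1)),
    TensorProduct.sub_tmul, sub_eq_neg_add]
  congr 1
  have h1 : ∀ j ∈ Finset.range n, (E.eigen (n + 1) h (ζ ^ (j + 1))).cls ⊗ₜ[ℤ]
      (omegaRoot (n + 1) ^ (j + 1)) =
      (E.eigen (n + 1) h (ζ ^ 1)).cls ⊗ₜ[ℤ] (omegaRoot (n + 1) ^ (j + 1)) := by
    intro j hj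
    rw [eigen_cls_eq_of_coprime hk.one_lt hζ]
    refine (Nat.coprime_comm.1 ((Nat.Prime.coprime_iff_not_dvd hk).2 fun hd => ?_))
    have := Nat.le_of_dvd (by omega) hd
    rw [Finset.mem_range] at hj
    omega
  rw [Finset.sum_congr rfl h1, ← TensorProduct.tmul_sum, eq_neg_of_add_eq_zero_left hω,
    TensorProduct.tmul_neg]

theorem perm_boolSum {E : CliffMod Q} {n : ℕ}
    {f : Bool → Module.End R E.carrier} (hf : ∀ b, IsMor E E (f b)) (σ : Equiv.Perm (Fin n))
    (c : (Fin n → Bool) → R) :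
    E.perm σ * boolSum f c = boolSum f (fun s => c fun i => s (σ i)) * E.perm σ := by
  unfold boolSum
  rw [Finset.mul_sum, Finset.sum_mul,
    ← Equiv.sum_comp (Equiv.arrowCongr σ (Equiv.refl Bool)) (fun s => (c (fun i => s (σ i)) •
      PiTensorProduct.map fun i => f (s i)) * E.perm σ)]
  refine Finset.sum_congr rfl fun s _ => ?_
  rw [mul_smul_comm, smul_mul_assoc]
  congr 1
  · simp
  · exact LinearMap.ext fun x => perm_map σ (fun i => hf (s i)) x

/-- A direct summand `N` of `E` gives a direct summand of `E^{⊗ k}`, with class `Ψ̄ᵏ(N)`. -/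
theorem chi_map_retract {E N : CliffMod Q} (h : ∀ v, Q' v = k • Q v)
    {i : N.carrier →ₗ[R] E.carrier} {p : E.carrier →ₗ[R] N.carrier} (hi : IsMor N E i)
    (hp : IsMor E N p) (hpi : p ∘ₗ i = LinearMap.id) :
    chi k ζ (E.power k h) (E.perm (finRotate k))
      (⊤ ⊓ Module.End.eigenspace (PiTensorProduct.map fun _ => i ∘ₗ p) 1) = N.psiBar k h ζ := by
  have h1 : ∀ x : ⨂[R] _ : Fin k, N.carrier, PiTensorProduct.map (fun _ => p)
      (PiTensorProduct.map (fun _ => i) x) = x := fun x => by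
    rw [← LinearMap.comp_apply, ← PiTensorProduct.map_comp, hpi, PiTensorProduct.map_id]
    rfl
  have h2 : ∀ x : ⨂[R] _ : Fin k, E.carrier, PiTensorProduct.map (fun _ => i)
      (PiTensorProduct.map (fun _ => p) x) = PiTensorProduct.map (fun _ => i ∘ₗ p) x := fun x => by
    rw [← LinearMap.comp_apply, ← PiTensorProduct.map_comp]
  rw [psiBar_eq_chi]
  refine Eq.symm (chi_congr Stable.top (Stable.top.inf (Stable.eigenspace
    (IsMor.power h fun _ => hi.comp hp) 1)) (isMor_perm N h _) (isMor_perm E h _)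
    (fun _ _ => trivial) (PiTensorProduct.map fun _ => i) (IsMor.power h fun _ => hi)
    (PiTensorProduct.map fun _ => p) (fun x _ => ⟨trivial, ?_⟩) (fun _ _ => trivial)
    (fun x _ => h1 x) (fun y hy => ?_) (fun x _ => (perm_map _ (fun _ => hi) x).symm))
  · refine Module.End.mem_eigenspace_iff.2 ?_
    rw [← h2, h1, one_smul]
  · rw [h2, Module.End.mem_eigenspace_iff.1 hy.2, one_smul]

theorem perm_countProj {E : CliffMod Q} {n : ℕ} {f : Bool → Module.End R E.carrier}
    (hf : ∀ b, IsMor E E (f b)) (σ : Equiv.Perm (Fin n)) (m : ℕ) :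
    E.perm σ * countProj n f m = countProj n f m * E.perm σ := by
  unfold countProj
  rw [perm_boolSum hf]
  congr 2
  funext s
  rw [Finset.card_equiv σ (t := Finset.univ.filter fun i => s i = true) fun i => by simp]

/-- The mixed part of `(E₀ ⊕ E₁)^{⊗ k}` with `m` factors `E₁` does not contribute, unless `k`
divides `m`: its direct summands are permuted by the cyclic permutation, and multiplying the
summand with factors `E₁` at the places in `S` by `∏_{i ∈ S} ζ^i` shifts the eigenvalues of the
cyclic permutation by `ζ^m`. -/
theorem chi_countProj_eq_zero (hk : 0 < k) (hζ : IsCycRoot k ζ) {E : CliffMod Q}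
    (h : ∀ v, Q' v = k • Q v) {f : Bool → Module.End R E.carrier} (hf : ∀ b, IsMor E E (f b))
    (hff : ∀ b c, f b * f c = if b = c then f b else 0) (hf1 : f false + f true = 1) {m : ℕ}
    (hm : ¬ k ∣ m) :
    chi k ζ (E.power k h) (E.perm (finRotate k))
      (⊤ ⊓ Module.End.eigenspace (countProj k f m) 1) = 0 := by
  have hS : (E.power k h).Stable (⊤ ⊓ Module.End.eigenspace (countProj k f m) 1) :=
    Stable.top.inf (Stable.eigenspace (isMor_boolSum h hf _) 1)
  have hmem : ∀ T : Module.End R (⨂[R] _ : Fin k, E.carrier),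
      T * countProj k f m = countProj k f m * T →
      ∀ x ∈ (⊤ ⊓ Module.End.eigenspace (countProj k f m) 1 : Submodule R _),
        T x ∈ (⊤ ⊓ Module.End.eigenspace (countProj k f m) 1 : Submodule R _) := by
    intro T hT x hx
    refine ⟨trivial, Module.End.mem_eigenspace_iff.2 ?_⟩
    have h2 := Module.End.mem_eigenspace_iff.1 hx.2
    rw [one_smul] at *
    rw [← Module.End.mul_apply, ← hT, Module.End.mul_apply, h2]
  have hc : ∀ c, boolSum f c * countProj k f m = countProj k f m * boolSum f c := fun c => by
    unfold countProj
    rw [boolSum_mul hff, boolSum_mul hff]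
    simp only [mul_comm]
  have hinv : ∀ c d : (Fin k → Bool) → R, (∀ s, c s * d s = 1) →
      ∀ x, boolSum f c (boolSum f d x) = x := by
    intro c d hcd x
    rw [← Module.End.mul_apply, boolSum_mul hff]
    simp only [hcd, boolSum_one hf1]
    rfl
  have hcw := fun s : Fin k → Bool => isUnit_cycWeight hζ s
  refine chi_eq_zero hk hζ hS (isMor_perm _ h _) (hmem _ (perm_countProj hf _ m)) hm
    (boolSum f (cycWeight ζ)) (isMor_boolSum h hf _)
    (boolSum f fun s => Ring.inverse (cycWeight ζ s)) (hmem _ (hc _)) (hmem _ (hc _))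
    (fun x _ => hinv _ _ (fun s => Ring.inverse_mul_cancel _ (hcw s)) x)
    (fun x _ => hinv _ _ (fun s => Ring.mul_inverse_cancel _ (hcw s)) x) fun x hx => ?_
  have h2 := Module.End.mem_eigenspace_iff.1 hx.2
  rw [one_smul] at h2
  have h3 : boolSum f (cycWeight ζ) * E.perm (finRotate k) * countProj k f m =
      ζ ^ m • (E.perm (finRotate k) * boolSum f (cycWeight ζ) * countProj k f m) := by
    rw [perm_boolSum hf, mul_assoc, mul_assoc, perm_countProj hf, ← mul_assoc, ← mul_assoc,
      countProj, boolSum_mul hff, boolSum_mul hff, ← smul_mul_assoc, ← boolSum_smul]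
    congr 2
    funext s
    split_ifs with hs
    · rw [cycWeight_finRotate hζ s, mul_one, mul_one, ← hs]
    · simp only [mul_zero]
  have h4 := LinearMap.congr_fun h3 x
  simpa only [Module.End.mul_apply, LinearMap.smul_apply, h2] using h4

theorem psiBar_eq_sum_countProj [Module.Finite R V] [Module.Projective R V] (hk : 0 < k)
    (hu : IsUnit (k : R)) (hζ : IsCycRoot k ζ) {E : CliffMod Q} (hE : E.IsFGP)
    (h : ∀ v, Q' v = k • Q v) {f : Bool → Module.End R E.carrier} (hf : ∀ b, IsMor E E (f b))
    (hff : ∀ b c, f b * f c = if b = c then f b else 0) (hf1 : f false + f true = 1) :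
    E.psiBar k h ζ = ∑ m ∈ Finset.range (k + 1), chi k ζ (E.power k h) (E.perm (finRotate k))
      (⊤ ⊓ Module.End.eigenspace (countProj k f m) 1) := by
  rw [psiBar_eq_chi]
  refine chi_decomp hk hu hζ (subFGP_top (hE.power hk h)) (isMor_perm _ h _) (fun _ _ => trivial)
    (fun x _ => by rw [perm_finRotate_pow]; rfl) _ _ (fun m _ => isMor_boolSum h hf _)
    (fun _ _ _ _ => trivial) (fun m _ x _ => ?_) (fun m _ n _ hmn x _ => ?_) (fun x _ => ?_)
    (fun m _ x _ => LinearMap.congr_fun (perm_countProj hf _ m) x)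
  · exact LinearMap.congr_fun ((countProj_mul hff m m).trans (if_pos rfl)) x
  · exact LinearMap.congr_fun ((countProj_mul hff m n).trans (if_neg hmn)) x
  · rw [← LinearMap.sum_apply, sum_countProj hf1]
    rfl

theorem psiBar_prod [Module.Finite R V] [Module.Projective R V] (hk : k.Prime)
    (hu : IsUnit (k : R)) (hζ : IsCycRoot k ζ) {E₀ E₁ : CliffMod Q} (h₀ : E₀.IsFGP)
    (h₁ : E₁.IsFGP) (h : ∀ v, Q' v = k • Q v) :
    (E₀.prod E₁).psiBar k h ζ = E₀.psiBar k h ζ + E₁.psiBar k h ζ := by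
  have hi0 : IsMor E₀ (E₀.prod E₁) (LinearMap.inl R E₀.carrier E₁.carrier) :=
    ⟨fun v x => Prod.ext rfl (map_zero (E₁.act (ι Q v))).symm,
      fun x => Prod.ext rfl (map_zero E₁.gr).symm⟩
  have hi1 : IsMor E₁ (E₀.prod E₁) (LinearMap.inr R E₀.carrier E₁.carrier) :=
    ⟨fun v x => Prod.ext (map_zero (E₀.act (ι Q v))).symm rfl,
      fun x => Prod.ext (map_zero E₀.gr).symm rfl⟩
  have hp0 : IsMor (E₀.prod E₁) E₀ (LinearMap.fst R E₀.carrier E₁.carrier) :=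
    ⟨fun v x => rfl, fun x => rfl⟩
  have hp1 : IsMor (E₀.prod E₁) E₁ (LinearMap.snd R E₀.carrier E₁.carrier) :=
    ⟨fun v x => rfl, fun x => rfl⟩
  let f : Bool → Module.End R (E₀.prod E₁).carrier := fun b =>
    bif b then LinearMap.inr R E₀.carrier E₁.carrier ∘ₗ LinearMap.snd R E₀.carrier E₁.carrier
      else LinearMap.inl R E₀.carrier E₁.carrier ∘ₗ LinearMap.fst R E₀.carrier E₁.carrier
  have hf : ∀ b, IsMor (E₀.prod E₁) (E₀.prod E₁) (f b) := fun b => by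
    cases b
    · exact hi0.comp hp0
    · exact hi1.comp hp1
  have hff : ∀ b c, f b * f c = if b = c then f b else 0 := fun b c => by
    refine LinearMap.ext fun x => ?_
    cases b <;> cases c <;> simp [f, Module.End.mul_apply]
  have hf1 : f false + f true = 1 := by
    refine LinearMap.ext fun x => Prod.ext ?_ ?_ <;> simp [f]
  rw [psiBar_eq_sum_countProj hk.pos hu hζ (h₀.prod h₁) h hf hff hf1,
    Finset.sum_eq_add_of_mem 0 k (Finset.mem_range.2 (Nat.succ_pos k))
    (Finset.self_mem_range_succ k) hk.ne_zero.symm, countProj_zero, countProj_self]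
  · congr 1
    · exact chi_map_retract h hi0 hp0 (LinearMap.ext fun x => rfl)
    · exact chi_map_retract h hi1 hp1 (LinearMap.ext fun x => rfl)
  · rintro m hm ⟨hm0, hmk⟩
    refine chi_countProj_eq_zero hk.pos hζ h hf hff hf1 fun hd => ?_
    have := Nat.le_of_dvd (Nat.pos_of_ne_zero hm0) hd
    rw [Finset.mem_range] at hm
    omega

end Additivity

/-! ### Tensor powers of a tensor product -/

section Interchange

variable {X Y : Type u} [AddCommGroup X] [Module R X] [AddCommGroup Y] [Module R Y]

/-- `x ↦ y ↦ x ⊗ y` for the tensor power. -/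
def consMap (R X : Type u) [CommRing R] [AddCommGroup X] [Module R X] (n : ℕ) :
    X →ₗ[R] (⨂[R] _ : Fin n, X) →ₗ[R] (⨂[R] _ : Fin (n + 1), X) :=
  (PiTensorProduct.lift (R := R) (s := fun _ : Fin n => X)).toLinearMap ∘ₗ
    (PiTensorProduct.tprod R (s := fun _ : Fin (n + 1) => X)).curryLeft

theorem consMap_tprod (n : ℕ) (x : X) (y : Fin n → X) :
    consMap R X n x (PiTensorProduct.tprod R y) =
      PiTensorProduct.tprod R (Fin.cons x y : Fin (n + 1) → X) := by
  simp [consMap]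

/-- The multilinear map underlying `unzip`. -/
def unzipAux (R X Y : Type u) [CommRing R] [AddCommGroup X] [Module R X] [AddCommGroup Y]
    [Module R Y] : (n : ℕ) → MultilinearMap R (fun _ : Fin n => X ⊗[R] Y)
      ((⨂[R] _ : Fin n, X) ⊗[R] (⨂[R] _ : Fin n, Y))
  | 0 => MultilinearMap.constOfIsEmpty R _
      (PiTensorProduct.tprod R Fin.elim0 ⊗ₜ PiTensorProduct.tprod R Fin.elim0)
  | n + 1 => LinearMap.uncurryLeft (M := fun _ : Fin (n + 1) => X ⊗[R] Y)
      { toFun := fun z => (TensorProduct.map₂ (consMap R X n) (consMap R Y n) z).compMultilinearMap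
          (unzipAux R X Y n)
        map_add' := fun z w => by ext; simp
        map_smul' := fun c z => by ext; simp }

theorem unzipAux_tmul (n : ℕ) (x : Fin n → X) (y : Fin n → Y) :
    unzipAux R X Y n (fun i => x i ⊗ₜ y i) =
      PiTensorProduct.tprod R x ⊗ₜ PiTensorProduct.tprod R y := by
  induction n with
  | zero =>
    rw [Subsingleton.elim x Fin.elim0, Subsingleton.elim y Fin.elim0]
    rfl
  | succ n ih =>
    change TensorProduct.map₂ (consMap R X n) (consMap R Y n) (x 0 ⊗ₜ y 0)
      (unzipAux R X Y n fun i => x i.succ ⊗ₜ y i.succ) = _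
    rw [ih, TensorProduct.map₂_apply_tmul, TensorProduct.map_tmul, consMap_tprod, consMap_tprod]
    congr 2
    · exact Fin.cons_self_tail x
    · exact Fin.cons_self_tail y

/-- The map `(x₁ ⊗ y₁) ⊗ ⋯ ⊗ (xₙ ⊗ yₙ) ↦ (x₁ ⊗ ⋯ ⊗ xₙ) ⊗ (y₁ ⊗ ⋯ ⊗ yₙ)`, without signs. -/
def unzip (R X Y : Type u) [CommRing R] [AddCommGroup X] [Module R X] [AddCommGroup Y]
    [Module R Y] (n : ℕ) : (⨂[R] _ : Fin n, X ⊗[R] Y) →ₗ[R]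
      (⨂[R] _ : Fin n, X) ⊗[R] (⨂[R] _ : Fin n, Y) :=
  PiTensorProduct.lift (unzipAux R X Y n)

theorem unzip_tprod {n : ℕ} (x : Fin n → X) (y : Fin n → Y) :
    unzip R X Y n (PiTensorProduct.tprod R fun i => x i ⊗ₜ y i) =
      PiTensorProduct.tprod R x ⊗ₜ PiTensorProduct.tprod R y := by
  rw [unzip, PiTensorProduct.lift.tprod, unzipAux_tmul]

/-- The inverse of `unzip`. -/
def zip (R X Y : Type u) [CommRing R] [AddCommGroup X] [Module R X] [AddCommGroup Y]
    [Module R Y] (n : ℕ) : (⨂[R] _ : Fin n, X) ⊗[R] (⨂[R] _ : Fin n, Y) →ₗ[R]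
      (⨂[R] _ : Fin n, X ⊗[R] Y) :=
  TensorProduct.lift (PiTensorProduct.map₂ fun _ => TensorProduct.mk R X Y)

theorem zip_tprod {n : ℕ} (x : Fin n → X) (y : Fin n → Y) :
    zip R X Y n (PiTensorProduct.tprod R x ⊗ₜ PiTensorProduct.tprod R y) =
      PiTensorProduct.tprod R fun i => x i ⊗ₜ y i := by
  rw [zip, TensorProduct.lift.tmul, PiTensorProduct.map₂_tprod_tprod]
  rfl

theorem unzip_zip {n : ℕ} (z : (⨂[R] _ : Fin n, X) ⊗[R] (⨂[R] _ : Fin n, Y)) :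
    unzip R X Y n (zip R X Y n z) = z := by
  refine LinearMap.congr_fun (f := unzip R X Y n ∘ₗ _) (g := LinearMap.id) ?_ z
  refine tprod_tmul_tprod_ext fun x y => ?_
  rw [LinearMap.comp_apply, zip_tprod, unzip_tprod, LinearMap.id_apply]

end Interchange

/-- The sign in the isomorphism of graded modules
`(x₁ ⊗ y₁) ⊗ ⋯ ⊗ (xₙ ⊗ yₙ) ↦ ± (x₁ ⊗ ⋯ ⊗ xₙ) ⊗ (y₁ ⊗ ⋯ ⊗ yₙ)` for `xᵢ`, `yᵢ` of parity
`s i`, `t i`: each `xⱼ` moves across the `yᵢ` with `i < j`. -/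
def zipSign {n : ℕ} (s t : Fin n → Bool) : ℤˣ :=
  ∏ i, ∏ j, if i < j ∧ t i = true ∧ s j = true then -1 else 1

theorem sg_xor (b c : Bool) : sg R (xor b c) = sg R b * sg R c := by
  cases b <;> cases c <;> simp [sg]

theorem koszulSign_xor {n : ℕ} (σ : Equiv.Perm (Fin n)) (s t : Fin n → Bool) :
    koszulSign σ (fun i => xor (s i) (t i)) *
        zipSign (fun i => s (σ.symm i)) (fun i => t (σ.symm i)) =
      zipSign s t * (koszulSign σ s * koszulSign σ t) := by
  have h1 : zipSign (fun i => s (σ.symm i)) (fun i => t (σ.symm i)) =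
      ∏ i, ∏ j, if σ i < σ j ∧ t i = true ∧ s j = true then -1 else 1 := by
    unfold zipSign
    rw [← Equiv.prod_comp σ]
    refine Finset.prod_congr rfl fun i _ => ?_
    rw [← Equiv.prod_comp σ]
    simp
  rw [h1]
  unfold koszulSign zipSign
  simp only [← Finset.prod_mul_distrib]
  refine prod_pairs_congr _ _ (fun i => by simp) fun i j hij => ?_
  have h2 : σ i ≠ σ j := fun h => hij.ne (σ.injective h)
  rcases lt_or_gt_of_ne h2 with h2 | h2 <;>
    rcases Bool.eq_false_or_eq_true (s i) with hsi | hsi <;>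
    rcases Bool.eq_false_or_eq_true (s j) with hsj | hsj <;>
    rcases Bool.eq_false_or_eq_true (t i) with hti | hti <;>
    rcases Bool.eq_false_or_eq_true (t j) with htj | htj <;>
    simp [hij, hij.not_gt, h2, h2.not_gt, hsi, hsj, hti, htj]

theorem zipSign_update_left {n : ℕ} (s t : Fin n → Bool) (i : Fin n) :
    ((zipSign (Function.update s i !(s i)) t : ℤ) : R) =
      ((zipSign s t : ℤ) : R) * ∏ j, if j < i then sg R (t j) else 1 := by
  unfold zipSign
  push_cast
  rw [← Finset.prod_mul_distrib]
  refine Finset.prod_congr rfl fun j _ => ?_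
  rw [← Finset.prod_erase_mul _ _ (Finset.mem_univ i), ← Finset.prod_erase_mul _ _
    (Finset.mem_univ i), mul_assoc]
  congr 1
  · refine Finset.prod_congr rfl fun l hl => ?_
    rw [Function.update_of_ne (Finset.ne_of_mem_erase hl)]
  · rw [Function.update_self]
    by_cases h : j < i <;> cases s i <;> cases t j <;> simp [h, sg]

theorem zipSign_update_right {n : ℕ} (s t : Fin n → Bool) (i : Fin n) :
    ((zipSign s (Function.update t i !(t i)) : ℤ) : R) =
      ((zipSign s t : ℤ) : R) * ∏ j, if i < j then sg R (s j) else 1 := by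
  unfold zipSign
  push_cast
  rw [Finset.prod_comm, Finset.prod_comm (f := fun i j => (((if i < j ∧ t i = true ∧ s j = true then
    -1 else 1 : ℤˣ) : ℤ) : R)), ← Finset.prod_mul_distrib]
  refine Finset.prod_congr rfl fun j _ => ?_
  rw [← Finset.prod_erase_mul _ _ (Finset.mem_univ i), ← Finset.prod_erase_mul _ _
    (Finset.mem_univ i), mul_assoc]
  congr 1
  · refine Finset.prod_congr rfl fun l hl => ?_
    rw [Function.update_of_ne (Finset.ne_of_mem_erase hl)]
  · rw [Function.update_self]
    by_cases h : i < j <;> cases t i <;> cases s j <;> simp [h, sg]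

theorem isHom_tmul {E₀ : CliffMod Q₁} {E₁ : CliffMod Q₂}
    (h : ∀ v, Q₃ v = Q₁ v + Q₂ v) {b c : Bool} {x : E₀.carrier} {y : E₁.carrier}
    (hx : E₀.IsHom b x) (hy : E₁.IsHom c y) : (tensor h E₀ E₁).IsHom (xor b c) (x ⊗ₜ[R] y) := by
  unfold IsHom at *
  refine (TensorProduct.map_tmul _ _ _ _).trans ?_
  rw [hx, hy, TensorProduct.smul_tmul_smul, sg_xor]

theorem isHom_update {n : ℕ} {M : CliffMod Q} {s : Fin n → Bool}
    {x : Fin n → M.carrier} (hx : ∀ i, M.IsHom (s i) (x i)) (i : Fin n) (v : V) (j : Fin n) :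
    M.IsHom (Function.update s i (!(s i)) j) (Function.update x i (M.act (ι Q v) (x i)) j) := by
  by_cases hj : j = i
  · subst hj
    simpa using (hx j).act v
  · simpa [hj] using hx j

section Zip

variable [Invertible (2 : R)] (E₀ : CliffMod Q₁) (E₁ : CliffMod Q₂) {n : ℕ}

/-- The operator which multiplies the product of homogeneous tensors by `zipSign`. -/
def zipSignMap (n : ℕ) : Module.End R
    ((⨂[R] _ : Fin n, E₀.carrier) ⊗[R] (⨂[R] _ : Fin n, E₁.carrier)) :=
  ∑ s : Fin n → Bool, ∑ t : Fin n → Bool, ((zipSign s t : ℤ) : R) •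
    TensorProduct.map (PiTensorProduct.map fun i => E₀.proj (s i))
      (PiTensorProduct.map fun i => E₁.proj (t i))

variable {E₀ E₁}

theorem zipSignMap_tprod {s t : Fin n → Bool} {x : Fin n → E₀.carrier} {y : Fin n → E₁.carrier}
    (hx : ∀ i, E₀.IsHom (s i) (x i)) (hy : ∀ i, E₁.IsHom (t i) (y i)) :
    zipSignMap E₀ E₁ n (PiTensorProduct.tprod R x ⊗ₜ PiTensorProduct.tprod R y) =
      ((zipSign s t : ℤ) : R) • (PiTensorProduct.tprod R x ⊗ₜ PiTensorProduct.tprod R y) := by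
  classical
  simp only [zipSignMap, LinearMap.sum_apply, LinearMap.smul_apply, TensorProduct.map_tmul,
    PiTensorProduct.map_tprod, IsHom.tprod_proj hx, IsHom.tprod_proj hy]
  rw [Finset.sum_eq_single s, Finset.sum_eq_single t, if_pos rfl, if_pos rfl]
  · intro t' _ ht'
    rw [if_neg ht', TensorProduct.tmul_zero, smul_zero]
  · intro h
    exact absurd (Finset.mem_univ t) h
  · intro s' _ hs'
    refine Finset.sum_eq_zero fun t' _ => ?_
    rw [if_neg hs', TensorProduct.zero_tmul, smul_zero]
  · intro h
    exact absurd (Finset.mem_univ s) h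

theorem zipSignMap_zipSignMap (z) : zipSignMap E₀ E₁ n (zipSignMap E₀ E₁ n z) = z := by
  refine LinearMap.congr_fun (f := zipSignMap E₀ E₁ n ∘ₗ zipSignMap E₀ E₁ n)
    (g := LinearMap.id) ?_ z
  refine tprod_tmul_tprod_hom_ext E₀ E₁ fun s x t y hx hy => ?_
  rw [LinearMap.comp_apply, zipSignMap_tprod hx hy, map_smul, zipSignMap_tprod hx hy, smul_smul,
    ← Int.cast_mul, Int.units_coe_mul_self, Int.cast_one, one_smul, LinearMap.id_apply]

/-- Linear maps on a tensor power of `E₀ ⊗ E₁` are equal as soon as they agree on the tensors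
`(x₁ ⊗ y₁) ⊗ ⋯ ⊗ (xₙ ⊗ yₙ)` with homogeneous `xᵢ`, `yᵢ`. -/
theorem tprod_tmul_hom_ext (E₀ : CliffMod Q₁) (E₁ : CliffMod Q₂) {P : Type u} [AddCommGroup P]
    [Module R P] {f g : (⨂[R] _ : Fin n, E₀.carrier ⊗[R] E₁.carrier) →ₗ[R] P}
    (h : ∀ (s t : Fin n → Bool) (x : Fin n → E₀.carrier) (y : Fin n → E₁.carrier),
      (∀ i, E₀.IsHom (s i) (x i)) → (∀ i, E₁.IsHom (t i) (y i)) →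
      f (PiTensorProduct.tprod R fun i => x i ⊗ₜ y i) =
        g (PiTensorProduct.tprod R fun i => x i ⊗ₜ y i)) : f = g := by
  let γ := {q : (Bool × E₀.carrier) × Bool × E₁.carrier // E₀.IsHom q.1.1 q.1.2 ∧
    E₁.IsHom q.2.1 q.2.2}
  have hspan : Submodule.span R (Set.range fun q : γ => q.1.1.2 ⊗ₜ[R] q.1.2.2) = ⊤ := by
    rw [eq_top_iff, ← TensorProduct.span_tmul_eq_top, Submodule.span_le]
    rintro _ ⟨x, y, rfl⟩
    have hm : ∀ b c, E₀.proj b x ⊗ₜ[R] E₁.proj c y ∈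
        Submodule.span R (Set.range fun q : γ => q.1.1.2 ⊗ₜ[R] q.1.2.2) := fun b c =>
      Submodule.subset_span ⟨⟨((b, _), (c, _)), isHom_proj E₀ b x, isHom_proj E₁ c y⟩, rfl⟩
    rw [SetLike.mem_coe, ← proj_add_proj E₀ x, ← proj_add_proj E₁ y, TensorProduct.add_tmul,
      TensorProduct.tmul_add, TensorProduct.tmul_add]
    exact add_mem (add_mem (hm _ _) (hm _ _)) (add_mem (hm _ _) (hm _ _))
  refine PiTensorProduct.ext_of_span_eq_top (γ := fun _ => γ)
    (g := fun {_} (q : γ) => q.1.1.2 ⊗ₜ[R] q.1.2.2) (fun _ => hspan) fun q => ?_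
  exact h (fun i => (q i).1.1.1) (fun i => (q i).1.2.1) (fun i => (q i).1.1.2)
    (fun i => (q i).1.2.2) (fun i => (q i).2.1) (fun i => (q i).2.2)

theorem zip_unzip (z : ⨂[R] _ : Fin n, E₀.carrier ⊗[R] E₁.carrier) :
    zip R E₀.carrier E₁.carrier n (unzip R E₀.carrier E₁.carrier n z) = z := by
  refine LinearMap.congr_fun (f := zip R E₀.carrier E₁.carrier n ∘ₗ _) (g := LinearMap.id) ?_ z
  refine tprod_tmul_hom_ext E₀ E₁ fun s t x y _ _ => ?_
  rw [LinearMap.comp_apply, unzip_tprod, zip_tprod, LinearMap.id_apply]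

variable (E₀ E₁)

/-- The isomorphism `(E₀ ⊗ E₁)^{⊗ n} → E₀^{⊗ n} ⊗ E₁^{⊗ n}` given by the sign rule. -/
def gradedUnzip (n : ℕ) : (⨂[R] _ : Fin n, E₀.carrier ⊗[R] E₁.carrier) →ₗ[R]
    (⨂[R] _ : Fin n, E₀.carrier) ⊗[R] (⨂[R] _ : Fin n, E₁.carrier) :=
  zipSignMap E₀ E₁ n ∘ₗ unzip R E₀.carrier E₁.carrier n

variable {E₀ E₁}

theorem gradedUnzip_tprod {s t : Fin n → Bool} {x : Fin n → E₀.carrier}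
    {y : Fin n → E₁.carrier} (hx : ∀ i, E₀.IsHom (s i) (x i)) (hy : ∀ i, E₁.IsHom (t i) (y i)) :
    gradedUnzip E₀ E₁ n (PiTensorProduct.tprod R fun i => x i ⊗ₜ y i) =
      ((zipSign s t : ℤ) : R) • (PiTensorProduct.tprod R x ⊗ₜ PiTensorProduct.tprod R y) := by
  rw [gradedUnzip, LinearMap.comp_apply, unzip_tprod, zipSignMap_tprod hx hy]

variable (h : ∀ v, Q₃ v = Q₁ v + Q₂ v)

theorem gradedUnzip_perm (σ : Equiv.Perm (Fin n))
    (z : ⨂[R] _ : Fin n, E₀.carrier ⊗[R] E₁.carrier) :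
    gradedUnzip E₀ E₁ n ((tensor h E₀ E₁).perm σ z) =
      TensorProduct.map (E₀.perm σ) (E₁.perm σ) (gradedUnzip E₀ E₁ n z) := by
  refine LinearMap.congr_fun (f := gradedUnzip E₀ E₁ n ∘ₗ (tensor h E₀ E₁).perm σ)
    (g := TensorProduct.map (E₀.perm σ) (E₁.perm σ) ∘ₗ gradedUnzip E₀ E₁ n) ?_ z
  refine tprod_tmul_hom_ext E₀ E₁ fun s t x y hx hy => ?_
  have h1 := perm_tprod (tensor h E₀ E₁) σ (x := fun i => x i ⊗ₜ[R] y i)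
    (fun i => isHom_tmul h (hx i) (hy i))
  rw [LinearMap.comp_apply, LinearMap.comp_apply, gradedUnzip_tprod hx hy, map_smul,
    TensorProduct.map_tmul, perm_tprod E₀ σ hx, perm_tprod E₁ σ hy, TensorProduct.smul_tmul_smul,
    smul_smul]
  refine (congrArg (gradedUnzip E₀ E₁ n) h1).trans ?_
  rw [map_smul, gradedUnzip_tprod (fun i => hx (σ.symm i)) (fun i => hy (σ.symm i)), smul_smul]
  congr 1
  have h2 := congrArg (fun u : ℤˣ => ((u : ℤ) : R)) (koszulSign_xor σ s t)
  push_cast at h2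
  exact h2

theorem isMor_gradedUnzip {Q₁' Q₂' Q₃' : QuadraticForm R V} (h₁ : ∀ v, Q₁' v = n • Q₁ v)
    (h₂ : ∀ v, Q₂' v = n • Q₂ v) (h₃ : ∀ v, Q₃' v = n • Q₃ v) (h' : ∀ v, Q₃' v = Q₁' v + Q₂' v) :
    IsMor ((tensor h E₀ E₁).power n h₃) (tensor h' (E₀.power n h₁) (E₁.power n h₂))
      (gradedUnzip E₀ E₁ n) := by
  constructor
  · intro v z
    refine LinearMap.congr_fun
      (f := gradedUnzip E₀ E₁ n ∘ₗ ((tensor h E₀ E₁).power n h₃).act (ι Q₃' v))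
      (g := (tensor h' (E₀.power n h₁) (E₁.power n h₂)).act (ι Q₃' v) ∘ₗ gradedUnzip E₀ E₁ n) ?_ z
    refine tprod_tmul_hom_ext E₀ E₁ fun s t x y hx hy => ?_
    rw [LinearMap.comp_apply, LinearMap.comp_apply, gradedUnzip_tprod hx hy, map_smul,
      power_act_ι, LinearMap.sum_apply, map_sum]
    have e1 := tensor_act_ι h' (E₀.power n h₁) (E₁.power n h₂) v (PiTensorProduct.tprod R x)
      (PiTensorProduct.tprod R y)
    refine Eq.trans ?_ (congrArg (((zipSign s t : ℤ) : R) • ·) e1).symm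
    have e2 : (E₀.power n h₁).gr (PiTensorProduct.tprod R x) =
        (∏ j, sg R (s j)) • PiTensorProduct.tprod R x := by
      refine (PiTensorProduct.map_tprod _ _).trans ?_
      rw [← MultilinearMap.map_smul_univ]
      exact congrArg _ (funext fun j => hx j)
    rw [power_act_ι, power_act_ι, e2, LinearMap.sum_apply, LinearMap.sum_apply,
      TensorProduct.sum_tmul, TensorProduct.tmul_sum, ← Finset.sum_add_distrib, Finset.smul_sum]
    refine Finset.sum_congr rfl fun i _ => ?_
    have e3 := slotMap_tprod (tensor h E₀ E₁) i v (x := fun i => x i ⊗ₜ[R] y i)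
      (fun i => isHom_tmul h (hx i) (hy i))
    have e4 : Function.update (fun i => x i ⊗ₜ[R] y i) i
        ((tensor h E₀ E₁).act (ι Q₃ v) (x i ⊗ₜ[R] y i)) =
        Function.update (fun i => x i ⊗ₜ[R] y i) i
          (E₀.act (ι Q₁ v) (x i) ⊗ₜ[R] y i + sg R (s i) • (x i ⊗ₜ[R] E₁.act (ι Q₂ v) (y i))) := by
      congr 1
      rw [tensor_act_ι, hx i, TensorProduct.smul_tmul']
    have e5 : Function.update (fun i => x i ⊗ₜ[R] y i) i (E₀.act (ι Q₁ v) (x i) ⊗ₜ[R] y i) =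
        fun j => Function.update x i (E₀.act (ι Q₁ v) (x i)) j ⊗ₜ[R] y j := by
      funext j
      by_cases hj : j = i
      · subst hj; simp
      · simp [hj]
    have e6 : Function.update (fun i => x i ⊗ₜ[R] y i) i (x i ⊗ₜ[R] E₁.act (ι Q₂ v) (y i)) =
        fun j => x j ⊗ₜ[R] Function.update y i (E₁.act (ι Q₂ v) (y i)) j := by
      funext j
      by_cases hj : j = i
      · subst hj; simp
      · simp [hj]
    refine (congrArg (gradedUnzip E₀ E₁ n) e3).trans ?_
    rw [e4, MultilinearMap.map_update_add, MultilinearMap.map_update_smul, e5, e6, map_smul,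
      map_add, map_smul, gradedUnzip_tprod (isHom_update hx i v) hy,
      gradedUnzip_tprod hx (isHom_update hy i v), slotMap_tprod E₀ i v hx,
      slotMap_tprod E₁ i v hy, zipSign_update_left, zipSign_update_right,
      ← TensorProduct.smul_tmul', TensorProduct.smul_tmul_smul, smul_add, smul_add, smul_smul,
      smul_smul, smul_smul, smul_smul, smul_smul]
    have hsq : ∀ f : Fin n → Bool, (∏ j, if j < i then sg R (f j) else 1) *
        (∏ j, if j < i then sg R (f j) else 1) = 1 := fun f => by
      rw [← Finset.prod_mul_distrib]
      refine Finset.prod_eq_one fun j _ => ?_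
      split_ifs <;> simp [sg_mul_self]
    have hxor : (∏ j, if j < i then sg R (xor (s j) (t j)) else 1) =
        (∏ j, if j < i then sg R (s j) else 1) * ∏ j, if j < i then sg R (t j) else 1 := by
      rw [← Finset.prod_mul_distrib]
      refine Finset.prod_congr rfl fun j _ => ?_
      split_ifs <;> simp [sg_xor]
    have hall : (∏ j, sg R (s j)) = (∏ j, if j < i then sg R (s j) else 1) * sg R (s i) *
        ∏ j, if i < j then sg R (s j) else 1 := by
      have : sg R (s i) = ∏ j, if j = i then sg R (s j) else 1 := by simp
      rw [this, ← Finset.prod_mul_distrib, ← Finset.prod_mul_distrib]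
      refine Finset.prod_congr rfl fun j _ => ?_
      rcases lt_trichotomy j i with hj | hj | hj
      · simp [hj, hj.ne, hj.not_gt]
      · subst hj; simp
      · simp [hj, hj.ne', hj.not_gt]
    congr 2
    · rw [hxor]
      linear_combination ((zipSign s t : ℤ) : R) *
        (∏ j, if j < i then sg R (s j) else 1) * hsq t
    · rw [hxor, hall]
      ring
  · intro z
    refine LinearMap.congr_fun
      (f := gradedUnzip E₀ E₁ n ∘ₗ ((tensor h E₀ E₁).power n h₃).gr)
      (g := (tensor h' (E₀.power n h₁) (E₁.power n h₂)).gr ∘ₗ gradedUnzip E₀ E₁ n) ?_ z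
    refine tprod_tmul_hom_ext E₀ E₁ fun s t x y hx hy => ?_
    have hx' : ∀ i, E₀.IsHom (s i) (E₀.gr (x i)) := fun i => by
      unfold IsHom; rw [hx i, map_smul, hx i]
    have hy' : ∀ i, E₁.IsHom (t i) (E₁.gr (y i)) := fun i => by
      unfold IsHom; rw [hy i, map_smul, hy i]
    rw [LinearMap.comp_apply, LinearMap.comp_apply, gradedUnzip_tprod hx hy, map_smul]
    refine (congrArg (gradedUnzip E₀ E₁ n) (PiTensorProduct.map_tprod _ _)).trans ?_
    refine (gradedUnzip_tprod hx' hy').trans (congrArg (((zipSign s t : ℤ) : R) • ·) ?_)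
    refine Eq.trans ?_ (TensorProduct.map_tmul _ _ _ _).symm
    exact congrArg₂ (· ⊗ₜ[R] ·) (PiTensorProduct.map_tprod _ _).symm
      (PiTensorProduct.map_tprod _ _).symm

end Zip

/-! ### Multiplicativity -/

section Multiplicativity

theorem eigProj_mul {X : Type*} [AddCommGroup X] [Module R X] {k : ℕ} {ζ : R}
    (hu : IsUnit (k : R)) (hζ : IsCycRoot k ζ) {T : Module.End R X} (hT : T ^ k = 1)
    {i j : ℕ} (hi : i < k) (hj : j < k) :
    eigProj k ζ T i * eigProj k ζ T j = if i = j then eigProj k ζ T i else 0 := by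
  have hk : 0 < k := by omega
  have hTk : ∀ x, (T ^ k) x = x := fun x => by rw [hT]; rfl
  refine LinearMap.ext fun x => ?_
  have h1 := apply_eigProj hk hζ (hTk x) j
  rw [Module.End.mul_apply]
  split_ifs with hij
  · subst hij
    exact eigProj_of_eigen hk hu hζ h1
  · refine eq_zero_of_pow_smul_eq hu hζ hi hj hij ?_
    have hc : T * eigProj k ζ T i = eigProj k ζ T i * T :=
      ((Commute.sum_right _ _ _ fun l _ =>
        ((Commute.refl T).pow_right l).smul_right _).smul_right _)
    rw [← apply_eigProj hk hζ (hTk _), ← map_smul, ← h1]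
    exact LinearMap.congr_fun hc _

variable [Invertible (2 : R)] [Module.Finite R V] [Module.Projective R V]

/-- `chi` turns the tensor product of two modules with automorphisms into the cup-product. -/
theorem chi_tensor (Q : QuadraticForm R V) {a b c : ℕ} (h : a + b = c) (hc : IsUnit (c : R))
    {k : ℕ} {ζ : R} (hk : 0 < k) (hu : IsUnit (k : R)) (hζ : IsCycRoot k ζ)
    {M : CliffMod (a • Q)} {M' : CliffMod (b • Q)} (hM : M.IsFGP) (hM' : M'.IsFGP)
    {T : Module.End R M.carrier} {T' : Module.End R M'.carrier} (hT : IsMor M M T)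
    (hT' : IsMor M' M' T') (hTk : T ^ k = 1) (hTk' : T' ^ k = 1) :
    chi k ζ (tensor (add_nsmul_apply Q h) M M') (TensorProduct.map T T') ⊤ =
      cupOmega Q k h hc (chi k ζ M T ⊤) (chi k ζ M' T' ⊤) := by
  have hx : ∀ x, (T ^ k) x = x := fun x => by rw [hTk]; rfl
  have hx' : ∀ x, (T' ^ k) x = x := fun x => by rw [hTk']; rfl
  have hpow : ∀ n, (TensorProduct.map T T' : Module.End R (M.carrier ⊗[R] M'.carrier)) ^ n =
      TensorProduct.map (T ^ n) (T' ^ n) := fun n => TensorProduct.map_pow T T' n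
  have key := chi_decomp (κ := ℕ × ℕ) hk hu hζ
    (subFGP_top (IsFGP.tensor' (add_nsmul_apply Q h) hM hM'))
    (IsMor.tensor (add_nsmul_apply Q h) hT hT') (fun _ _ => trivial)
    (fun x _ => by
      refine (LinearMap.congr_fun (hpow k) x).trans ?_
      rw [hTk, hTk', TensorProduct.map_one]
      rfl)
    (Finset.range k ×ˢ Finset.range k)
    (fun ij => TensorProduct.map (eigProj k ζ T ij.1) (eigProj k ζ T' ij.2))
    (fun ij _ => IsMor.tensor _ (hT.eigProj _) (hT'.eigProj _)) (fun _ _ _ _ => trivial)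
    (fun ij hij x _ => by
      rw [Finset.mem_product, Finset.mem_range, Finset.mem_range] at hij
      rw [← Module.End.mul_apply, ← TensorProduct.map_mul, eigProj_mul hu hζ hTk hij.1 hij.1,
        eigProj_mul hu hζ hTk' hij.2 hij.2, if_pos rfl, if_pos rfl])
    (fun ij hij lm hlm hne x _ => by
      rw [Finset.mem_product, Finset.mem_range, Finset.mem_range] at hij hlm
      rw [← Module.End.mul_apply, ← TensorProduct.map_mul, eigProj_mul hu hζ hTk hij.1 hlm.1,
        eigProj_mul hu hζ hTk' hij.2 hlm.2]
      by_cases h1 : ij.1 = lm.1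
      · rw [if_neg fun h2 => hne (Prod.ext h1 h2), TensorProduct.map_zero_right]
        rfl
      · rw [if_neg h1, TensorProduct.map_zero_left]
        rfl)
    (fun x _ => by
      induction x using TensorProduct.induction_on with
      | zero => simp only [map_zero, Finset.sum_const_zero]
      | add x y hx hy =>
        simp only [map_add, Finset.sum_add_distrib]
        rw [hx trivial, hy trivial]
      | tmul x y =>
        simp only [TensorProduct.map_tmul, Finset.sum_product]
        simp only [← TensorProduct.tmul_sum, ← TensorProduct.sum_tmul, sum_eigProj hk hu hζ])
    (fun ij _ x _ => by
      have hcomm : ∀ {X : Type u} [AddCommGroup X] [Module R X] (T : Module.End R X) (j : ℕ),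
          T * eigProj k ζ T j = eigProj k ζ T j * T := fun T j =>
        ((Commute.sum_right _ _ _ fun l _ =>
          ((Commute.refl T).pow_right l).smul_right _).smul_right _)
      rw [← Module.End.mul_apply, ← Module.End.mul_apply, ← TensorProduct.map_mul,
        ← TensorProduct.map_mul, hcomm, hcomm])
  have hR : cupOmega Q k h hc (chi k ζ M T ⊤) (chi k ζ M' T' ⊤) =
      ∑ i ∈ Finset.range k, ∑ j ∈ Finset.range k, cupOmega Q k h hc
        (M.subCls (⊤ ⊓ Module.End.eigenspace T (ζ ^ i)) ⊗ₜ[ℤ] (omegaRoot k ^ i))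
        (M'.subCls (⊤ ⊓ Module.End.eigenspace T' (ζ ^ j)) ⊗ₜ[ℤ] (omegaRoot k ^ j)) := by
    unfold chi
    simp only [map_sum, LinearMap.sum_apply]
    exact Finset.sum_comm
  rw [key, Finset.sum_product, hR]
  refine Finset.sum_congr rfl fun i _ => Finset.sum_congr rfl fun j _ => ?_
  have h1 := (subFGP_top hM).eigen hk hu hζ hT (fun _ _ => trivial) (fun x _ => hx x) i
  have h2 := (subFGP_top hM').eigen hk hu hζ hT' (fun _ _ => trivial) (fun x _ => hx' x) j
  have h3 := cup_subCls Q h hc h1 h2 (eigProj k ζ T i) (eigProj k ζ T' j) (hT.eigProj i)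
    (hT'.eigProj j)
    (fun x => ⟨trivial, Module.End.mem_eigenspace_iff.2 (apply_eigProj hk hζ (hx x) i)⟩)
    (fun x => ⟨trivial, Module.End.mem_eigenspace_iff.2 (apply_eigProj hk hζ (hx' x) j)⟩)
    (fun x h => eigProj_of_eigen hk hu hζ (Module.End.mem_eigenspace_iff.1 h.2))
    (fun x h => eigProj_of_eigen hk hu hζ (Module.End.mem_eigenspace_iff.1 h.2))
  rw [chi_scalar hk hu hζ (i + j), top_inf_eq, ← h3, pow_add, cupOmega]
  · rfl
  · intro z hz
    have h4 : TensorProduct.map (eigProj k ζ T i) (eigProj k ζ T' j) z = z := by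
      have := Module.End.mem_eigenspace_iff.1 hz.2
      rwa [one_smul] at this
    have h5 : TensorProduct.map T T' * TensorProduct.map (eigProj k ζ T i) (eigProj k ζ T' j) =
        ζ ^ (i + j) • TensorProduct.map (eigProj k ζ T i) (eigProj k ζ T' j) := by
      refine TensorProduct.ext' fun x y => ?_
      rw [Module.End.mul_apply, LinearMap.smul_apply, TensorProduct.map_tmul,
        TensorProduct.map_tmul, apply_eigProj hk hζ (hx x), apply_eigProj hk hζ (hx' y),
        TensorProduct.smul_tmul_smul, pow_add]
    have h6 := LinearMap.congr_fun h5 z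
    rw [Module.End.mul_apply, LinearMap.smul_apply] at h6
    rwa [h4] at h6

theorem psiBar_tensor (Q : QuadraticForm R V) {k : ℕ} {ζ : R} (hk : 0 < k)
    (h2k : IsUnit ((2 * k : ℕ) : R)) (hu : IsUnit (k : R)) (hζ : IsCycRoot k ζ)
    {E₀ E₁ : CliffMod Q} (h₀ : E₀.IsFGP) (h₁ : E₁.IsFGP) :
    psiBar (Q' := (2 * k) • Q) (tensor (two_nsmul_apply Q) E₀ E₁) k (mul_nsmul_apply Q k) ζ =
      cupOmega Q k (two_mul k).symm h2k (psiBar E₀ k (fun _ => rfl) ζ)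
        (psiBar E₁ k (fun _ => rfl) ζ) := by
  have hpow : ∀ n, (TensorProduct.map (E₀.perm (finRotate k)) (E₁.perm (finRotate k))) ^ n =
      TensorProduct.map (E₀.perm (finRotate k) ^ n) (E₁.perm (finRotate k) ^ n) :=
    fun n => TensorProduct.map_pow _ _ n
  rw [psiBar_eq_chi, psiBar_eq_chi, psiBar_eq_chi,
    ← chi_tensor Q _ _ hk hu hζ (h₀.power hk _) (h₁.power hk _) (isMor_perm _ _ _)
      (isMor_perm _ _ _) (perm_finRotate_pow _ _) (perm_finRotate_pow _ _)]
  refine chi_congr Stable.top Stable.top (isMor_perm _ _ _)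
    (IsMor.tensor _ (isMor_perm _ _ _) (isMor_perm _ _ _)) (fun _ _ => trivial)
    (gradedUnzip E₀ E₁ k) (isMor_gradedUnzip _ _ _ _ _)
    (fun z => zip R E₀.carrier E₁.carrier k (zipSignMap E₀ E₁ k z)) (fun _ _ => trivial)
    (fun _ _ => trivial) (fun x _ => ?_) (fun y _ => ?_)
    (fun x _ => gradedUnzip_perm _ _ x)
  · change zip R E₀.carrier E₁.carrier k (zipSignMap E₀ E₁ k (zipSignMap E₀ E₁ k _)) = x
    rw [zipSignMap_zipSignMap, zip_unzip]
  · change zipSignMap E₀ E₁ k (unzip R E₀.carrier E₁.carrier k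
      (zip R E₀.carrier E₁.carrier k _)) = y
    rw [unzip_zip, zipSignMap_zipSignMap]

end Multiplicativity

/-! ### Invariants of finite groups -/

section Invariants

variable {G G' X X' : Type*} [Group G] [Group G'] [AddCommGroup X] [Module R X] [AddCommGroup X']
  [Module R X']

/-- The invariants of a representation. -/
def invts (ρ : G →* Module.End R X) : Submodule R X := ⨅ g, Module.End.eigenspace (ρ g) 1

theorem mem_invts {ρ : G →* Module.End R X} {x : X} : x ∈ invts ρ ↔ ∀ g, ρ g x = x := by
  simp [invts, Submodule.mem_iInf]

variable [Fintype G] [Fintype G']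

/-- The projection onto the invariants of a representation of a finite group, if the order of the
group is invertible. -/
def avg (ρ : G →* Module.End R X) : Module.End R X :=
  Ring.inverse (Fintype.card G : R) • ∑ g, ρ g

theorem avg_apply (ρ : G →* Module.End R X) (x : X) :
    avg ρ x = Ring.inverse (Fintype.card G : R) • ∑ g, ρ g x := by
  simp [avg, LinearMap.sum_apply]

theorem avg_mem (ρ : G →* Module.End R X) (x : X) : avg ρ x ∈ invts ρ := by
  refine mem_invts.2 fun g => ?_
  rw [avg_apply, map_smul, map_sum, ← Equiv.sum_comp (Equiv.mulLeft g) (fun g => ρ g x)]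
  simp only [← Module.End.mul_apply, ← map_mul, Equiv.coe_mulLeft]

theorem avg_apply_rep (ρ : G →* Module.End R X) (g : G) (x : X) : avg ρ (ρ g x) = avg ρ x := by
  rw [avg_apply, avg_apply, ← Equiv.sum_comp (Equiv.mulRight g) (fun g => ρ g x)]
  simp only [← Module.End.mul_apply, ← map_mul, Equiv.coe_mulRight]

theorem avg_of_mem {ρ : G →* Module.End R X} (hG : IsUnit (Fintype.card G : R)) {x : X}
    (hx : x ∈ invts ρ) : avg ρ x = x := by
  rw [mem_invts] at hx
  simp only [avg_apply, hx, Finset.sum_const, Finset.card_univ]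
  rw [← Nat.cast_smul_eq_nsmul R, smul_smul, Ring.inverse_mul_cancel _ hG, one_smul]

theorem IsMor.avg {M : CliffMod Q} {ρ : G →* Module.End R M.carrier} (h : ∀ g, IsMor M M (ρ g)) :
    IsMor M M (avg ρ) :=
  (IsMor.sum _ fun g _ => h g).smul _

theorem Stable.invts {G : Type*} [Group G] {M : CliffMod Q} {ρ : G →* Module.End R M.carrier}
    (h : ∀ g, IsMor M M (ρ g)) : M.Stable (invts ρ) :=
  Stable.iInf fun g => Stable.eigenspace (h g) 1

theorem subFGP_invts {M : CliffMod Q} (hM : M.IsFGP) {ρ : G →* Module.End R M.carrier}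
    (h : ∀ g, IsMor M M (ρ g)) (hG : IsUnit (Fintype.card G : R)) : M.SubFGP (invts ρ) :=
  (subFGP_top hM).of_retract (Stable.invts h) le_top (CliffMod.avg ρ) (IsMor.avg h)
    (fun x _ => avg_mem ρ x) fun _ hx => avg_of_mem hG hx

/-- The image of `avg ρ ⊗ avg ρ'` consists of the invariants of the product group `G × G'`. -/
theorem map_avg_eq_iff {ρ : G →* Module.End R X} {ρ' : G' →* Module.End R X'}
    (hG : IsUnit (Fintype.card G : R)) (hG' : IsUnit (Fintype.card G' : R)) (z : X ⊗[R] X') :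
    TensorProduct.map (avg ρ) (avg ρ') z = z ↔
      ∀ g g', TensorProduct.map (ρ g) (ρ' g') z = z := by
  constructor
  · intro h g g'
    rw [← h]
    refine LinearMap.congr_fun (f := TensorProduct.map (ρ g) (ρ' g') ∘ₗ
      TensorProduct.map (avg ρ) (avg ρ')) ?_ z
    refine TensorProduct.ext' fun x y => ?_
    rw [LinearMap.comp_apply, TensorProduct.map_tmul, TensorProduct.map_tmul,
      mem_invts.1 (avg_mem ρ x), mem_invts.1 (avg_mem ρ' y)]
  · intro h
    have h1 : TensorProduct.map (avg ρ) (avg ρ') =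
        (Ring.inverse (Fintype.card G : R) * Ring.inverse (Fintype.card G' : R)) •
          ∑ g, ∑ g', TensorProduct.map (ρ g) (ρ' g') := by
      refine TensorProduct.ext' fun x y => ?_
      simp only [TensorProduct.map_tmul, avg_apply, LinearMap.smul_apply, LinearMap.sum_apply,
        TensorProduct.smul_tmul_smul, TensorProduct.sum_tmul, TensorProduct.tmul_sum]
      rw [Finset.sum_comm]
    rw [h1]
    simp only [LinearMap.smul_apply, LinearMap.sum_apply, h, Finset.sum_const, Finset.card_univ]
    rw [← Nat.cast_smul_eq_nsmul R, ← Nat.cast_smul_eq_nsmul R, smul_smul, smul_smul]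
    have h2 := Ring.inverse_mul_cancel _ hG
    have h3 := Ring.inverse_mul_cancel _ hG'
    rw [show Ring.inverse (Fintype.card G : R) * Ring.inverse (Fintype.card G' : R) *
      (Fintype.card G : R) * (Fintype.card G' : R) = 1 by
        linear_combination (Ring.inverse (Fintype.card G' : R) * (Fintype.card G' : R)) * h2 + h3,
      one_smul]

end Invariants

/-! ### Antisymmetric tensors and exterior powers -/

section Antisymmetric

theorem isUnit_card_subgroup {n : ℕ} (hn : IsUnit ((n.factorial : ℕ) : R))
    (H : Subgroup (Equiv.Perm (Fin n))) [Fintype H] : IsUnit (Fintype.card H : R) := by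
  refine isUnit_of_dvd_unit (Nat.cast_dvd_cast ?_) hn
  have h1 := Subgroup.card_subgroup_dvd_card H
  rwa [Nat.card_eq_fintype_card, Nat.card_eq_fintype_card, Fintype.card_perm,
    Fintype.card_fin] at h1

variable [Invertible (2 : R)] (E : CliffMod Q) {n : ℕ}

/-- The representation of the symmetric group on the tensor power, twisted by the signature. -/
def signPerm (n : ℕ) : Equiv.Perm (Fin n) →* Module.End R (⨂[R] _ : Fin n, E.carrier) where
  toFun g := ((Equiv.Perm.sign g : ℤ) : R) • E.perm g
  map_one' := by simp [perm_one]
  map_mul' g g' := by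
    rw [perm_mul, map_mul, smul_mul_smul_comm]
    push_cast
    rfl

theorem signPerm_apply (g : Equiv.Perm (Fin n)) (x : ⨂[R] _ : Fin n, E.carrier) :
    E.signPerm n g x = ((Equiv.Perm.sign g : ℤ) : R) • E.perm g x := rfl

theorem signPerm_inv_apply (g : Equiv.Perm (Fin n)) (x : ⨂[R] _ : Fin n, E.carrier) :
    E.signPerm n g⁻¹ (E.signPerm n g x) = x := by
  rw [← Module.End.mul_apply, ← map_mul, inv_mul_cancel, map_one, Module.End.one_apply]

theorem isMor_signPerm (h : ∀ v, Q' v = n • Q v) (g : Equiv.Perm (Fin n)) :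
    IsMor (E.power n h) (E.power n h) (E.signPerm n g) :=
  (isMor_perm E h g).smul _

/-- The tensors which are antisymmetric under the subgroup `H` of the symmetric group. -/
def altSub (H : Subgroup (Equiv.Perm (Fin n))) : Submodule R (⨂[R] _ : Fin n, E.carrier) :=
  invts ((E.signPerm n).comp H.subtype)

variable {E}

theorem mem_altSub {H : Subgroup (Equiv.Perm (Fin n))} {x : ⨂[R] _ : Fin n, E.carrier} :
    x ∈ E.altSub H ↔ ∀ g ∈ H, E.signPerm n g x = x := by
  rw [altSub, mem_invts]
  exact ⟨fun h g hg => h ⟨g, hg⟩, fun h g => h g g.2⟩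

theorem stable_altSub (h : ∀ v, Q' v = n • Q v) (H : Subgroup (Equiv.Perm (Fin n))) :
    (E.power n h).Stable (E.altSub H) :=
  Stable.invts (M := E.power n h) fun g => isMor_signPerm E h g

theorem subFGP_altSub [Module.Finite R V] [Module.Projective R V] (hE : E.IsFGP) (hn0 : 0 < n)
    (hn : IsUnit ((n.factorial : ℕ) : R)) (h : ∀ v, Q' v = n • Q v)
    (H : Subgroup (Equiv.Perm (Fin n))) : (E.power n h).SubFGP (E.altSub H) := by
  classical
  exact subFGP_invts (hE.power hn0 h) (fun g => isMor_signPerm E h g) (isUnit_card_subgroup hn H)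

/-- If `n!` is invertible, the exterior power is the module of antisymmetric tensors. -/
theorem lambda_isFGP_and_cls [Module.Finite R V] [Module.Projective R V] (hE : E.IsFGP)
    (hn0 : 0 < n) (hn : IsUnit ((n.factorial : ℕ) : R)) (h : ∀ v, Q' v = n • Q v) :
    (E.lambda n h).IsFGP ∧ (E.lambda n h).cls = (E.power n h).subCls (E.altSub ⊤) := by
  classical
  have hcard : IsUnit (Fintype.card (Equiv.Perm (Fin n)) : R) := by
    rwa [Fintype.card_perm, Fintype.card_fin]
  have hmem : ∀ x, avg (E.signPerm n) x ∈ E.altSub (⊤ : Subgroup (Equiv.Perm (Fin n))) :=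
    fun x => mem_altSub.2 fun g _ => mem_invts.1 (avg_mem (E.signPerm n) x) g
  have hfix : ∀ x ∈ E.altSub (⊤ : Subgroup (Equiv.Perm (Fin n))), avg (E.signPerm n) x = x :=
    fun x hx => avg_of_mem hcard (mem_invts.2 fun g => mem_altSub.1 hx g trivial)
  have hker : E.extRel n ≤ LinearMap.ker
      ((avg (E.signPerm n)).codRestrict (E.altSub ⊤) hmem) := by
    rw [extRel, Submodule.span_le]
    rintro _ ⟨σ, m, rfl⟩
    refine LinearMap.mem_ker.2 (Subtype.ext ?_)
    change avg (E.signPerm n) (m - E.signPerm n σ m) = 0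
    rw [map_sub, avg_apply_rep, sub_self]
  have hrel : ∀ x, avg (E.signPerm n) x - x ∈ E.extRel n := by
    intro x
    have h1 : avg (E.signPerm n) x - x = -(Ring.inverse (Fintype.card (Equiv.Perm (Fin n)) : R) •
        ∑ g, (x - E.signPerm n g x)) := by
      rw [Finset.sum_sub_distrib, smul_sub, ← avg_apply, Finset.sum_const, Finset.card_univ,
        ← Nat.cast_smul_eq_nsmul R, smul_smul, Ring.inverse_mul_cancel _ hcard, one_smul, neg_sub]
    rw [h1]
    exact neg_mem (Submodule.smul_mem _ _ (sum_mem fun g _ => Submodule.subset_span ⟨g, x, rfl⟩))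
  -- averaging induces the inverse of the map from the antisymmetric tensors to the quotient
  let e : Iso ((E.power n h).ofStable (E.altSub ⊤) (stable_altSub h ⊤)) (E.lambda n h) :=
    { toEquiv := LinearEquiv.ofLinearMap ((E.extRel n).mkQ ∘ₗ (E.altSub ⊤).subtype)
        ((E.extRel n).liftQ _ hker)
        (by
          refine Submodule.linearMap_qext _ (LinearMap.ext fun x => ?_)
          exact (Submodule.Quotient.eq _).2 (hrel x))
        (by
          refine LinearMap.ext fun x => Subtype.ext ?_
          exact hfix x x.2)
      map_act := fun a x => rfl
      map_gr := fun x => rfl }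
  obtain ⟨h1, h2⟩ := subFGP_altSub hE hn0 hn h ⊤
  exact ⟨e.isFGP h2, by rw [subCls_eq h1]; exact e.cls_eq.symm⟩

/-- Conjugate subgroups have isomorphic modules of antisymmetric tensors. -/
theorem subCls_altSub_conj (h : ∀ v, Q' v = n • Q v) {H H' : Subgroup (Equiv.Perm (Fin n))}
    (g : Equiv.Perm (Fin n)) (hH : ∀ x, x ∈ H' ↔ g * x * g⁻¹ ∈ H) :
    (E.power n h).subCls (E.altSub H) = (E.power n h).subCls (E.altSub H') := by
  refine subCls_congr (stable_altSub h H) (stable_altSub h H') (E.signPerm n g⁻¹)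
    (isMor_signPerm E h _) (E.signPerm n g) (fun x hx => ?_) (fun y hy => ?_)
    (fun x _ => by simp) (fun y _ => E.signPerm_inv_apply g y)
  · refine mem_altSub.2 fun a ha => ?_
    have h1 := mem_altSub.1 hx _ ((hH a).1 ha)
    conv_rhs => rw [← h1]
    rw [← Module.End.mul_apply, ← map_mul, ← Module.End.mul_apply, ← map_mul]
    congr 2
    group
  · refine mem_altSub.2 fun a ha => ?_
    have h1 := mem_altSub.1 hy (g⁻¹ * a * g) ((hH _).2 (by
      rwa [show g * (g⁻¹ * a * g) * g⁻¹ = a by group]))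
    conv_rhs => rw [← h1]
    rw [← Module.End.mul_apply, ← map_mul, ← Module.End.mul_apply, ← map_mul]
    congr 2
    group

/-- The cup-product of classes of modules of antisymmetric tensors. -/
theorem cup_altSub [Module.Finite R V] [Module.Projective R V] (hE : E.IsFGP) {a b : ℕ}
    (ha : 0 < a) (hb : 0 < b) (hc : IsUnit ((a + b : ℕ) : R))
    (ha' : IsUnit ((a.factorial : ℕ) : R)) (hb' : IsUnit ((b.factorial : ℕ) : R))
    {H : Subgroup (Equiv.Perm (Fin a))} {H' : Subgroup (Equiv.Perm (Fin b))}
    {K : Subgroup (Equiv.Perm (Fin (a + b)))}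
    (hK : ∀ g, g ∈ K ↔ ∃ σ ∈ H, ∃ τ ∈ H', g = concat σ τ) :
    cup Q rfl hc ((E.power a fun _ => rfl).subCls (E.altSub H))
        ((E.power b fun _ => rfl).subCls (E.altSub H')) =
      (E.power (Q' := (a + b) • Q) (a + b) fun _ => rfl).subCls (E.altSub K) := by
  classical
  have hab := add_nsmul_apply Q (rfl : a + b = a + b)
  have hcH := isUnit_card_subgroup ha' H
  have hcH' := isUnit_card_subgroup hb' H'
  let ρ := (E.signPerm a).comp H.subtype
  let ρ' := (E.signPerm b).comp H'.subtype
  have hρ : ∀ g, IsMor (E.power (Q' := a • Q) a fun _ => rfl) (E.power a fun _ => rfl) (ρ g) :=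
    fun g => isMor_signPerm E _ _
  have hρ' : ∀ g, IsMor (E.power (Q' := b • Q) b fun _ => rfl) (E.power b fun _ => rfl) (ρ' g) :=
    fun g => isMor_signPerm E _ _
  rw [cup_subCls Q rfl hc (subFGP_altSub hE ha ha' _ H) (subFGP_altSub hE hb hb' _ H')
    (avg ρ) (avg ρ') (IsMor.avg hρ) (IsMor.avg hρ') (fun x => avg_mem ρ x)
    (fun x => avg_mem ρ' x) (fun x hx => avg_of_mem hcH hx) (fun x hx => avg_of_mem hcH' hx)]
  have hconcat : ∀ σ τ z, E.signPerm (a + b) (concat σ τ) (TensorPower.mulEquiv z) =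
      TensorPower.mulEquiv (TensorProduct.map (E.signPerm a σ) (E.signPerm b τ) z) := by
    intro σ τ z
    have h1 : TensorProduct.map (E.signPerm a σ) (E.signPerm b τ) =
        (((Equiv.Perm.sign σ : ℤ) : R) * ((Equiv.Perm.sign τ : ℤ) : R)) •
          TensorProduct.map (E.perm σ) (E.perm τ) := by
      refine TensorProduct.ext' fun x y => ?_
      rw [TensorProduct.map_tmul, signPerm_apply, signPerm_apply, TensorProduct.smul_tmul_smul]
      rfl
    rw [h1, signPerm_apply, perm_concat, sign_concat, LinearMap.smul_apply, map_smul]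
    push_cast
    rfl
  have hiff : ∀ z, TensorPower.mulEquiv z ∈ E.altSub K ↔
      z ∈ Module.End.eigenspace (TensorProduct.map (avg ρ) (avg ρ')) (1 : R) := by
    intro z
    rw [Module.End.mem_eigenspace_iff, one_smul, map_avg_eq_iff hcH hcH', mem_altSub]
    constructor
    · intro h g g'
      have h2 := h _ ((hK _).2 ⟨g, g.2, g', g'.2, rfl⟩)
      rw [hconcat] at h2
      exact TensorPower.mulEquiv.injective h2
    · intro h g hg
      obtain ⟨σ, hσ, τ, hτ, rfl⟩ := (hK g).1 hg
      rw [hconcat]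
      exact congrArg _ (h ⟨σ, hσ⟩ ⟨τ, hτ⟩)
  refine subCls_congr (Stable.eigenspace (IsMor.tensor hab (IsMor.avg hρ) (IsMor.avg hρ')) 1)
    (stable_altSub _ K) _
    (isMor_mulEquiv E (fun _ => rfl) (fun _ => rfl) (fun _ => rfl) hab)
    TensorPower.mulEquiv.symm (fun x hx => (hiff x).2 hx) (fun y hy => (hiff _).1 ?_)
    (fun x _ => TensorPower.mulEquiv.symm_apply_apply x)
    (fun y _ => TensorPower.mulEquiv.apply_symm_apply y)
  rwa [LinearEquiv.apply_symm_apply]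

end Antisymmetric

/-! ### Commutativity of the cup-product -/

section Commutativity

theorem isMor_assoc {Q₁₂ Q₂₃ Q₁₂₃ : QuadraticForm R V} (h₁ : ∀ v, Q₁₂ v = Q₁ v + Q₂ v)
    (h₂ : ∀ v, Q₂₃ v = Q₂ v + Q₃ v) (h₃ : ∀ v, Q₁₂₃ v = Q₁₂ v + Q₃ v)
    (h₄ : ∀ v, Q₁₂₃ v = Q₁ v + Q₂₃ v) (A : CliffMod Q₁) (B : CliffMod Q₂) (C : CliffMod Q₃) :
    IsMor (tensor h₃ (tensor h₁ A B) C) (tensor h₄ A (tensor h₂ B C))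
      (TensorProduct.assoc R A.carrier B.carrier C.carrier).toLinearMap := by
  constructor
  · intro v z
    refine LinearMap.congr_fun
      (f := (TensorProduct.assoc R A.carrier B.carrier C.carrier).toLinearMap ∘ₗ
        (tensor h₃ (tensor h₁ A B) C).act (ι Q₁₂₃ v))
      (g := (tensor h₄ A (tensor h₂ B C)).act (ι Q₁₂₃ v) ∘ₗ
        (TensorProduct.assoc R A.carrier B.carrier C.carrier).toLinearMap) ?_ z
    refine TensorProduct.ext_threefold fun x y z => ?_
    have e1 := tensor_act_ι h₃ (tensor h₁ A B) C v (x ⊗ₜ[R] y) z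
    have e2 := tensor_act_ι h₁ A B v x y
    have e3 := tensor_act_ι h₄ A (tensor h₂ B C) v x (y ⊗ₜ[R] z)
    have e4 := tensor_act_ι h₂ B C v y z
    rw [LinearMap.comp_apply, LinearMap.comp_apply, LinearEquiv.coe_coe, TensorProduct.assoc_tmul]
    refine (congrArg (TensorProduct.assoc R A.carrier B.carrier C.carrier) e1).trans
      (Eq.trans ?_ e3.symm)
    rw [e2, e4, map_add, TensorProduct.add_tmul, map_add, TensorProduct.tmul_add, add_assoc]
    rfl
  · intro z
    refine LinearMap.congr_fun
      (f := (TensorProduct.assoc R A.carrier B.carrier C.carrier).toLinearMap ∘ₗ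
        (tensor h₃ (tensor h₁ A B) C).gr)
      (g := (tensor h₄ A (tensor h₂ B C)).gr ∘ₗ
        (TensorProduct.assoc R A.carrier B.carrier C.carrier).toLinearMap) ?_ z
    exact TensorProduct.ext_threefold fun x y z => rfl

theorem IsMor.symm {M N : CliffMod Q} {e : M.carrier ≃ₗ[R] N.carrier}
    (he : IsMor M N e.toLinearMap) : IsMor N M e.symm.toLinearMap := by
  refine ⟨fun v x => e.injective ?_, fun x => e.injective ?_⟩
  · refine (e.apply_symm_apply _).trans (Eq.trans ?_ (he.1 v _).symm)
    exact congrArg (N.act (ι Q v)) (e.apply_symm_apply x).symm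
  · refine (e.apply_symm_apply _).trans (Eq.trans ?_ (he.2 _).symm)
    exact congrArg N.gr (e.apply_symm_apply x).symm

theorem cls_eq_of_isMor {M N : CliffMod Q} (f : M.carrier →ₗ[R] N.carrier) (hf : IsMor M N f)
    (g : N.carrier → M.carrier) (hl : ∀ x, g (f x) = x) (hr : ∀ y, f (g y) = y) :
    M.cls = N.cls := by
  rw [← subCls_top, ← subCls_top]
  exact subCls_congr Stable.top Stable.top f hf g (fun _ _ => trivial) (fun _ _ => trivial)
    (fun x _ => hl x) (fun y _ => hr y)

theorem GrK.induction_cls {p : GrK Q → Prop} (h0 : p 0) (hadd : ∀ x y, p x → p y → p (x + y))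
    (hneg : ∀ x, p x → p (-x)) (hcls : ∀ M : CliffMod Q, M.IsFGP → p M.cls) (x : GrK Q) : p x := by
  obtain ⟨x, rfl⟩ := QuotientAddGroup.mk'_surjective (grKRel Q) x
  induction x using FreeAbelianGroup.induction_on with
  | zero => exact h0
  | of M =>
    have h := hcls M.1 M.2
    rw [cls_eq M.1 M.2] at h
    exact h
  | neg M h => exact hneg _ h
  | add x y hx hy => exact hadd _ _ hx hy

variable [Invertible (2 : R)]

theorem isMor_swap (h : ∀ v, Q₃ v = Q₁ v + Q₂ v) (h' : ∀ v, Q₃ v = Q₂ v + Q₁ v) (M : CliffMod Q₁)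
    (N : CliffMod Q₂) : IsMor (tensor h M N) (tensor h' N M) (swap M N) := by
  refine ⟨swap_act h h' M N, fun z => ?_⟩
  refine LinearMap.congr_fun (f := swap M N ∘ₗ (tensor h M N).gr)
    (g := (tensor h' N M).gr ∘ₗ swap M N) ?_ z
  refine TensorProduct.ext' fun x y => ?_
  change swap M N (M.gr x ⊗ₜ N.gr y) = TensorProduct.map N.gr M.gr (swap M N (x ⊗ₜ y))
  rw [swap_tmul, swap_tmul]
  simp

variable [Module.Finite R V] [Module.Projective R V]

theorem cup_comm (Q : QuadraticForm R V) {a b n : ℕ} (h : a + b = n) (h' : b + a = n)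
    (hn : IsUnit (n : R)) (x : GrK (a • Q)) (y : GrK (b • Q)) :
    cup Q h hn x y = cup Q h' hn y x := by
  induction x using GrK.induction_cls with
  | h0 => simp
  | hadd x x' hx hx' => simp only [map_add, LinearMap.add_apply, hx, hx']
  | hneg x hx => simp only [map_neg, LinearMap.neg_apply, hx]
  | hcls A hA =>
    induction y using GrK.induction_cls with
    | h0 => simp
    | hadd x x' hx hx' => simp only [map_add, LinearMap.add_apply, hx, hx']
    | hneg x hx => simp only [map_neg, LinearMap.neg_apply, hx]
    | hcls B hB =>
      rw [cup_cls Q h hn A B hA hB, cup_cls Q h' hn B A hB hA]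
      exact cls_eq_of_isMor (swap A B) (isMor_swap _ _ A B) (swap B A) (swap_swap A B)
        (swap_swap B A)

theorem cup_left_comm (Q : QuadraticForm R V) {a b c m m' n : ℕ} (h₁ : a + m = n) (h₂ : b + c = m)
    (h₃ : b + m' = n) (h₄ : a + c = m') (hn : IsUnit (n : R)) (hm : IsUnit (m : R))
    (hm' : IsUnit (m' : R)) (x : GrK (a • Q)) (y : GrK (b • Q)) (z : GrK (c • Q)) :
    cup Q h₁ hn x (cup Q h₂ hm y z) = cup Q h₃ hn y (cup Q h₄ hm' x z) := by
  induction x using GrK.induction_cls with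
  | h0 => simp
  | hadd x x' hx hx' => simp only [map_add, LinearMap.add_apply, hx, hx']
  | hneg x hx => simp only [map_neg, LinearMap.neg_apply, hx]
  | hcls A hA =>
  induction y using GrK.induction_cls with
  | h0 => simp
  | hadd x x' hx hx' => simp only [map_add, LinearMap.add_apply, hx, hx']
  | hneg x hx => simp only [map_neg, LinearMap.neg_apply, hx]
  | hcls B hB =>
  induction z using GrK.induction_cls with
  | h0 => simp
  | hadd x x' hx hx' => simp only [map_add, hx, hx']
  | hneg x hx => simp only [map_neg, hx]
  | hcls C hC =>
    rw [cup_cls Q h₂ hm B C hB hC, cup_cls Q h₄ hm' A C hA hC,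
      cup_cls Q h₁ hn A _ hA (IsFGP.tensor' _ hB hC), cup_cls Q h₃ hn B _ hB (IsFGP.tensor' _ hA hC)]
    have hs : ∀ v, ((a + b) • Q) v = (b • Q) v + (a • Q) v := add_nsmul_apply Q (add_comm b a)
    have hs' : ∀ v, ((a + b) • Q) v = (a • Q) v + (b • Q) v := add_nsmul_apply Q rfl
    have ht : ∀ v, (n • Q) v = ((a + b) • Q) v + (c • Q) v := add_nsmul_apply Q (by omega)
    have m1 := isMor_assoc hs' (add_nsmul_apply Q h₂) ht (add_nsmul_apply Q h₁) A B C
    have m2 := isMor_assoc hs (add_nsmul_apply Q h₄) ht (add_nsmul_apply Q h₃) B A C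
    have m3 := IsMor.tensor ht (isMor_swap hs' hs A B) (IsMor.id (M := C))
    have hss : ∀ {a b : ℕ} (A : CliffMod (a • Q)) (B : CliffMod (b • Q))
        (z : (A.carrier ⊗[R] B.carrier) ⊗[R] C.carrier),
        TensorProduct.map (swap B A) (LinearMap.id (R := R) (M := C.carrier))
        (TensorProduct.map (swap A B) LinearMap.id z) = z := fun A B z => by
      rw [← LinearMap.comp_apply, ← TensorProduct.map_comp, LinearMap.comp_id,
        show swap B A ∘ₗ swap A B = LinearMap.id from LinearMap.ext (swap_swap A B),
        TensorProduct.map_id, LinearMap.id_apply]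
    refine cls_eq_of_isMor _ (m2.comp (m3.comp m1.symm))
      (fun w => TensorProduct.assoc R A.carrier B.carrier C.carrier
        (TensorProduct.map (swap B A) LinearMap.id
          ((TensorProduct.assoc R B.carrier A.carrier C.carrier).symm w))) (fun w => ?_) fun w => ?_
    · simp only [LinearMap.comp_apply, LinearEquiv.coe_coe, LinearEquiv.symm_apply_apply]
      rw [hss, LinearEquiv.apply_symm_apply]
    · simp only [LinearMap.comp_apply, LinearEquiv.coe_coe, LinearEquiv.symm_apply_apply]
      rw [hss, LinearEquiv.apply_symm_apply]

end Commutativity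

/-! ### Products of exterior powers -/

/-- The polynomials `Q_n` in indeterminates `X 1, X 2, …`, which stand for the elementary symmetric
functions, defined by Newton's recursion. -/
def newtonPoly : ℕ → MvPolynomial ℕ ℤ
  | 0 => 0
  | m + 1 => (∑ i : Fin m, (-1 : ℤ) ^ (i : ℕ) •
      (MvPolynomial.X (i + 1 : ℕ) * newtonPoly (m - i))) +
    ((-1 : ℤ) ^ m * (m + 1 : ℕ)) • MvPolynomial.X (m + 1)

/-- The `n`-th elementary symmetric function, with value `1` for `n = 0`. -/
def elemPoly (n : ℕ) : MvPolynomial ℕ ℤ := if n = 0 then 1 else MvPolynomial.X n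

section Products

variable [Invertible (2 : R)] [Module.Finite R V] [Module.Projective R V] (E : CliffMod Q)

/-- The class of `λⁿ(E)`. -/
def lamCls (n : ℕ) : GrK (n • Q) := (E.lambda n fun _ => rfl).cls

/-- Multiplication by the class of `λᵃ(E)` in the truncated graded ring
`ℤ ⊕ K(C(V(1))) ⊕ K(C(V(2))) ⊕ ⋯`: the products in degrees greater than `k` are replaced by `0`.
By convention, `λ⁰(E)` acts as the identity. -/
def mulLam {k : ℕ} (hk : IsUnit ((k.factorial : ℕ) : R)) (a : ℕ) :
    (ℤ × ∀ n : ℕ, GrK (n • Q)) →ₗ[ℤ] (ℤ × ∀ n : ℕ, GrK (n • Q)) :=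
  if a = 0 then LinearMap.id else
    LinearMap.prod 0 (LinearMap.pi fun n =>
      (if n = a then (LinearMap.fst ℤ ℤ (∀ n : ℕ, GrK (n • Q))).smulRight (E.lamCls n) else 0) +
      if h : a < n ∧ n ≤ k then
        cup Q (a := a) (b := n - a) (c := n) (by omega)
          (isUnit_cast_of_factorial (by omega) h.2 hk) (E.lamCls a) ∘ₗ
            LinearMap.proj (n - a) ∘ₗ LinearMap.snd ℤ ℤ (∀ n : ℕ, GrK (n • Q))
      else 0)

variable {E} {k : ℕ} {hk : IsUnit ((k.factorial : ℕ) : R)}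

theorem mulLam_zero (g : ℤ × ∀ n : ℕ, GrK (n • Q)) : E.mulLam hk 0 g = g := by
  simp [mulLam]

theorem mulLam_fst {a : ℕ} (ha : a ≠ 0) (g : ℤ × ∀ n : ℕ, GrK (n • Q)) :
    (E.mulLam hk a g).1 = 0 := by
  simp [mulLam, ha]

theorem mulLam_self {a : ℕ} (ha : a ≠ 0) (g : ℤ × ∀ n : ℕ, GrK (n • Q)) :
    (E.mulLam hk a g).2 a = g.1 • E.lamCls a := by
  simp [mulLam, ha]

theorem mulLam_of_lt {a n : ℕ} (h : n < a) (g : ℤ × ∀ n : ℕ, GrK (n • Q)) :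
    (E.mulLam hk a g).2 n = 0 := by
  simp [mulLam, show a ≠ 0 by omega, show n ≠ a by omega, show ¬ (a < n ∧ n ≤ k) by omega]

theorem mulLam_add {a b n : ℕ} (ha : a ≠ 0) (hb : b ≠ 0) (h : a + b = n) (hn : n ≤ k)
    (hu : IsUnit (n : R)) (g : ℤ × ∀ n : ℕ, GrK (n • Q)) :
    (E.mulLam hk a g).2 n = cup Q h hu (E.lamCls a) (g.2 b) := by
  obtain rfl : b = n - a := by omega
  simp [mulLam, ha, show n ≠ a by omega, show a < n ∧ n ≤ k by omega]

theorem mulLam_of_gt {a n : ℕ} (ha : a ≠ 0) (hg : n ≠ a) (hn : k < n)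
    (g : ℤ × ∀ n : ℕ, GrK (n • Q)) : (E.mulLam hk a g).2 n = 0 := by
  simp [mulLam, ha, hg, show ¬ (a < n ∧ n ≤ k) by omega]

theorem mulLam_mulLam_of_lt {a b n : ℕ} (ha : a ≠ 0) (hb : b ≠ 0) (h : n < a + b)
    (g : ℤ × ∀ n : ℕ, GrK (n • Q)) : (E.mulLam hk a (E.mulLam hk b g)).2 n = 0 := by
  rcases lt_trichotomy n a with h1 | h1 | h1
  · exact mulLam_of_lt h1 _
  · subst h1
    rw [mulLam_self ha, mulLam_fst hb, zero_smul]
  · by_cases hn : n ≤ k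
    · rw [mulLam_add (b := n - a) ha (by omega) (by omega) hn
        (isUnit_cast_of_factorial (by omega) hn hk), mulLam_of_lt (by omega), map_zero]
    · exact mulLam_of_gt ha (by omega) (by omega) _

theorem mulLam_comm (a b : ℕ) (g : ℤ × ∀ n : ℕ, GrK (n • Q)) :
    E.mulLam hk a (E.mulLam hk b g) = E.mulLam hk b (E.mulLam hk a g) := by
  by_cases ha : a = 0
  · subst ha
    rw [mulLam_zero, mulLam_zero]
  by_cases hb : b = 0
  · subst hb
    rw [mulLam_zero, mulLam_zero]
  refine Prod.ext ((mulLam_fst ha _).trans (mulLam_fst hb _).symm) (funext fun n => ?_)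
  rcases lt_or_ge n (a + b) with h1 | h1
  · rw [mulLam_mulLam_of_lt ha hb h1, mulLam_mulLam_of_lt hb ha (by omega)]
  by_cases hn : n ≤ k
  swap
  · rw [mulLam_of_gt ha (by omega) (by omega), mulLam_of_gt hb (by omega) (by omega)]
  have hu : ∀ m, m ≠ 0 → m ≤ n → IsUnit (m : R) := fun m h h' =>
    isUnit_cast_of_factorial (Nat.pos_of_ne_zero h) (h'.trans hn) hk
  rcases h1.eq_or_lt with rfl | h2
  · rw [mulLam_add ha hb rfl hn (hu _ (by omega) le_rfl),
      mulLam_add hb ha (add_comm b a) hn (hu _ (by omega) le_rfl),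
      mulLam_self ha, mulLam_self hb, map_smul, map_smul, cup_comm]
  obtain ⟨c, rfl⟩ := Nat.exists_eq_add_of_le h1
  have hc : c ≠ 0 := by omega
  rw [mulLam_add (b := b + c) ha (by omega) (by omega) hn (hu _ (by omega) le_rfl),
    mulLam_add (b := a + c) hb (by omega) (by omega) hn (hu _ (by omega) le_rfl),
    mulLam_add hb hc rfl (by omega) (hu _ (by omega) (by omega)),
    mulLam_add ha hc rfl (by omega) (hu _ (by omega) (by omega)), cup_left_comm]

instance : LeftCommutative fun (a : ℕ) (g : ℤ × ∀ n : ℕ, GrK (n • Q)) => E.mulLam hk a g :=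
  ⟨mulLam_comm⟩

variable (E hk)

/-- The evaluation of polynomials in the exterior powers of `E`: the indeterminate `X a` acts as
multiplication by `λᵃ(E)`. -/
def lamEval : MvPolynomial ℕ ℤ →ₗ[ℤ] (ℤ × ∀ n : ℕ, GrK (n • Q)) :=
  (MvPolynomial.basisMonomials ℕ ℤ).constr ℤ fun d =>
    Multiset.foldr (fun a g => E.mulLam hk a g) (1, 0) (Finsupp.toMultiset d)

variable {E hk}

theorem lamEval_monomial (d : ℕ →₀ ℕ) : E.lamEval hk (MvPolynomial.monomial d 1) =
    Multiset.foldr (fun a g => E.mulLam hk a g) (1, 0) (Finsupp.toMultiset d) := by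
  have h := (MvPolynomial.basisMonomials ℕ ℤ).constr_basis ℤ (fun d =>
    Multiset.foldr (fun a g => E.mulLam hk a g) (1, 0) (Finsupp.toMultiset d)) d
  rwa [MvPolynomial.coe_basisMonomials] at h

theorem lamEval_one : E.lamEval hk 1 = (1, 0) := by
  refine (lamEval_monomial 0).trans ?_
  simp

theorem lamEval_X_mul (a : ℕ) (x : MvPolynomial ℕ ℤ) :
    E.lamEval hk (MvPolynomial.X a * x) = E.mulLam hk a (E.lamEval hk x) := by
  have h : E.lamEval hk ∘ₗ LinearMap.mulLeft ℤ (MvPolynomial.X a) =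
      E.mulLam hk a ∘ₗ E.lamEval hk := by
    refine (MvPolynomial.basisMonomials ℕ ℤ).ext fun d => ?_
    rw [MvPolynomial.coe_basisMonomials, LinearMap.comp_apply, LinearMap.comp_apply,
      LinearMap.mulLeft_apply, MvPolynomial.X, MvPolynomial.monomial_mul, one_mul,
      lamEval_monomial, lamEval_monomial, map_add, Finsupp.toMultiset_single, one_smul,
      Multiset.singleton_add, Multiset.foldr_cons]
  exact LinearMap.congr_fun h x

theorem lamEval_elemPoly_mul (a : ℕ) (x : MvPolynomial ℕ ℤ) :
    E.lamEval hk (elemPoly a * x) = E.mulLam hk a (E.lamEval hk x) := by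
  unfold elemPoly
  split_ifs with h
  · rw [h, mulLam_zero, one_mul]
  · exact lamEval_X_mul a x

/-- The Adams operation is the value of the Newton polynomial at the exterior powers. -/
theorem lamEval_newtonPoly (n : ℕ) (hn : n ≤ k) (hn' : IsUnit ((n.factorial : ℕ) : R)) :
    (E.lamEval hk (newtonPoly n)).2 n = E.adams n hn' := by
  induction n using Nat.strong_induction_on with
  | _ n ih =>
    cases n with
    | zero => rw [newtonPoly, adams, map_zero]; rfl
    | succ m =>
      rw [newtonPoly, adams, map_add, map_sum, map_smul]
      rw [Prod.snd_add, Pi.add_apply, Prod.snd_sum, Finset.sum_apply]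
      congr 1
      · refine Finset.sum_congr rfl fun i _ => ?_
        rw [map_smul, lamEval_X_mul, Prod.smul_snd, Pi.smul_apply,
          mulLam_add (b := m - i) (by omega) (by omega) (by omega) hn
            (isUnit_cast_of_factorial m.succ_pos le_rfl hn'),
          ih (m - i) (by omega) (by omega) (isUnit_factorial_of_le (by omega) hn')]
        rfl
      · rw [Prod.smul_snd, Pi.smul_apply, ← mul_one (MvPolynomial.X (m + 1)), lamEval_X_mul,
          mulLam_self (by omega), lamEval_one, one_smul]
        rfl

variable (E hk) in
/-- The component of degree `n` of `lamEval`, with coefficients extended to `Ω_m`. -/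
def lamEvalOmega (m n : ℕ) : MvPolynomial ℕ (Omega m) →+ GrK (n • Q) ⊗[ℤ] Omega m where
  toFun x := ∑ d ∈ x.support, (E.lamEval hk (MvPolynomial.monomial d 1)).2 n ⊗ₜ[ℤ] x.coeff d
  map_zero' := by simp
  map_add' x y := by
    classical
    have h : ∀ (z : MvPolynomial ℕ (Omega m)) (s : Finset (ℕ →₀ ℕ)), z.support ⊆ s →
        ∑ d ∈ z.support, (E.lamEval hk (MvPolynomial.monomial d 1)).2 n ⊗ₜ[ℤ] z.coeff d =
        ∑ d ∈ s, (E.lamEval hk (MvPolynomial.monomial d 1)).2 n ⊗ₜ[ℤ] z.coeff d :=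
      fun z s hs => Finset.sum_subset hs fun d _ hd => by
        rw [MvPolynomial.notMem_support_iff.1 hd, TensorProduct.tmul_zero]
    rw [h x _ Finset.subset_union_left, h y _ Finset.subset_union_right,
      h (x + y) _ MvPolynomial.support_add, ← Finset.sum_add_distrib]
    simp only [MvPolynomial.coeff_add, TensorProduct.tmul_add]

theorem lamEvalOmega_C_mul_map (m n : ℕ) (c : Omega m) (p : MvPolynomial ℕ ℤ) :
    E.lamEvalOmega hk m n (MvPolynomial.C c * MvPolynomial.map (Int.castRingHom (Omega m)) p) =
      (E.lamEval hk p).2 n ⊗ₜ[ℤ] c := by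
  classical
  induction p using MvPolynomial.induction_on' with
  | monomial d z =>
    rw [MvPolynomial.map_monomial, MvPolynomial.C_mul_monomial]
    have h1 : MvPolynomial.monomial d z = z • MvPolynomial.monomial d (1 : ℤ) := by
      rw [MvPolynomial.smul_monomial, smul_eq_mul, mul_one]
    rw [h1, map_smul, Prod.smul_snd, Pi.smul_apply, TensorProduct.smul_tmul]
    change ∑ d' ∈ (MvPolynomial.monomial d _).support, _ ⊗ₜ[ℤ] (MvPolynomial.monomial d _).coeff d'
      = _
    have h2 : z • c = c * (Int.castRingHom (Omega m)) z := by
      rw [zsmul_eq_mul, mul_comm]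
      rfl
    rw [h2]
    by_cases h3 : c * (Int.castRingHom (Omega m)) z = 0
    · rw [h3, map_zero, MvPolynomial.support_zero, Finset.sum_empty, TensorProduct.tmul_zero]
    · rw [MvPolynomial.support_monomial, if_neg h3, Finset.sum_singleton,
        MvPolynomial.coeff_monomial, if_pos rfl]
  | add p q hp hq =>
    rw [map_add, mul_add, map_add, hp, hq, map_add, Prod.snd_add, Pi.add_apply,
      TensorProduct.add_tmul]

end Products

/-! ### Antisymmetric tensors under Young subgroups -/

section Young

/-- The Young subgroup of the permutations which preserve the map `f`. -/
def stab {n : ℕ} {κ : Type*} (f : Fin n → κ) : Subgroup (Equiv.Perm (Fin n)) where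
  carrier := {g | ∀ i, f (g i) = f i}
  mul_mem' {g g'} hg hg' i := (hg (g' i)).trans (hg' i)
  one_mem' _ := rfl
  inv_mem' {g} hg i := by
    have h := hg (g⁻¹ i)
    rw [← Equiv.Perm.mul_apply, mul_inv_cancel] at h
    exact h.symm

theorem mem_stab {n : ℕ} {κ : Type*} {f : Fin n → κ} {g : Equiv.Perm (Fin n)} :
    g ∈ stab f ↔ ∀ i, f (g i) = f i := Iff.rfl

/-- The numbers of elements of the fibres of a map. -/
def content {n : ℕ} {κ : Type*} [DecidableEq κ] (f : Fin n → κ) (j : κ) : ℕ :=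
  (Finset.univ.filter fun i => f i = j).card

theorem content_eq_sum {n : ℕ} {κ : Type*} [DecidableEq κ] (f : Fin n → κ) (j : κ) :
    content f j = ∑ i, if f i = j then 1 else 0 := Finset.card_filter _ _

theorem content_comp {n : ℕ} {κ : Type*} [DecidableEq κ] (f : Fin n → κ)
    (g : Equiv.Perm (Fin n)) (j : κ) : content (fun i => f (g i)) j = content f j := by
  rw [content_eq_sum, content_eq_sum]
  exact Equiv.sum_comp g fun i => if f i = j then 1 else 0

/-- The permutations which preserve the decomposition of `a + b` places into `a` and `b` places. -/
theorem exists_eq_concat {a b : ℕ} (g : Equiv.Perm (Fin (a + b)))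
    (hg : ∀ i : Fin a, ∃ j : Fin a, g (Fin.castAdd b i) = Fin.castAdd b j) :
    ∃ σ τ, g = concat σ τ := by
  have h1 : finSumFinEquiv.symm.permCongr g ∈
      (Equiv.Perm.sumCongrHom (Fin a) (Fin b)).range := by
    refine Equiv.Perm.mem_sumCongrHom_range_of_perm_mapsTo_inl ?_
    rintro _ ⟨i, rfl⟩
    obtain ⟨j, hj⟩ := hg i
    exact ⟨j, by simp [Equiv.permCongr_apply, hj]⟩
  obtain ⟨⟨σ, τ⟩, h2⟩ := h1
  refine ⟨σ, τ, ?_⟩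
  refine (Equiv.symm_apply_eq _).1 ?_
  rw [Equiv.permCongr_symm]
  exact h2.symm

theorem exists_perm_append {a b : ℕ} {κ : Type*} [DecidableEq κ] (f : Fin (a + b) → κ) (c : κ)
    (hf : content f c = a) : ∃ g : Equiv.Perm (Fin (a + b)),
      (∀ i, f (g (Fin.castAdd b i)) = c) ∧ ∀ i, f (g (Fin.natAdd a i)) ≠ c := by
  have h1 : Fintype.card {i // f i = c} = a := by exact (Fintype.card_subtype _).trans hf
  have h2 : Fintype.card {i // ¬ f i = c} = b := by
    rw [Fintype.card_subtype_compl, h1, Fintype.card_fin, Nat.add_sub_cancel_left]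
  let e : Fin (a + b) ≃ Fin (a + b) := finSumFinEquiv.symm.trans
    ((Equiv.sumCongr (Fintype.equivFinOfCardEq h1).symm (Fintype.equivFinOfCardEq h2).symm).trans
      (Equiv.sumCompl fun i => f i = c))
  refine ⟨e, fun i => ?_, fun i => ?_⟩
  · simp only [e, Equiv.trans_apply, finSumFinEquiv_symm_apply_castAdd, Equiv.sumCongr_apply,
      Sum.map_inl, Equiv.sumCompl_apply_inl]
    exact ((Fintype.equivFinOfCardEq h1).symm i).2
  · simp only [e, Equiv.trans_apply, finSumFinEquiv_symm_apply_natAdd, Equiv.sumCongr_apply,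
      Sum.map_inr, Equiv.sumCompl_apply_inr]
    exact ((Fintype.equivFinOfCardEq h2).symm i).2

variable [Invertible (2 : R)] [Module.Finite R V] [Module.Projective R V] {E : CliffMod Q}

/-- The module of tensors antisymmetric under the Young subgroup of `f` has as its class the product
of the exterior powers `λ^{n_j}(E)`, where the `n_j` are the numbers of elements of the fibres. -/
theorem subCls_altSub_stab (hE : E.IsFGP) {k : ℕ} (hk : IsUnit ((k.factorial : ℕ) : R)) {m : ℕ} :
    ∀ {n : ℕ} (_ : 0 < n) (_ : n ≤ k) (f : Fin n → Fin m),
      (E.power (Q' := n • Q) n fun _ => rfl).subCls (E.altSub (stab f)) =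
        (E.lamEval hk (∏ j, elemPoly (content f j))).2 n := by
  induction m with
  | zero => exact fun {n} hn0 _ f => (f ⟨0, hn0⟩).elim0
  | succ m ih =>
    intro n hn0 hn f
    rw [Fin.prod_univ_succ, lamEval_elemPoly_mul]
    by_cases h0 : ∀ i, f i = 0
    · have h1 : stab f = ⊤ := by
        refine top_le_iff.1 fun g _ => mem_stab.2 fun i => ?_
        rw [h0, h0]
      have h2 : content f 0 = n := by simp [content, h0]
      have h3 : ∀ j : Fin m, elemPoly (content f j.succ) = 1 := by
        intro j
        have : content f j.succ = 0 := by simp [content, h0, (Fin.succ_ne_zero j).symm]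
        rw [this, elemPoly, if_pos rfl]
      simp only [h3, Finset.prod_const_one]
      rw [h2, mulLam_self hn0.ne', lamEval_one, one_smul, h1]
      exact (lambda_isFGP_and_cls hE hn0 (isUnit_factorial_of_le hn hk) _).2.symm
    by_cases h1 : ∀ i, f i ≠ 0
    · have h2 : content f 0 = 0 := by simp [content, h1]
      have h3 : stab f = stab fun i => (f i).pred (h1 i) := by
        ext g
        simp only [mem_stab, Fin.pred_inj]
      have h4 : ∀ j : Fin m, content f j.succ = content (fun i => (f i).pred (h1 i)) j := by
        intro j
        simp only [content, Fin.pred_eq_iff_eq_succ]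
      rw [h2, mulLam_zero, h3, ih hn0 hn]
      simp only [h4]
    obtain ⟨i₀, hi₀⟩ := not_forall.1 h0
    obtain ⟨i₁, hi₁⟩ := not_forall_not.1 h1
    obtain ⟨a, ha⟩ : ∃ a, content f 0 = a := ⟨_, rfl⟩
    have ha0 : a ≠ 0 := by
      rintro rfl
      exact Finset.notMem_empty i₁
        (Finset.card_eq_zero.1 ha ▸ Finset.mem_filter.2 ⟨Finset.mem_univ _, hi₁⟩)
    have han : a < n := by
      have h2 : content f 0 < Fintype.card (Fin n) :=
        Finset.card_lt_univ_of_notMem (x := i₀) (by simpa using hi₀)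
      rwa [ha, Fintype.card_fin] at h2
    obtain ⟨b, rfl⟩ := Nat.exists_eq_add_of_le han.le
    have hb : 0 < b := by omega
    obtain ⟨g, hg, hg'⟩ := exists_perm_append f 0 ha
    let f' : Fin b → Fin m := fun i => (f (g (Fin.natAdd a i))).pred (hg' i)
    have hf' : ∀ i, f (g (Fin.natAdd a i)) = (f' i).succ := fun i => (Fin.succ_pred _ _).symm
    have hu : IsUnit ((a + b : ℕ) : R) := isUnit_cast_of_factorial hn0 hn hk
    have hK : ∀ x, x ∈ stab (fun i => f (g i)) ↔
        ∃ σ ∈ (⊤ : Subgroup (Equiv.Perm (Fin a))), ∃ τ ∈ stab f', x = concat σ τ := by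
      intro x
      constructor
      · intro hx
        obtain ⟨σ, τ, rfl⟩ := exists_eq_concat x fun i => by
          have h2 : f (g (x (Fin.castAdd b i))) = 0 := (hx _).trans (hg i)
          revert h2
          refine Fin.addCases (fun j _ => ⟨j, rfl⟩) (fun j h2 => (hg' j h2).elim)
            (x (Fin.castAdd b i))
        refine ⟨σ, trivial, τ, fun i => ?_, rfl⟩
        have h2 := hx (Fin.natAdd a i)
        beta_reduce at h2
        rw [concat_natAdd, hf', hf'] at h2
        exact Fin.succ_injective _ h2
      · rintro ⟨σ, -, τ, hτ, rfl⟩ i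
        beta_reduce
        refine Fin.addCases (fun i => ?_) (fun i => ?_) i
        · rw [concat_castAdd, hg, hg]
        · rw [concat_natAdd, hf', hf', hτ i]
    have hcont : ∀ j : Fin m, content f j.succ = content f' j := by
      intro j
      rw [← content_comp f g, content_eq_sum, content_eq_sum, Fin.sum_univ_add]
      simp only [hg, hf', Fin.succ_inj, (Fin.succ_ne_zero j).symm, if_false,
        Finset.sum_const_zero, zero_add]
    rw [ha, mulLam_add ha0 hb.ne' rfl hn hu,
      subCls_altSub_conj (H' := stab fun i => f (g i)) _ g fun x => ?_,
      ← cup_altSub hE (Nat.pos_of_ne_zero ha0) hb hu (isUnit_factorial_of_le (by omega) hk)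
        (isUnit_factorial_of_le (by omega) hk) hK, ih hb (by omega) f',
      ← (lambda_isFGP_and_cls hE (Nat.pos_of_ne_zero ha0)
        (isUnit_factorial_of_le (by omega) hk) _).2]
    · simp only [hcont]
      rfl
    · refine ⟨fun h i => ?_, fun h i => ?_⟩
      · simpa using h (g⁻¹ i)
      · simpa using h (g i)

end Young

/-! ### Newton's identities and roots of unity -/

section PowerSeriesIdentity

open PowerSeries

theorem derivative_rescale {A : Type*} [CommRing A] (a : A) (f : A⟦X⟧) :
    derivative A (rescale a f) = PowerSeries.C a * rescale a (derivative A f) := by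
  ext n
  rw [coeff_derivative, coeff_rescale, coeff_C_mul, coeff_rescale, coeff_derivative]
  ring

theorem derivative_prod_of_eq_mul {A : Type*} [CommRing A] {κ : Type*} (s : Finset κ)
    (f q : κ → A⟦X⟧) (h : ∀ j, derivative A (f j) = f j * q j) :
    derivative A (∏ j ∈ s, f j) = (∏ j ∈ s, f j) * ∑ j ∈ s, q j := by
  classical
  induction s using Finset.induction_on with
  | empty => simp
  | insert a s ha ih =>
    rw [Finset.prod_insert ha, Finset.sum_insert ha, Derivation.leibniz, ih, h, smul_eq_mul,
      smul_eq_mul]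
    ring

/-- If `e` and `p` satisfy Newton's identities and `w` is a root of unity of order `k`, then the
coefficient of `t^k` in `∏_{j < k} ∑ₙ e n (w^j t)ⁿ` is `(-1)^(k - 1) p k`. Both sides are determined
by the logarithmic derivative of the product, which is `k (-1)^(k - 1) p k t^(k - 1) + ⋯`. -/
theorem coeff_prod_rescale_of_newton {A : Type*} [CommRing A] [IsDomain A] [CharZero A] {k : ℕ}
    (hk : 0 < k) {w : A} (hw : IsCycRoot k w) (e p : ℕ → A) (he : e 0 = 1)
    (hp : ∀ m, p (m + 1) = (∑ i ∈ Finset.range m, (-1) ^ i * (e (i + 1) * p (m - i))) +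
      (-1) ^ m * (m + 1 : ℕ) * e (m + 1)) :
    coeff k (∏ j : Fin k, rescale (w ^ (j : ℕ)) (PowerSeries.mk e)) =
      (-1) ^ (k - 1) * p k := by
  have hsq : ∀ m : ℕ, ((-1 : A) ^ m) * (-1) ^ m = 1 := fun m => by
    rw [← mul_pow, neg_one_mul, neg_neg, one_pow]
  have h1 : derivative A (PowerSeries.mk e) =
      PowerSeries.mk e * PowerSeries.mk fun n => (-1) ^ n * p (n + 1) := by
    ext m
    rw [coeff_derivative, coeff_mk, coeff_mul, Finset.Nat.sum_antidiagonal_eq_sum_range_succ_mk,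
      Finset.sum_range_succ']
    simp only [coeff_mk, he, Nat.sub_zero, one_mul]
    rw [hp m, mul_add ((-1 : A) ^ m), Finset.mul_sum, ← add_assoc, ← Finset.sum_add_distrib,
      Finset.sum_eq_zero, zero_add, ← mul_assoc, ← mul_assoc, hsq, one_mul]
    · push_cast
      ring
    · intro i hi
      rw [Finset.mem_range] at hi
      obtain ⟨l, rfl⟩ := Nat.exists_eq_add_of_lt hi
      have h2 : i + l + 1 - (i + 1) = l := by omega
      have h3 : i + l + 1 - i = l + 1 := by omega
      rw [h2, h3, pow_add, pow_add, pow_one]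
      linear_combination -((-1) ^ l * e (i + 1) * p (l + 1)) * hsq i
  have h2 := derivative_prod_of_eq_mul Finset.univ
    (fun j : Fin k => rescale (w ^ (j : ℕ)) (PowerSeries.mk e)) (fun j => PowerSeries.C (w ^ (j : ℕ)) *
      rescale (w ^ (j : ℕ)) (PowerSeries.mk fun n => (-1) ^ n * p (n + 1))) fun j => by
    rw [derivative_rescale, h1, map_mul]
    ring
  have h3 : ∀ n, coeff n (∑ j : Fin k, PowerSeries.C (w ^ (j : ℕ)) *
      rescale (w ^ (j : ℕ)) (PowerSeries.mk fun n => (-1) ^ n * p (n + 1))) =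
      (∑ i ∈ Finset.range k, w ^ (i * (n + 1))) * ((-1) ^ n * p (n + 1)) := by
    intro n
    rw [map_sum, Finset.sum_mul, ← Fin.sum_univ_eq_sum_range
      (fun i => w ^ (i * (n + 1)) * ((-1) ^ n * p (n + 1)))]
    refine Finset.sum_congr rfl fun j _ => ?_
    rw [coeff_C_mul, coeff_rescale, coeff_mk, ← mul_assoc, ← pow_succ', pow_mul]
  obtain ⟨m, rfl⟩ : ∃ m, k = m + 1 := ⟨k - 1, by omega⟩
  have h4 := congrArg (coeff m) h2
  rw [coeff_derivative, coeff_mul, Finset.sum_eq_single_of_mem (0, m) (by simp)] at h4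
  · rw [h3, coeff_zero_eq_constantCoeff, map_prod (constantCoeff (R := A))] at h4
    have h5 : ∑ i ∈ Finset.range (m + 1), w ^ (i * (m + 1)) = ((m + 1 : ℕ) : A) := by
      simp only [mul_comm _ (m + 1), pow_mul w, hw.pow_eq, one_pow]
      simp
    have h6 : ∀ a, constantCoeff (rescale a (PowerSeries.mk e)) = 1 := fun a => by
      rw [← coeff_zero_eq_constantCoeff_apply, coeff_rescale, coeff_mk, he, pow_zero, one_mul]
    simp only [h6, Finset.prod_const_one] at h4
    rw [h5, one_mul, mul_comm] at h4
    refine mul_left_cancel₀ (a := ((m + 1 : ℕ) : A)) (Nat.cast_ne_zero.2 m.succ_ne_zero) ?_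
    rw [Nat.add_sub_cancel, ← h4]
    push_cast
    ring
  · rintro ⟨a, b⟩ hab hne
    rw [Finset.HasAntidiagonal.mem_antidiagonal] at hab
    rw [h3, hw.sum_eq, zero_mul, mul_zero]
    intro hdvd
    have h5 := Nat.le_of_dvd (Nat.succ_pos _) hdvd
    refine hne (Prod.ext ?_ ?_) <;> simp at hab ⊢ <;> omega

/-- The Newton polynomial as a sum over the decompositions `k = ∑ c j`, weighted by the powers of
`ω`. -/
theorem sum_omegaRoot_pow_mul_prod_elemPoly (k : ℕ) [NeZero k] :
    ∑ c ∈ Finset.finsuppAntidiag (Finset.univ : Finset (Fin k)) k,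
      MvPolynomial.C (omegaRoot k ^ (∑ j : Fin k, (j : ℕ) * c j)) *
        MvPolynomial.map (Int.castRingHom (Omega k)) (∏ j, elemPoly (c j)) =
      MvPolynomial.C ((-1) ^ (k - 1)) *
        MvPolynomial.map (Int.castRingHom (Omega k)) (newtonPoly k) := by
  have hω := (isCycRoot_omegaRoot k).map (MvPolynomial.C (σ := ℕ) (R := Omega k))
  have h := coeff_prod_rescale_of_newton (Nat.pos_of_ne_zero (NeZero.ne k)) hω
    (fun n => MvPolynomial.map (Int.castRingHom (Omega k)) (elemPoly n))
    (fun n => MvPolynomial.map (Int.castRingHom (Omega k)) (newtonPoly n))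
    (by simp [elemPoly]) (fun m => by
      rw [newtonPoly, map_add, map_sum, ← Fin.sum_univ_eq_sum_range (fun i => (-1) ^ i *
        (MvPolynomial.map (Int.castRingHom (Omega k)) (elemPoly (i + 1)) *
          MvPolynomial.map (Int.castRingHom (Omega k)) (newtonPoly (m - i))))]
      congr 1
      · refine Finset.sum_congr rfl fun i _ => ?_
        simp [elemPoly, zsmul_eq_mul]
      · simp [elemPoly, zsmul_eq_mul])
  rw [map_pow, map_neg, map_one, ← h, coeff_prod]
  refine Finset.sum_congr rfl fun c _ => ?_
  rw [map_prod, map_pow, ← Finset.prod_pow_eq_pow_sum, ← Finset.prod_mul_distrib]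
  refine Finset.prod_congr rfl fun j _ => ?_
  rw [coeff_rescale, coeff_mk, pow_mul]

end PowerSeriesIdentity

/-! ### Functions with values in a graded module -/

section Functions

/-- The graded module of functions on a set with values in a graded module. -/
abbrev funMod (M : CliffMod Q) (X : Type) : CliffMod Q where
  carrier := X → M.carrier
  act :=
    { toFun := fun a => LinearMap.pi fun x => M.act a ∘ₗ LinearMap.proj x
      map_one' := by
        refine LinearMap.ext fun φ => funext fun x => ?_
        simp
      map_mul' := fun a b => by
        refine LinearMap.ext fun φ => funext fun x => ?_
        simp
      map_zero' := by
        refine LinearMap.ext fun φ => funext fun x => ?_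
        simp
      map_add' := fun a b => by
        refine LinearMap.ext fun φ => funext fun x => ?_
        simp
      commutes' := fun r => by
        refine LinearMap.ext fun φ => funext fun x => ?_
        simp }
  gr := LinearMap.pi fun x => M.gr ∘ₗ LinearMap.proj x
  gr_gr φ := funext fun x => M.gr_gr (φ x)
  gr_act v φ := funext fun x => M.gr_act v (φ x)

variable {X : Type}

theorem isMor_eval (M : CliffMod Q) (x : X) : IsMor (M.funMod X) M (LinearMap.proj x) :=
  ⟨fun _ _ => rfl, fun _ => rfl⟩

variable [Fintype X]

theorem isFGP_funMod {M : CliffMod Q} (hM : M.IsFGP) : (M.funMod X).IsFGP := by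
  classical
  rw [isFGP_iff] at hM ⊢
  refine Retr.trans ⟨X, inferInstance, fun x => ⟨LinearMap.proj x, fun v φ => rfl⟩,
    fun x => ⟨LinearMap.single R (fun _ => M.carrier) x, fun v y => funext fun x' => ?_⟩,
    fun φ => ?_⟩ hM
  · by_cases hx : x' = x
    · subst hx
      simp
    · simp [hx]
  · exact (LinearMap.sum_single_apply _ _).trans rfl

/-- The operator on functions given by a matrix. -/
def matOp (Y : Type*) [AddCommGroup Y] [Module R Y] (C : Matrix X X R) :
    Module.End R (X → Y) :=
  LinearMap.pi fun x => ∑ x', C x x' • LinearMap.proj x'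

section

variable {Y : Type*} [AddCommGroup Y] [Module R Y]

theorem matOp_apply (C : Matrix X X R) (φ : X → Y) (x : X) :
    matOp Y C φ x = ∑ x', C x x' • φ x' := by
  simp [matOp, LinearMap.sum_apply]

theorem matOp_matOp (C D : Matrix X X R) (φ : X → Y) :
    matOp Y C (matOp Y D φ) = matOp Y (C * D) φ := by
  funext x
  simp only [matOp_apply, Matrix.mul_apply, Finset.smul_sum, Finset.sum_smul, smul_smul]
  exact Finset.sum_comm

variable [DecidableEq X]

theorem matOp_one (φ : X → Y) : matOp Y (1 : Matrix X X R) φ = φ := by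
  funext x
  simp [matOp_apply, Matrix.one_apply]

theorem matOp_diagonal (c : X → R) (φ : X → Y) (x : X) :
    matOp Y (Matrix.diagonal c) φ x = c x • φ x := by
  rw [matOp_apply, Finset.sum_eq_single_of_mem x (Finset.mem_univ x), Matrix.diagonal_apply_eq]
  intro x' _ hx
  rw [Matrix.diagonal_apply_ne _ hx.symm, zero_smul]

/-- The restriction of functions to the subset `P`, extended by `0`. -/
def suppOp (R Y : Type*) [CommRing R] [AddCommGroup Y] [Module R Y] (P : X → Prop)
    [DecidablePred P] : Module.End R (X → Y) :=
  matOp Y (Matrix.diagonal fun x => if P x then 1 else 0)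

theorem suppOp_apply (P : X → Prop) [DecidablePred P] (φ : X → Y) (x : X) :
    suppOp R Y P φ x = if P x then φ x else 0 := by
  rw [suppOp, matOp_diagonal, ite_smul, one_smul, zero_smul]

theorem mem_eigenspace_suppOp {P : X → Prop} [DecidablePred P] {φ : X → Y} :
    φ ∈ Module.End.eigenspace (suppOp R Y P) (1 : R) ↔ ∀ x, ¬ P x → φ x = 0 := by
  rw [Module.End.mem_eigenspace_iff, one_smul]
  constructor
  · intro h x hx
    rw [← h, suppOp_apply, if_neg hx]
  · intro h
    funext x
    rw [suppOp_apply]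
    split_ifs with hx
    · rfl
    · exact (h x hx).symm

end

theorem isMor_matOp (M : CliffMod Q) (C : Matrix X X R) :
    IsMor (M.funMod X) (M.funMod X) (matOp M.carrier C) := by
  refine ⟨fun v φ => funext fun x => ?_, fun φ => funext fun x => ?_⟩
  · refine (matOp_apply _ _ _).trans (Eq.trans ?_ (congrArg (M.act (ι Q v))
      (matOp_apply C φ x)).symm)
    rw [map_sum]
    exact Finset.sum_congr rfl fun _ _ => ((M.act (ι Q v)).map_smul _ _).symm
  · refine (matOp_apply _ _ _).trans (Eq.trans ?_ (congrArg M.gr (matOp_apply C φ x)).symm)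
    rw [map_sum]
    exact Finset.sum_congr rfl fun _ _ => (M.gr.map_smul _ _).symm

end Functions

/-! ### Equivariant functions on the maps into a finite set -/

section Equivariant

variable [Invertible (2 : R)] (E : CliffMod Q) (n : ℕ) (κ : Type)

/-- The representation of the symmetric group on functions of the maps `f` from the `n` places to
`κ`, with values in the `n`-th tensor power twisted by the signature. -/
def funRep : Equiv.Perm (Fin n) →* Module.End R ((Fin n → κ) → ⨂[R] _ : Fin n, E.carrier) where
  toFun g := LinearMap.pi fun f => E.signPerm n g ∘ₗ LinearMap.proj fun i => f (g i)
  map_one' := by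
    refine LinearMap.ext fun φ => funext fun f => ?_
    change E.signPerm n 1 (φ f) = φ f
    rw [map_one, Module.End.one_apply]
  map_mul' g g' := by
    refine LinearMap.ext fun φ => funext fun f => ?_
    change E.signPerm n (g * g') _ = E.signPerm n g (E.signPerm n g' _)
    rw [map_mul]
    rfl

theorem isMor_funRep (h : ∀ v, Q' v = n • Q v) (g : Equiv.Perm (Fin n)) :
    IsMor ((E.power n h).funMod (Fin n → κ)) ((E.power n h).funMod (Fin n → κ))
      (E.funRep n κ g) :=
  ⟨fun v _ => funext fun _ => (isMor_signPerm E h g).1 v _,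
    fun _ => funext fun _ => (isMor_signPerm E h g).2 _⟩

/-- The equivariant functions of the maps from the `n` places to `κ`. -/
def altFun : Submodule R ((Fin n → κ) → ⨂[R] _ : Fin n, E.carrier) := invts (E.funRep n κ)

variable {E n κ}

theorem mem_altFun {φ : (Fin n → κ) → ⨂[R] _ : Fin n, E.carrier} : φ ∈ E.altFun n κ ↔
    ∀ (g : Equiv.Perm (Fin n)) (f : Fin n → κ), E.signPerm n g (φ fun i => f (g i)) = φ f := by
  rw [altFun, mem_invts]
  exact forall_congr' fun g => funext_iff

theorem apply_mem_altSub {φ : (Fin n → κ) → ⨂[R] _ : Fin n, E.carrier} (hφ : φ ∈ E.altFun n κ)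
    (f : Fin n → κ) : φ f ∈ E.altSub (stab f) := by
  refine mem_altSub.2 fun g hg => ?_
  have h1 := mem_altFun.1 hφ g f
  have h2 : (fun i => f (g i)) = f := funext hg
  rwa [h2] at h1

theorem apply_comp_of_mem_altFun {φ : (Fin n → κ) → ⨂[R] _ : Fin n, E.carrier}
    (hφ : φ ∈ E.altFun n κ) (f : Fin n → κ) (g : Equiv.Perm (Fin n)) :
    φ (fun i => f (g i)) = E.signPerm n g⁻¹ (φ f) := by
  rw [← mem_altFun.1 hφ g f, signPerm_inv_apply]

theorem stable_altFun (h : ∀ v, Q' v = n • Q v) :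
    ((E.power n h).funMod (Fin n → κ)).Stable (E.altFun n κ) :=
  Stable.invts (M := (E.power n h).funMod (Fin n → κ)) (isMor_funRep E n κ h)

variable [Fintype κ]

theorem subFGP_altFun [Module.Finite R V] [Module.Projective R V] (hE : E.IsFGP) (hn0 : 0 < n)
    (hn : IsUnit ((n.factorial : ℕ) : R)) (h : ∀ v, Q' v = n • Q v) :
    ((E.power n h).funMod (Fin n → κ)).SubFGP (E.altFun n κ) :=
  subFGP_invts (isFGP_funMod (hE.power hn0 h)) (isMor_funRep E n κ h)
    (by rwa [Fintype.card_perm, Fintype.card_fin])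

theorem matOp_mem_altFun {C : Matrix (Fin n → κ) (Fin n → κ) R}
    (hC : ∀ (g : Equiv.Perm (Fin n)) f f', C (fun i => f (g i)) (fun i => f' (g i)) = C f f')
    {φ : (Fin n → κ) → ⨂[R] _ : Fin n, E.carrier} (hφ : φ ∈ E.altFun n κ) :
    matOp _ C φ ∈ E.altFun n κ := by
  refine mem_altFun.2 fun g f => ?_
  rw [matOp_apply, matOp_apply, map_sum, ← (Equiv.arrowCongr g.symm (Equiv.refl κ)).sum_comp]
  refine Finset.sum_congr rfl fun f' _ => ?_
  rw [map_smul]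
  congr 1
  · exact hC g f f'
  · exact mem_altFun.1 hφ g f'

variable [DecidableEq κ]

theorem diagonal_mem_altFun {c : (Fin n → κ) → R}
    (hc : ∀ (g : Equiv.Perm (Fin n)) f, c (fun i => f (g i)) = c f)
    {φ : (Fin n → κ) → ⨂[R] _ : Fin n, E.carrier} (hφ : φ ∈ E.altFun n κ) :
    matOp _ (Matrix.diagonal c) φ ∈ E.altFun n κ := by
  refine matOp_mem_altFun (fun g f f' => ?_) hφ
  rw [Matrix.diagonal_apply, Matrix.diagonal_apply, hc]
  refine if_congr ⟨fun e => funext fun i => ?_, fun e => by rw [e]⟩ rfl rfl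
  simpa using congrFun e (g⁻¹ i)

variable {k : ℕ} {ζ : R}

/-- The equivariant functions decompose according to an invariant of the maps. -/
theorem chi_altFun_decomp [Module.Finite R V] [Module.Projective R V] (hk : 0 < k)
    (hu : IsUnit (k : R)) (hζ : IsCycRoot k ζ) (hE : E.IsFGP) (hn0 : 0 < n)
    (hn : IsUnit ((n.factorial : ℕ) : R)) (h : ∀ v, Q' v = n • Q v)
    {T : Module.End R ((Fin n → κ) → ⨂[R] _ : Fin n, E.carrier)}
    (hT : IsMor ((E.power n h).funMod (Fin n → κ)) ((E.power n h).funMod (Fin n → κ)) T)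
    (hTN : ∀ φ ∈ E.altFun n κ, T φ ∈ E.altFun n κ) (hTk : ∀ φ ∈ E.altFun n κ, (T ^ k) φ = φ)
    {L : Type*} [DecidableEq L] (s : Finset L) (l : (Fin n → κ) → L) (hl : ∀ f, l f ∈ s)
    (hlg : ∀ (g : Equiv.Perm (Fin n)) f, l (fun i => f (g i)) = l f)
    (hTl : ∀ i φ, T (suppOp R _ (fun f => l f = i) φ) = suppOp R _ (fun f => l f = i) (T φ)) :
    chi k ζ ((E.power n h).funMod (Fin n → κ)) T (E.altFun n κ) =
      ∑ i ∈ s, chi k ζ ((E.power n h).funMod (Fin n → κ)) T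
        (E.altFun n κ ⊓ Module.End.eigenspace (suppOp R _ fun f => l f = i) 1) := by
  refine chi_decomp hk hu hζ (subFGP_altFun hE hn0 hn h) hT hTN hTk s
    (fun i => suppOp R _ fun f => l f = i) (fun i _ => isMor_matOp _ _)
    (fun i _ φ hφ => diagonal_mem_altFun (fun g f => by simp only [hlg]) hφ)
    (fun i _ φ _ => funext fun f => ?_) (fun i _ j _ hij φ _ => funext fun f => ?_)
    (fun φ _ => funext fun f => ?_) fun i _ φ _ => hTl i φ
  · rw [suppOp_apply, suppOp_apply]
    split_ifs <;> rfl
  · rw [suppOp_apply, suppOp_apply]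
    split_ifs with h1 h2
    · exact absurd (h1.symm.trans h2) hij
    · rfl
    · rfl
  · refine (Finset.sum_apply f s _).trans ?_
    simp only [suppOp_apply]
    rw [Finset.sum_ite_eq, if_pos (hl f)]

/-- The equivariant functions supported by the orbit of `f₀` are determined by their value at `f₀`,
an arbitrary tensor which is antisymmetric under the stabilizer of `f₀`. -/
theorem chi_altFun_orbit (h : ∀ v, Q' v = n • Q v) (f₀ : Fin n → κ) (P : (Fin n → κ) → Prop)
    [DecidablePred P] (hP : ∀ f, P f ↔ ∃ g : Equiv.Perm (Fin n), f = fun i => f₀ (g i))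
    {T : Module.End R ((Fin n → κ) → ⨂[R] _ : Fin n, E.carrier)}
    {T' : Module.End R (⨂[R] _ : Fin n, E.carrier)}
    (hT : IsMor ((E.power n h).funMod (Fin n → κ)) ((E.power n h).funMod (Fin n → κ)) T)
    (hT' : IsMor (E.power n h) (E.power n h) T')
    (hTN : ∀ φ ∈ E.altFun n κ, T φ ∈ E.altFun n κ)
    (hTP : ∀ φ, T (suppOp R _ P φ) = suppOp R _ P (T φ))
    (haT : ∀ φ ∈ E.altFun n κ ⊓ Module.End.eigenspace (suppOp R _ P) (1 : R),
      T φ f₀ = T' (φ f₀)) :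
    chi k ζ ((E.power n h).funMod (Fin n → κ)) T
        (E.altFun n κ ⊓ Module.End.eigenspace (suppOp R _ P) 1) =
      chi k ζ (E.power n h) T' (E.altSub (stab f₀)) := by
  classical
  -- the extension of `y` to an equivariant function
  let b : (⨂[R] _ : Fin n, E.carrier) → ((Fin n → κ) → ⨂[R] _ : Fin n, E.carrier) := fun y f =>
    if hf : ∃ g : Equiv.Perm (Fin n), f = fun i => f₀ (g i) then
      E.signPerm n hf.choose⁻¹ y else 0
  have hb : ∀ y ∈ E.altSub (stab f₀), ∀ g : Equiv.Perm (Fin n),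
      b y (fun i => f₀ (g i)) = E.signPerm n g⁻¹ y := by
    intro y hy g
    have hf : ∃ g' : Equiv.Perm (Fin n), (fun i => f₀ (g i)) = fun i => f₀ (g' i) := ⟨g, rfl⟩
    simp only [b, dif_pos hf]
    have h1 : g * hf.choose⁻¹ ∈ stab f₀ := by
      intro i
      have := congrFun hf.choose_spec (hf.choose⁻¹ i)
      simpa using this
    have h2 := mem_altSub.1 hy _ h1
    conv_rhs => rw [← h2]
    rw [← Module.End.mul_apply, ← map_mul, inv_mul_cancel_left]
  have hb0 : ∀ y f, ¬ P f → b y f = 0 := fun y f hf => dif_neg fun h' => hf ((hP f).2 h')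
  have hbid : ∀ y ∈ E.altSub (stab f₀), b y f₀ = y := by
    intro y hy
    have := hb y hy 1
    rwa [inv_one, map_one] at this
  refine chi_congr ((stable_altFun h).inf (Stable.eigenspace (isMor_matOp _ _) 1))
    (stable_altSub h (stab f₀)) hT hT' (fun φ hφ => ⟨hTN φ hφ.1, ?_⟩) (LinearMap.proj f₀)
    (isMor_eval _ f₀) b (fun φ hφ => ?_) (fun y hy => ⟨?_, ?_⟩) (fun φ hφ => funext fun f => ?_)
    hbid haT
  · refine Module.End.mem_eigenspace_iff.2 ?_
    rw [one_smul]
    have h1 := Module.End.mem_eigenspace_iff.1 hφ.2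
    rw [one_smul] at h1
    exact (hTP φ).symm.trans (congrArg T h1)
  · exact apply_mem_altSub hφ.1 f₀
  · refine mem_altFun.2 fun g f => ?_
    by_cases hf : P f
    · obtain ⟨g', rfl⟩ := (hP f).1 hf
      have h1 := hb y hy (g' * g)
      rw [hb y hy g']
      refine (congrArg (E.signPerm n g) h1).trans ?_
      rw [← Module.End.mul_apply, ← map_mul, mul_inv_rev, mul_inv_cancel_left]
    · rw [hb0 y f hf, hb0, map_zero]
      intro hf'
      obtain ⟨g', hg'⟩ := (hP _).1 hf'
      refine hf ((hP f).2 ⟨g' * g⁻¹, funext fun i => ?_⟩)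
      simpa using congrFun hg' (g⁻¹ i)
  · exact mem_eigenspace_suppOp.2 fun f hf => hb0 y f hf
  · by_cases hf : P f
    · obtain ⟨g, rfl⟩ := (hP f).1 hf
      exact (hb _ (apply_mem_altSub hφ.1 f₀) g).trans (apply_comp_of_mem_altFun hφ.1 f₀ g).symm
    · exact (hb0 _ f hf).trans (mem_eigenspace_suppOp.1 hφ.2 f hf).symm

end Equivariant

/-! ### Cyclic rotation of the values -/

section Rotation

variable (E : CliffMod Q) (k : ℕ)

/-- The action of the cyclic permutation on functions of the maps `f : Fin k → Fin k`, through the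
values of `f`. -/
def rotOp : Module.End R ((Fin k → Fin k) → ⨂[R] _ : Fin k, E.carrier) :=
  LinearMap.pi fun f => LinearMap.proj fun i => (finRotate k)⁻¹ (f i)

variable {E k}

theorem rotOp_apply (φ : (Fin k → Fin k) → ⨂[R] _ : Fin k, E.carrier) (f : Fin k → Fin k) :
    E.rotOp k φ f = φ fun i => (finRotate k)⁻¹ (f i) := rfl

theorem isMor_rotOp (h : ∀ v, Q' v = k • Q v) :
    IsMor ((E.power k h).funMod (Fin k → Fin k)) ((E.power k h).funMod (Fin k → Fin k))
      (E.rotOp k) := ⟨fun _ _ => rfl, fun _ => rfl⟩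

theorem rotOp_pow (m : ℕ) (φ : (Fin k → Fin k) → ⨂[R] _ : Fin k, E.carrier)
    (f : Fin k → Fin k) : (E.rotOp k ^ m) φ f = φ fun i => ((finRotate k)⁻¹ ^ m) (f i) := by
  induction m generalizing φ with
  | zero => rfl
  | succ m ih =>
    rw [pow_succ, Module.End.mul_apply, ih, rotOp_apply]
    simp only [pow_succ', Equiv.Perm.mul_apply]

theorem rotOp_pow_self (φ : (Fin k → Fin k) → ⨂[R] _ : Fin k, E.carrier) :
    (E.rotOp k ^ k) φ = φ := by
  funext f
  rw [rotOp_pow, inv_pow, finRotate_pow_self]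
  rfl

theorem rotOp_suppOp {P : (Fin k → Fin k) → Prop} [DecidablePred P]
    (hP : ∀ f, P (fun i => (finRotate k)⁻¹ (f i)) ↔ P f)
    (φ : (Fin k → Fin k) → ⨂[R] _ : Fin k, E.carrier) :
    E.rotOp k (suppOp R _ P φ) = suppOp R _ P (E.rotOp k φ) := by
  funext f
  rw [rotOp_apply, suppOp_apply, suppOp_apply, rotOp_apply]
  exact if_congr (hP f) rfl rfl

/-- The set of the values missed by `f`. -/
def missed (f : Fin k → Fin k) (j : Fin k) : Bool := decide (∀ i, f i ≠ j)

theorem missed_comp (f : Fin k → Fin k) (g : Equiv.Perm (Fin k)) :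
    missed (fun i => f (g i)) = missed f := by
  funext j
  exact decide_eq_decide.2 ⟨fun h i => by simpa using h (g⁻¹ i), fun h i => h (g i)⟩

theorem missed_inv_comp (f : Fin k → Fin k) (g : Equiv.Perm (Fin k)) :
    missed (fun i => g⁻¹ (f i)) = fun j => missed f (g j) := by
  funext j
  exact decide_eq_decide.2 (forall_congr' fun i => not_congr Equiv.Perm.inv_eq_iff_eq)

/-- The number of values missed by `f`. -/
def missedCard (f : Fin k → Fin k) : ℕ := (Finset.univ.filter fun j => missed f j = true).card

theorem missedCard_lt (hk : 0 < k) (f : Fin k → Fin k) : missedCard f < k := by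
  have h1 : missedCard f < Fintype.card (Fin k) := by
    refine Finset.card_lt_univ_of_notMem (x := f ⟨0, hk⟩) ?_
    simp only [Finset.mem_filter, Finset.mem_univ, true_and, missed, decide_eq_true_eq]
    exact fun h => h ⟨0, hk⟩ rfl
  rwa [Fintype.card_fin] at h1

theorem missedCard_comp (f : Fin k → Fin k) (g : Equiv.Perm (Fin k)) :
    missedCard (fun i => f (g i)) = missedCard f := by
  rw [missedCard, missed_comp, missedCard]

theorem missedCard_inv_comp (f : Fin k → Fin k) (g : Equiv.Perm (Fin k)) :
    missedCard (fun i => g⁻¹ (f i)) = missedCard f := by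
  rw [missedCard, missed_inv_comp]
  exact Finset.card_equiv g fun i => by simp

theorem missedCard_eq_zero_iff (f : Fin k → Fin k) :
    missedCard f = 0 ↔ ∃ g : Equiv.Perm (Fin k), f = fun i => id (g i) := by
  simp only [missedCard, missed, Finset.card_eq_zero, Finset.filter_eq_empty_iff,
    Finset.mem_univ, true_imp_iff, decide_eq_true_eq, not_forall, not_not]
  constructor
  · intro h
    have hs : Function.Surjective f := fun j => @h j
    exact ⟨Equiv.ofBijective f (Finite.injective_iff_bijective.1
      (Finite.injective_iff_surjective.2 hs)), rfl⟩
  · rintro ⟨g, rfl⟩ j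
    exact ⟨g⁻¹ j, by simp⟩

variable [Invertible (2 : R)]

theorem rotOp_mem_altFun {φ : (Fin k → Fin k) → ⨂[R] _ : Fin k, E.carrier}
    (hφ : φ ∈ E.altFun k (Fin k)) : E.rotOp k φ ∈ E.altFun k (Fin k) :=
  mem_altFun.2 fun g f => mem_altFun.1 hφ g fun i => (finRotate k)⁻¹ (f i)

variable {ζ : R} [Module.Finite R V] [Module.Projective R V]

/-- Only the bijective maps contribute to the class of the equivariant functions: the operator which
multiplies `φ f` by the product of the `ζ^j` over the missed values `j` permutes cyclically the
eigenmodules of the other parts. -/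
theorem chi_rotOp_eq_chi_signPerm (hk : 0 < k) (hu : IsUnit ((k.factorial : ℕ) : R))
    (hζ : IsCycRoot k ζ) (hE : E.IsFGP) (h : ∀ v, Q' v = k • Q v) :
    chi k ζ ((E.power k h).funMod (Fin k → Fin k)) (E.rotOp k) (E.altFun k (Fin k)) =
      chi k ζ (E.power k h) (E.signPerm k (finRotate k)) ⊤ := by
  have hT := isMor_rotOp (E := E) h
  have hTl : ∀ (i : ℕ) (φ : (Fin k → Fin k) → ⨂[R] _ : Fin k, E.carrier),
      E.rotOp k (suppOp R _ (fun f => missedCard f = i) φ) =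
        suppOp R _ (fun f => missedCard f = i) (E.rotOp k φ) :=
    fun i φ => rotOp_suppOp (fun f => by rw [missedCard_inv_comp]) φ
  rw [chi_altFun_decomp hk (isUnit_cast_of_factorial hk le_rfl hu) hζ hE hk hu h hT
    (fun _ => rotOp_mem_altFun) (fun φ _ => rotOp_pow_self φ) (Finset.range k) missedCard
    (fun f => Finset.mem_range.2 (missedCard_lt hk f)) (fun g f => missedCard_comp f g) hTl,
    Finset.sum_eq_single_of_mem 0 (Finset.mem_range.2 hk)]
  · rw [chi_altFun_orbit h id _ missedCard_eq_zero_iff hT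
      (isMor_signPerm E h (finRotate k)) (fun _ => rotOp_mem_altFun) (hTl 0) fun φ hφ => ?_]
    · congr 1
      refine top_le_iff.1 fun x _ => mem_altSub.2 fun g hg => ?_
      obtain rfl : g = 1 := Equiv.ext hg
      rw [map_one, Module.End.one_apply]
    · have h1 := apply_comp_of_mem_altFun hφ.1 id (finRotate k)⁻¹
      rw [inv_inv] at h1
      exact h1
  · intro m hm hm0
    have hD : ∀ (g : Equiv.Perm (Fin k)) (f : Fin k → Fin k),
        cycWeight ζ (missed fun i => f (g i)) = cycWeight ζ (missed f) :=
      fun g f => by rw [missed_comp]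
    refine chi_eq_zero hk hζ ((stable_altFun h).inf (Stable.eigenspace (isMor_matOp _ _) 1)) hT
      (fun φ hφ => ⟨rotOp_mem_altFun hφ.1, mem_eigenspace_suppOp.2 fun f hf =>
        mem_eigenspace_suppOp.1 hφ.2 _ (by rwa [missedCard_inv_comp])⟩)
      (fun hkm => hm0 (Nat.eq_zero_of_dvd_of_lt hkm (Finset.mem_range.1 hm)))
      (matOp _ (Matrix.diagonal fun f => cycWeight ζ (missed f))) (isMor_matOp _ _)
      (matOp _ (Matrix.diagonal fun f => Ring.inverse (cycWeight ζ (missed f))))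
      (fun φ hφ => ⟨diagonal_mem_altFun hD hφ.1, mem_eigenspace_suppOp.2 fun f hf => ?_⟩)
      (fun φ hφ => ⟨diagonal_mem_altFun (fun g f => by rw [hD]) hφ.1,
        mem_eigenspace_suppOp.2 fun f hf => ?_⟩)
      (fun φ _ => funext fun f => ?_) (fun φ _ => funext fun f => ?_)
      fun φ hφ => funext fun f => ?_
    · rw [matOp_diagonal, mem_eigenspace_suppOp.1 hφ.2 f hf, smul_zero]
    · rw [matOp_diagonal, mem_eigenspace_suppOp.1 hφ.2 f hf, smul_zero]
    · rw [matOp_diagonal, matOp_diagonal, smul_smul,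
        Ring.inverse_mul_cancel _ (isUnit_cycWeight hζ _), one_smul]
    · rw [matOp_diagonal, matOp_diagonal, smul_smul,
        Ring.mul_inverse_cancel _ (isUnit_cycWeight hζ _), one_smul]
    · refine (matOp_diagonal _ _ _).trans (Eq.trans ?_
        (congrArg (ζ ^ m • ·) (matOp_diagonal _ φ fun i => (finRotate k)⁻¹ (f i))).symm)
      rw [rotOp_apply, smul_smul, missed_inv_comp]
      by_cases hf : missedCard f = m
      · rw [cycWeight_finRotate hζ (missed f)]
        rw [missedCard] at hf
        rw [hf]
      · rw [mem_eigenspace_suppOp.1 hφ.2 _ (by rwa [missedCard_inv_comp]), smul_zero, smul_zero]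

end Rotation

/-! ### Fourier transformation -/

section Fourier

variable {k : ℕ} {ζ : R}

/-- The matrix of the Fourier transformation on the functions on `(ℤ/k)^n` for the character
`ζ^a`. -/
def fourierMat (ζ : R) (n k a : ℕ) : Matrix (Fin n → Fin k) (Fin n → Fin k) R :=
  fun f f' => ∏ i, ζ ^ (a * ((f i : ℕ) * (f' i : ℕ)))

theorem fourierMat_mul (hζ : IsCycRoot k ζ) {n a b : ℕ}
    (hab : ∀ x y : Fin k, k ∣ a * x + b * y ↔ x = y) :
    fourierMat ζ n k a * fourierMat ζ n k b = ((k : R) ^ n) • 1 := by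
  ext f f'
  rw [Matrix.mul_apply, Matrix.smul_apply, smul_eq_mul]
  have h1 : ∀ x y : Fin k, ∑ z : Fin k, ζ ^ (a * ((x : ℕ) * z)) * ζ ^ (b * ((z : ℕ) * y)) =
      if x = y then (k : R) else 0 := by
    intro x y
    have h2 : ∀ z : ℕ, ζ ^ (a * ((x : ℕ) * z)) * ζ ^ (b * (z * y)) = ζ ^ (z * (a * x + b * y)) := by
      intro z
      rw [← pow_add]
      congr 1
      ring
    rw [Fin.sum_univ_eq_sum_range (fun z => ζ ^ (a * ((x : ℕ) * z)) * ζ ^ (b * (z * y)))]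
    simp only [h2]
    split_ifs with hxy
    · obtain ⟨c, hc⟩ := (hab x y).2 hxy
      have h3 : ∀ z : ℕ, ζ ^ (z * (a * x + b * y)) = 1 := fun z => by
        rw [hc, mul_left_comm, pow_mul, hζ.pow_eq, one_pow]
      simp [h3]
    · exact hζ.sum_eq _ fun hd => hxy ((hab x y).1 hd)
  simp only [fourierMat, ← Finset.prod_mul_distrib]
  rw [← Fintype.prod_sum (fun i (z : Fin k) => ζ ^ (a * ((f i : ℕ) * z)) *
    ζ ^ (b * ((z : ℕ) * f' i)))]
  simp only [h1]
  by_cases hf : f = f'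
  · subst hf
    simp
  · obtain ⟨i, hi⟩ := Function.ne_iff.1 hf
    rw [Finset.prod_eq_zero (Finset.mem_univ i) (if_neg hi), Matrix.one_apply_ne hf, mul_zero]

theorem fourierMat_comp (ζ : R) {n k a : ℕ} (g : Equiv.Perm (Fin n)) (f f' : Fin n → Fin k) :
    fourierMat ζ n k a (fun i => f (g i)) (fun i => f' (g i)) = fourierMat ζ n k a f f' :=
  Equiv.prod_comp g fun i => ζ ^ (a * ((f i : ℕ) * (f' i : ℕ)))

theorem fourierMat_finRotate (hζ : IsCycRoot k ζ) {n : ℕ} (f f' : Fin n → Fin k) :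
    fourierMat ζ n k 1 f (fun i => finRotate k (f' i)) =
      ζ ^ (∑ i, (f i : ℕ)) * fourierMat ζ n k 1 f f' := by
  rw [fourierMat, fourierMat, ← Finset.prod_pow_eq_pow_sum, ← Finset.prod_mul_distrib]
  refine Finset.prod_congr rfl fun i _ => ?_
  rw [one_mul, one_mul, mul_comm, pow_mul, hζ.pow_finRotate, mul_pow, ← pow_mul,
    mul_comm (f' i : ℕ), mul_comm]

theorem dvd_sub_one_mul_add_iff (x y : Fin k) : k ∣ (k - 1) * x + 1 * y ↔ x = y := by
  have hk : 0 < k := x.pos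
  have h1 : (k : ℤ) ∣ (((k - 1) * x + 1 * y : ℕ) : ℤ) ↔ (k : ℤ) ∣ (y : ℤ) - (x : ℤ) := by
    have h2 : (((k - 1) * x + 1 * y : ℕ) : ℤ) = ((y : ℤ) - (x : ℤ)) + k * x := by
      push_cast [Nat.cast_sub hk]
      ring
    rw [h2, dvd_add_left (dvd_mul_right _ _)]
  rw [← Int.natCast_dvd_natCast, h1]
  constructor
  · intro h
    have h2 := Int.eq_zero_of_abs_lt_dvd h (abs_lt.2 ⟨by omega, by omega⟩)
    exact Fin.ext (by omega)
  · rintro rfl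
    simp

theorem sum_eq_sum_mul_content {n : ℕ} (f : Fin n → Fin k) :
    ∑ i, (f i : ℕ) = ∑ j : Fin k, (j : ℕ) * content f j := by
  rw [← Finset.sum_fiberwise Finset.univ f]
  refine Finset.sum_congr rfl fun j _ => ?_
  rw [Finset.sum_congr rfl (g := fun _ => (j : ℕ)) fun i hi => by rw [(Finset.mem_filter.1 hi).2],
    Finset.sum_const, smul_eq_mul, mul_comm]
  rfl

theorem sum_content {n : ℕ} (f : Fin n → Fin k) : ∑ j, content f j = n := by
  have := Finset.card_eq_sum_card_fiberwise (s := Finset.univ) (t := Finset.univ) (f := f)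
    fun _ _ => Finset.mem_univ _
  rw [Finset.card_univ, Fintype.card_fin] at this
  exact this.symm

theorem exists_content_eq {n : ℕ} (c : Fin k → ℕ) (hc : ∑ j, c j = n) :
    ∃ f : Fin n → Fin k, ∀ j, content f j = c j := by
  subst hc
  refine ⟨fun i => (finSigmaFinEquiv.symm i).1, fun j => ?_⟩
  rw [← Fintype.card_fin (c j), content, ← Fintype.card_subtype]
  refine Fintype.card_congr ((finSigmaFinEquiv.symm.subtypeEquiv fun _ => Iff.rfl).trans
    (Equiv.sigmaSubtype j))

theorem exists_perm_of_content_eq {n : ℕ} {f f' : Fin n → Fin k}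
    (h : ∀ j, content f j = content f' j) :
    ∃ g : Equiv.Perm (Fin n), f = fun i => f' (g i) := by
  have h1 : ∀ j, Fintype.card {i // f i = j} = Fintype.card {i // f' i = j} := fun j => by
    rw [Fintype.card_subtype, Fintype.card_subtype]
    exact h j
  exact ⟨Equiv.ofFiberEquiv fun j => Fintype.equivOfCardEq (h1 j),
    funext fun i => (Equiv.ofFiberEquiv_map _ i).symm⟩

variable [Invertible (2 : R)] {E : CliffMod Q}

/-- The Fourier transformation diagonalizes the rotation of the values. -/
theorem chi_rotOp_eq_chi_diagonal (hu : IsUnit (k : R)) (hζ : IsCycRoot k ζ)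
    (h : ∀ v, Q' v = k • Q v) :
    chi k ζ ((E.power k h).funMod (Fin k → Fin k)) (E.rotOp k) (E.altFun k (Fin k)) =
      chi k ζ ((E.power k h).funMod (Fin k → Fin k))
        (matOp _ (Matrix.diagonal fun f => ζ ^ (∑ i, (f i : ℕ)))) (E.altFun k (Fin k)) := by
  have hinv : Ring.inverse ((k : R) ^ k) * (k : R) ^ k = 1 :=
    Ring.inverse_mul_cancel _ (hu.pow k)
  have h1 := fourierMat_mul hζ (n := k) (dvd_sub_one_mul_add_iff (k := k))
  have h2 := fourierMat_mul hζ (n := k) (a := 1) (b := k - 1) fun x y => by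
    rw [add_comm, dvd_sub_one_mul_add_iff, eq_comm]
  refine chi_congr (stable_altFun h) (stable_altFun h) (isMor_rotOp h) (isMor_matOp _ _)
    (fun _ => rotOp_mem_altFun) (matOp _ (fourierMat ζ k k 1)) (isMor_matOp _ _)
    (matOp _ (Ring.inverse ((k : R) ^ k) • fourierMat ζ k k (k - 1)))
    (fun φ => matOp_mem_altFun (fourierMat_comp ζ))
    (fun φ => matOp_mem_altFun fun g f f' => congrArg (Ring.inverse ((k : R) ^ k) * ·)
      (fourierMat_comp ζ g f f'))
    (fun φ _ => ?_) (fun φ _ => ?_) fun φ _ => funext fun f => ?_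
  · rw [matOp_matOp, smul_mul_assoc, h1, smul_smul, hinv, one_smul]
    exact matOp_one φ
  · rw [matOp_matOp, mul_smul_comm, h2, smul_smul, hinv, one_smul]
    exact matOp_one φ
  · refine (matOp_apply _ _ _).trans (Eq.trans ?_ (matOp_diagonal _ _ _).symm)
    rw [matOp_apply, Finset.smul_sum,
      ← (Equiv.arrowCongr (Equiv.refl (Fin k)) (finRotate k)).sum_comp]
    refine Finset.sum_congr rfl fun f' _ => ?_
    rw [smul_smul, ← fourierMat_finRotate hζ]
    congr 1
    refine congrArg φ (funext fun i => ?_)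
    exact (finRotate k).symm_apply_apply _

variable [Module.Finite R V] [Module.Projective R V]

/-- The decomposition of the equivariant functions by the contents of the maps. -/
theorem chi_diagonal_eq_sum (hk : 0 < k) (hu : IsUnit ((k.factorial : ℕ) : R))
    (hζ : IsCycRoot k ζ) (hE : E.IsFGP)
    {T : Module.End R ((Fin k → Fin k) → ⨂[R] _ : Fin k, E.carrier)}
    (hT : IsMor ((E.power (Q' := k • Q) k fun _ => rfl).funMod (Fin k → Fin k))
      ((E.power k fun _ => rfl).funMod (Fin k → Fin k)) T)
    (hTN : ∀ φ ∈ E.altFun k (Fin k), T φ ∈ E.altFun k (Fin k))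
    (hTf : ∀ φ f, T φ f = ζ ^ (∑ i, (f i : ℕ)) • φ f) :
    chi k ζ ((E.power (Q' := k • Q) k fun _ => rfl).funMod (Fin k → Fin k)) T
        (E.altFun k (Fin k)) =
      ∑ c ∈ Finset.finsuppAntidiag (Finset.univ : Finset (Fin k)) k,
        (E.lamEval hu (∏ j, elemPoly (c j))).2 k ⊗ₜ[ℤ]
          (omegaRoot k ^ (∑ j : Fin k, (j : ℕ) * c j)) := by
  have huk : IsUnit (k : R) := isUnit_cast_of_factorial hk le_rfl hu
  have hTpow : ∀ (m : ℕ) φ f, (T ^ m) φ f = ζ ^ (m * ∑ i, (f i : ℕ)) • φ f := by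
    intro m φ f
    induction m with
    | zero => simp
    | succ m ih =>
      rw [pow_succ', Module.End.mul_apply, hTf, ih, smul_smul, ← pow_add]
      congr 2
      ring
  let l : (Fin k → Fin k) → (Fin k →₀ ℕ) := fun f => Finsupp.equivFunOnFinite.symm (content f)
  have hl : ∀ f c, l f = c ↔ ∀ j, content f j = c j := fun f c => DFunLike.ext_iff
  have hTl : ∀ c φ, T (suppOp R _ (fun f => l f = c) φ) = suppOp R _ (fun f => l f = c) (T φ) := by
    intro c φ
    funext f
    rw [hTf, suppOp_apply, suppOp_apply, hTf, smul_ite, smul_zero]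
  rw [chi_altFun_decomp hk huk hζ hE hk hu (fun _ => rfl) hT hTN (fun φ _ => funext fun f => by
      rw [hTpow, pow_mul, hζ.pow_eq, one_pow, one_smul])
    (Finset.finsuppAntidiag Finset.univ k) l
    (fun f => Finset.mem_finsuppAntidiag.2 ⟨sum_content f, Finset.subset_univ _⟩)
    (fun g f => (hl _ _).2 fun j => content_comp f g j) hTl]
  refine Finset.sum_congr rfl fun c hc => ?_
  obtain ⟨f₀, hf₀⟩ := exists_content_eq c (Finset.mem_finsuppAntidiag.1 hc).1
  have hw : ∑ i, (f₀ i : ℕ) = ∑ j : Fin k, (j : ℕ) * c j := by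
    simp only [sum_eq_sum_mul_content, hf₀]
  have hP : ∀ f, l f = c ↔ ∃ g : Equiv.Perm (Fin k), f = fun i => f₀ (g i) := by
    intro f
    rw [hl]
    constructor
    · intro hf
      exact exists_perm_of_content_eq fun j => (hf j).trans (hf₀ j).symm
    · rintro ⟨g, rfl⟩ j
      rw [content_comp, hf₀]
  rw [chi_altFun_orbit (fun _ => rfl) f₀ (fun f => l f = c) hP
      (T' := ζ ^ (∑ i, (f₀ i : ℕ)) • (1 : Module.End R (⨂[R] _ : Fin k, E.carrier)))
      hT (IsMor.one.smul _) hTN (hTl c) fun φ _ => hTf φ f₀,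
    chi_scalar hk huk hζ (∑ i, (f₀ i : ℕ)) fun x _ => rfl, subCls_altSub_stab hE hu hk le_rfl, hw]
  simp only [hf₀]

end Fourier

/-! ### Comparison with the Adams operation -/

section Comparison

/-- The sign of a `k`-cycle is a `k`-th root of unity. -/
theorem exists_omegaRoot_pow_eq (k : ℕ) [NeZero k] :
    ∃ w : ℕ, omegaRoot k ^ w = (-1) ^ (k - 1) := by
  rcases Nat.even_or_odd k with hk | hk
  · refine ⟨k / 2, ?_⟩
    have hk0 := NeZero.ne k
    have h1 := isPrimitiveRoot_omegaRoot k
    obtain ⟨m, hm⟩ := hk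
    have h2 : k / 2 = m := by omega
    rw [h2, Odd.neg_one_pow ⟨m - 1, by omega⟩]
    have h3 : omegaRoot k ^ m * omegaRoot k ^ m = 1 := by rw [← pow_add, ← hm, h1.pow_eq_one]
    refine (mul_self_eq_one_iff.1 h3).resolve_left fun h4 => ?_
    have := Nat.le_of_dvd (by omega) ((h1.pow_eq_one_iff_dvd m).1 h4)
    omega
  · exact ⟨0, by rw [pow_zero, Even.neg_one_pow (by obtain ⟨m, hm⟩ := hk; exact ⟨m, by omega⟩)]⟩

theorem mulOmega_tmul (k : ℕ) (Q : QuadraticForm R V) (α β : Omega k) (x : GrK Q) :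
    mulOmega k Q α (x ⊗ₜ[ℤ] β) = x ⊗ₜ[ℤ] (β * α) := TensorProduct.map_tmul _ _ _ _

theorem mulOmega_mulOmega (k : ℕ) (Q : QuadraticForm R V) (α β : Omega k)
    (x : GrK Q ⊗[ℤ] Omega k) : mulOmega k Q α (mulOmega k Q β x) = mulOmega k Q (β * α) x := by
  induction x using TensorProduct.induction_on with
  | zero => simp
  | add x y hx hy => rw [map_add, map_add, map_add, hx, hy]
  | tmul x y => rw [mulOmega_tmul, mulOmega_tmul, mulOmega_tmul, mul_assoc]

theorem mulOmega_one (k : ℕ) (Q : QuadraticForm R V) (x : GrK Q ⊗[ℤ] Omega k) :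
    mulOmega k Q 1 x = x := by
  induction x using TensorProduct.induction_on with
  | zero => simp
  | add x y hx hy => rw [map_add, hx, hy]
  | tmul x y => rw [mulOmega_tmul, mul_one]

variable [Invertible (2 : R)] [Module.Finite R V] [Module.Projective R V] {E : CliffMod Q}
  {k : ℕ} {ζ : R}

/-- The class of the equivariant functions with the rotation of the values is computed in two ways:
by bijective maps, which give `(-1)^(k - 1) Ψ̄ᵏ(E)`, and after a Fourier transformation, which gives
`(-1)^(k - 1)` times the Newton polynomial in the exterior powers. -/
theorem psiBar_eq_adams_tmul_one (hk : 0 < k) (hu : IsUnit ((k.factorial : ℕ) : R))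
    (hζ : (Polynomial.cyclotomic k R).IsRoot ζ) (hE : E.IsFGP) :
    E.psiBar (Q' := k • Q) k (fun _ => rfl) ζ = E.adams k hu ⊗ₜ[ℤ] (1 : Omega k) := by
  have : NeZero k := ⟨hk.ne'⟩
  have hz := isCycRoot_of_isRoot hk hζ
  -- the signature of the cyclic permutation, as a power of `ω` and of `ζ`
  obtain ⟨w, hw⟩ := exists_omegaRoot_pow_eq k
  have hw' : ζ ^ w = (-1) ^ (k - 1) := by
    obtain ⟨f, hf⟩ := exists_ringHom_of_isRoot hζ
    rw [← hf, ← map_pow, hw, map_pow, map_neg, map_one]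
  have h1 := chi_rotOp_eq_chi_signPerm hk hu hz hE (Q' := k • Q) fun _ => rfl
  have hmor := isMor_matOp (E.power (Q' := k • Q) k fun _ => rfl)
    (Matrix.diagonal fun f : Fin k → Fin k => ζ ^ (∑ i, (f i : ℕ)))
  have hsum : ∀ (g : Equiv.Perm (Fin k)) (f : Fin k → Fin k),
      ζ ^ (∑ i, (f (g i) : ℕ)) = ζ ^ (∑ i, (f i : ℕ)) := fun g f => by
    rw [Equiv.sum_comp g fun i => (f i : ℕ)]
  have hmem : ∀ φ ∈ E.altFun k (Fin k), matOp (⨂[R] _ : Fin k, E.carrier)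
      (Matrix.diagonal fun f : Fin k → Fin k => ζ ^ (∑ i, (f i : ℕ))) φ ∈ E.altFun k (Fin k) :=
    fun φ hφ => diagonal_mem_altFun hsum hφ
  rw [chi_rotOp_eq_chi_diagonal (isUnit_cast_of_factorial hk le_rfl hu) hz,
    chi_diagonal_eq_sum hk hu hz hE hmor hmem (matOp_diagonal _)] at h1
  have h2 := congrArg (E.lamEvalOmega hu k k) (sum_omegaRoot_pow_mul_prod_elemPoly k)
  rw [map_sum, lamEvalOmega_C_mul_map, lamEval_newtonPoly k le_rfl hu] at h2
  simp only [lamEvalOmega_C_mul_map] at h2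
  rw [h2, chi_smul hk hz ⊤ (T := E.perm (finRotate k)) w fun x _ => ?_, hw, ← psiBar_eq_chi] at h1
  · have h3 := congrArg (mulOmega k (k • Q) ((-1) ^ (k - 1))) h1
    have h4 : ((-1 : Omega k) ^ (k - 1)) * (-1) ^ (k - 1) = 1 := by
      rw [← mul_pow, neg_one_mul, neg_neg, one_pow]
    rw [mulOmega_tmul, mulOmega_mulOmega, h4, mulOmega_one] at h3
    exact h3.symm
  · rw [signPerm_apply, hw']
    obtain ⟨m, rfl⟩ : ∃ m, k = m + 1 := ⟨k - 1, by omega⟩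
    rw [sign_finRotate]
    push_cast
    rfl

end Comparison

end CliffMod

end

theorem theorem6p1 {R V : Type u} [CommRing R] [AddCommGroup V] [Module R V]
    [Module.Finite R V] [Module.Projective R V] [Invertible (2 : R)] (Q : QuadraticForm R V)
    (k : ℕ) (hk : 0 < k) (h2k : IsUnit ((2 * k : ℕ) : R))
    (ζ : R) (hζ : (Polynomial.cyclotomic k R).IsRoot ζ) :
    -- `F = E^{⊗ k}` is the direct sum of the eigenmodules, which have classes in `K(C(V(k)))`
    (∀ E : CliffMod Q, E.IsFGP →
      DirectSum.IsInternal
        (fun j : Fin k => Module.End.eigenspace (E.perm (finRotate k)) (ζ ^ (j : ℕ))) ∧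
      ∀ j < k, (E.eigen (Q' := k • Q) k (fun _ => rfl) (ζ ^ j)).IsFGP) ∧
    -- multiplicativity in `K(C(V(2k))) ⊗ Ω_k`
    (∀ E₀ E₁ : CliffMod Q, E₀.IsFGP → E₁.IsFGP →
      (CliffMod.tensor (CliffMod.two_nsmul_apply Q) E₀ E₁).IsFGP ∧
      CliffMod.psiBar (Q' := (2 * k) • Q) (CliffMod.tensor (CliffMod.two_nsmul_apply Q) E₀ E₁) k
          (CliffMod.mul_nsmul_apply Q k) ζ =
        CliffMod.cupOmega Q k (two_mul k).symm h2k
          (CliffMod.psiBar E₀ k (fun _ => rfl) ζ) (CliffMod.psiBar E₁ k (fun _ => rfl) ζ)) ∧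
    -- for `k` prime: values in the subgroup `K(C(V(k)))`, and additivity in this group
    (k.Prime →
      Function.Injective (fun x : CliffMod.GrK (k • Q) => x ⊗ₜ[ℤ] (1 : CliffMod.Omega k)) ∧
      ∃ ψ : CliffMod Q → CliffMod.GrK (k • Q),
        (∀ E, E.IsFGP → ψ E ⊗ₜ[ℤ] (1 : CliffMod.Omega k) = CliffMod.psiBar E k (fun _ => rfl) ζ) ∧
        ∀ E₀ E₁, E₀.IsFGP → E₁.IsFGP → ψ (E₀.prod E₁) = ψ E₀ + ψ E₁) ∧
    -- comparison with the Adams operation when `k!` is invertible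
    (∀ hk' : IsUnit ((k.factorial : ℕ) : R), ∀ E : CliffMod Q, E.IsFGP →
      (∀ i, 1 ≤ i → i ≤ k → (E.lambda (Q' := i • Q) i (fun _ => rfl)).IsFGP) ∧
      CliffMod.psiBar E k (fun _ => rfl) ζ = E.adams k hk' ⊗ₜ[ℤ] (1 : CliffMod.Omega k)) := by
  classical
  have hu : IsUnit (k : R) := isUnit_of_dvd_unit (Nat.cast_dvd_cast (Dvd.intro_left 2 rfl)) h2k
  have hz := CliffMod.isCycRoot_of_isRoot hk hζ
  refine ⟨fun E hE => ⟨CliffMod.isInternal_eigenspace hk hu hz (CliffMod.perm_finRotate_pow E k),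
    fun j _ => CliffMod.eigen_isFGP hk hu hz hE _ j⟩,
    fun E₀ E₁ h₀ h₁ => ⟨h₀.tensor' _ h₁, CliffMod.psiBar_tensor Q hk h2k hu hz h₀ h₁⟩,
    fun hp => ⟨CliffMod.tmul_one_injective _ k hk,
      fun E => (E.eigen k (fun _ => rfl) (ζ ^ 0)).cls - (E.eigen k (fun _ => rfl) (ζ ^ 1)).cls,
      fun E _ => CliffMod.eigen_sub_tmul_one hp hz E _, fun E₀ E₁ h₀ h₁ => ?_⟩,
    fun hk' E hE => ?_⟩
  · apply CliffMod.tmul_one_injective _ k hk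
    beta_reduce
    rw [TensorProduct.add_tmul, CliffMod.eigen_sub_tmul_one hp hz,
      CliffMod.eigen_sub_tmul_one hp hz, CliffMod.eigen_sub_tmul_one hp hz,
      CliffMod.psiBar_prod hp hu hz h₀ h₁]
  · exact ⟨fun i hi hik => (CliffMod.lambda_isFGP_and_cls hE hi
      (CliffMod.isUnit_factorial_of_le hik hk') fun _ => rfl).1,
      CliffMod.psiBar_eq_adams_tmul_one hk hk' hζ hE⟩
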